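/- Let $n\ge 1$. Let $\mathcal P_{2n}$ be the space of positive definite symmetric real $2n\times 2n$ matrices $X$, with coordinates $X_{ij}=X_{ji}$, and let $L\mathcal P_{2n}=\mathcal P_{2n}/\mathbb R_{>0}$ be its quotient by positive scalings. Smooth forms on $L\mathcal P_{2n}$ are identified, by pullback, with the smooth forms on $\mathcal P_{2n}$ that are invariant under positive scalings and are annihilated by contraction with the Euler vector field $E=\sum_{i\le j}X_{ij}\,\partial/\partial X_{ij}$. Consider on $\mathcal P_{2n}$ the differential forms $$\beta^{4k+1}_X=\operatorname{tr}\big((X^{-1}dX)^{4k+1}\big)\quad(k\ge 1),\qquad \phi^{2n}_X=\frac{\operatorname{Pf}(dX\cdot X^{-1}\cdot dX)}{\sqrt{\det X}},\qquad \eta^{2n}_X=\iota_E\Big(\frac{1}{(\det X)^{(2n+1)/2}}\bigwedge_{i\le j}dX_{ij}\Big),$$ where $\operatorname{Pf}(M)=\frac1{2^n n!}\sum_{\pi\in S_{2n}}\operatorname{sgn}(\pi)\,M_{\pi(1)\pi(2)}\cdots M_{\pi(2n-1)\pi(2n)}$, square roots are positive, and the product over $i\le j$ is ordered lexicographically in $(i,j)$.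 (1) There is a non-zero integer $c_n$ such that $$\beta^5\wedge\beta^9\wedge\cdots\wedge\beta^{4n-3}\wedge\phi^{2n}=c_n\,\eta^{2n}$$ as differential forms on $\mathcal P_{2n}$ (for $n=1$ the product of the $\beta$'s is empty, equal to $1$). (2) Let $\Omega^\bullet_{nc}(2n-1)$ be the graded exterior algebra over $\mathbb Q$ on formal generators $\beta^{4k+1}$ of degree $4k+1$, $1\le k<n-1$ (that is, $\beta^5,\dots,\beta^{4n-7}$), which maps to differential forms on $\mathcal P_{2n}$ by the homomorphism of $\mathbb Q$-algebras sending each generator $\beta^{4k+1}$ to the form $\beta^{4k+1}_X$. Then $\omega\mapsto\omega\wedge\phi^{2n}$ maps $\Omega^\bullet_{nc}(2n-1)$ into the space of smooth differential forms on $L\mathcal P_{2n}$ satisfying $\omega(g^{\intercal}Xg)=\operatorname{sgn}(\det g)\,\omega(X)$ for all $g\in \mathrm{GL}_{2n}(\mathbb R)$, where $\omega(g^{\intercal}Xg)$ denotes the pullback of $\omega$ along $X\mapsto g^{\intercal}Xg$, and this map is injective. -/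

import Mathlib

open scoped Matrix

namespace PfaffianForms

noncomputable section

/-! ### Symmetric and positive definite matrices -/

/-- The real vector space of symmetric `m × m` matrices. -/
def symMat (m : ℕ) : Submodule ℝ (Matrix (Fin m) (Fin m) ℝ) where
  carrier := {X | X.IsSymm}
  add_mem' hX hY := Matrix.IsSymm.add hX hY
  zero_mem' := Matrix.isSymm_zero
  smul_mem' c _ hX := Matrix.IsSymm.smul hX c

/-- The space `𝒫_m` of positive definite symmetric real `m × m` matrices. It is an open cone in
`symMat m`, so that its tangent space at every point is `symMat m`. -/
abbrev SPD (m : ℕ) : Type := {X : symMat m // (X : Matrix (Fin m) (Fin m) ℝ).PosDef}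

/-- The underlying matrix of a point of `𝒫_m`. -/
def SPD.mat {m : ℕ} (X : SPD m) : Matrix (Fin m) (Fin m) ℝ := X.1.1

/-! ### Differential forms on `𝒫_m` -/

/-- The exterior algebra on the cotangent space of `𝒫_m` (the same space at every point). -/
abbrev Ext (m : ℕ) : Type := ExteriorAlgebra ℝ (Module.Dual ℝ (symMat m))

/-- Differential forms on `𝒫_m`, of mixed degree and not necessarily smooth. The pointwise product
is the exterior product. -/
abbrev Form (m : ℕ) : Type := SPD m → Ext m

section
attribute [local instance] Matrix.normedAddCommGroup Matrix.normedSpace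

/-- A form is smooth if all its coefficients with respect to the constant forms are smooth
functions on the open cone `𝒫_m` (the choice of the norm on matrices is irrelevant). -/
def IsSmooth {m : ℕ} (ω : Form m) : Prop :=
  ∀ l : Module.Dual ℝ (Ext m), ∃ f : symMat m → ℝ,
    ContDiffOn ℝ ((⊤ : ℕ∞) : WithTop ℕ∞) f {Y | (Y : Matrix (Fin m) (Fin m) ℝ).PosDef} ∧ ∀ X : SPD m, f X.1 = l (ω X)

theorem IsSmooth.add {m : ℕ} {a b : Form m} (ha : IsSmooth a) (hb : IsSmooth b) :
    IsSmooth (a + b) := fun l => by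
  obtain ⟨f, hf, hf'⟩ := ha l
  obtain ⟨g, hg, hg'⟩ := hb l
  exact ⟨f + g, hf.add hg, fun X => by simp [hf', hg']⟩

theorem IsSmooth.zero {m : ℕ} : IsSmooth (0 : Form m) := fun l =>
  ⟨0, contDiffOn_const, fun X => by simp⟩

theorem IsSmooth.smul {m : ℕ} {a : Form m} (c : ℝ) (ha : IsSmooth a) :
    IsSmooth (c • a) := fun l => by
  obtain ⟨f, hf, hf'⟩ := ha l
  exact ⟨c • f, hf.const_smul c, fun X => by simp [hf']⟩

end

/-- The one-form `dX_{ij}`, an element of the exterior algebra. -/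
def dX {m : ℕ} (i j : Fin m) : Ext m :=
  ExteriorAlgebra.ι ℝ ((Matrix.entryLinearMap ℝ ℝ i j).comp (symMat m).subtype)

/-- The matrix `dX` of one-forms. -/
def dMat (m : ℕ) : Matrix (Fin m) (Fin m) (Ext m) := Matrix.of fun i j => dX i j

/-- The matrix `X⁻¹`, with entries regarded as elements of degree zero of the exterior algebra. -/
def invMat {m : ℕ} (X : SPD m) : Matrix (Fin m) (Fin m) (Ext m) :=
  X.mat⁻¹.map (algebraMap ℝ (Ext m))

/-- Contraction of a form with the Euler vector field `∑_{i ≤ j} X_{ij} ∂/∂X_{ij}`, whose value at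
the point `X` is the tangent vector `X`. -/
def contractEuler {m : ℕ} (ω : Form m) : Form m := fun X =>
  CliffordAlgebra.contractLeft (Q := (0 : QuadraticForm ℝ (Module.Dual ℝ (symMat m))))
    (Module.Dual.eval ℝ (symMat m) X.1) (ω X)

/-- Pullback of forms along the restriction to `𝒫_m` of a linear endomorphism `T` of the space of
symmetric matrices which preserves `𝒫_m`. -/
def pullback {m : ℕ} (T : symMat m →ₗ[ℝ] symMat m)
    (hT : ∀ X : SPD m, (T X.1 : Matrix (Fin m) (Fin m) ℝ).PosDef) (ω : Form m) : Form m := fun X =>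
  ExteriorAlgebra.map T.dualMap (ω ⟨T X.1, hT X⟩)

/-! ### The forms `β^d`, `φ^{2n}` and `η^{2n}` -/

/-- The form `β^d_X = tr ((X⁻¹ dX)^d)`. -/
def beta (m d : ℕ) : Form m := fun X => ((invMat X * dMat m) ^ d).trace

/-- The Pfaffian of a `2n × 2n` matrix. (It is only applied to matrices whose entries commute, so
the order of the factors in the product plays no role.) -/
def pfaffian {A : Type*} [Ring A] [Algebra ℝ A] (n : ℕ)
    (M : Matrix (Fin (2 * n)) (Fin (2 * n)) A) : A :=
  ((2 ^ n * n.factorial : ℝ)⁻¹) • ∑ σ : Equiv.Perm (Fin (2 * n)), (Equiv.Perm.sign σ : ℤ) •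
    (List.ofFn fun i : Fin n =>
      M (σ ⟨2 * i.1, by omega⟩) (σ ⟨2 * i.1 + 1, by omega⟩)).prod

/-- The invariant Pfaffian form `φ^{2n}_X = (det X)^{-1/2} Pf (dX · X⁻¹ · dX)`. -/
def phi (n : ℕ) : Form (2 * n) := fun X =>
  (Real.sqrt X.mat.det)⁻¹ • pfaffian n (dMat (2 * n) * invMat X * dMat (2 * n))

/-- The exterior product of all `dX_{ij}`, `i ≤ j`, ordered lexicographically in `(i, j)`. -/
def coordVolume (m : ℕ) : Ext m :=
  ((List.finRange m).flatMap fun i =>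
    ((List.finRange m).filter fun j => i ≤ j).map fun j => dX i j).prod

/-- The volume form `(det X)^{-(2n+1)/2} ⋀_{i ≤ j} dX_{ij}` on `𝒫_{2n}`. -/
def volumeForm (n : ℕ) : Form (2 * n) := fun X =>
  ((Real.sqrt X.mat.det) ^ (2 * n + 1))⁻¹ • coordVolume (2 * n)

/-- The projective volume orientation form `η^{2n}`: the contraction of the volume form of
`𝒫_{2n}` with the Euler vector field. -/
def eta (n : ℕ) : Form (2 * n) := contractEuler (volumeForm n)

/-- The form `β^5 ∧ β^9 ∧ ⋯ ∧ β^{4n-3}` on `𝒫_{2n}` (equal to `1` for `n = 1`). -/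
def betaProd (n : ℕ) : Form (2 * n) :=
  ((List.range' 1 (n - 1)).map fun k => beta (2 * n) (4 * k + 1)).prod

/-! ### Forms on the link `L𝒫_{2n} = 𝒫_{2n} / ℝ_{>0}` -/

/-- The linear map `X ↦ gᵀ X g` on symmetric matrices. -/
def congr {m : ℕ} (g : Matrix (Fin m) (Fin m) ℝ) : symMat m →ₗ[ℝ] symMat m where
  toFun X := ⟨gᵀ * X.1 * g, by
    have hX : X.1ᵀ = X.1 := X.2
    change (gᵀ * X.1 * g)ᵀ = gᵀ * X.1 * g
    simp [Matrix.transpose_mul, hX, Matrix.mul_assoc]⟩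
  map_add' X Y := by ext1; simp [Matrix.mul_add, Matrix.add_mul]
  map_smul' c X := by ext1; simp

theorem congr_posDef {m : ℕ} (g : GL (Fin m) ℝ) (X : SPD m) :
    (congr g.1 X.1 : Matrix (Fin m) (Fin m) ℝ).PosDef := by
  have h := X.2.conjTranspose_mul_mul_same (B := g.1)
    (Matrix.mulVec_injective_of_isUnit g.isUnit)
  simpa [congr, Matrix.conjTranspose_eq_transpose_of_trivial] using h

theorem smul_posDef {m : ℕ} {t : ℝ} (ht : 0 < t) (X : SPD m) :
    ((t • LinearMap.id : symMat m →ₗ[ℝ] symMat m) X.1 : Matrix (Fin m) (Fin m) ℝ).PosDef :=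
  X.2.smul ht

/-- The sign `ε(g)` of the determinant. -/
def eps {m : ℕ} (g : GL (Fin m) ℝ) : ℝ := g.1.det * |g.1.det|⁻¹

/-- Smooth differential forms on the link `L𝒫_m`, the quotient of `𝒫_m` by positive scalings. They
are identified through pullback with the smooth forms on `𝒫_m` which are invariant under positive
scalings and whose contraction with the Euler vector field, which spans the tangent lines of the
fibres of `𝒫_m → L𝒫_m`, vanishes. -/
def linkForms (m : ℕ) : Submodule ℝ (Form m) where
  carrier := {ω | IsSmooth ω ∧ contractEuler ω = 0 ∧
    ∀ (t : ℝ) (ht : 0 < t), pullback (t • LinearMap.id) (smul_posDef ht) ω = ω}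
  add_mem' {a b} ha hb := by
    refine ⟨ha.1.add hb.1, ?_, fun t ht => ?_⟩
    · funext X
      have h1 := congrFun ha.2.1 X
      have h2 := congrFun hb.2.1 X
      simp only [contractEuler, Pi.zero_apply, Pi.add_apply, map_add] at h1 h2 ⊢
      rw [h1, h2, add_zero]
    · funext X
      have h1 := congrFun (ha.2.2 t ht) X
      have h2 := congrFun (hb.2.2 t ht) X
      simp only [pullback, Pi.add_apply, map_add] at h1 h2 ⊢
      rw [h1, h2]
  zero_mem' :=
    ⟨IsSmooth.zero, by funext X; simp [contractEuler],
      fun t ht => by funext X; simp [pullback]⟩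
  smul_mem' c a ha := by
    refine ⟨ha.1.smul c, ?_, fun t ht => ?_⟩
    · funext X
      have h1 := congrFun ha.2.1 X
      simp only [contractEuler, Pi.zero_apply, Pi.smul_apply, map_smul] at h1 ⊢
      rw [h1, smul_zero]
    · funext X
      have h1 := congrFun (ha.2.2 t ht) X
      simp only [pullback, Pi.smul_apply, map_smul] at h1 ⊢
      rw [h1]

/-- The space of smooth differential forms `ω` on `L𝒫_m` satisfying
`ω(gᵀ X g) = ε(g) ω(X)` for all `g ∈ GL_m(ℝ)`. -/
def linkOrientationForms (m : ℕ) : Submodule ℝ (Form m) where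
  carrier := {ω | ω ∈ linkForms m ∧
    ∀ g : GL (Fin m) ℝ, pullback (congr g.1) (congr_posDef g) ω = eps g • ω}
  add_mem' {a b} ha hb := by
    refine ⟨add_mem ha.1 hb.1, fun g => ?_⟩
    funext X
    have h1 := congrFun (ha.2 g) X
    have h2 := congrFun (hb.2 g) X
    simp only [pullback, Pi.add_apply, Pi.smul_apply, map_add, smul_add] at h1 h2 ⊢
    rw [h1, h2]
  zero_mem' := ⟨zero_mem _, fun g => by funext X; simp [pullback]⟩
  smul_mem' c a ha := by
    refine ⟨Submodule.smul_mem _ c ha.1, fun g => ?_⟩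
    funext X
    have h1 := congrFun (ha.2 g) X
    simp only [pullback, Pi.smul_apply, map_smul] at h1 ⊢
    rw [h1, smul_comm]

/-! ### Canonical forms of non-compact type -/

/-- The indices `k` of the generators `β^{4k+1}` of `Ω_nc(2n-1)`, that is of
`β^5, β^9, …, β^{4n-7}`. -/
abbrev NCIndex (n : ℕ) : Type := {k : ℕ // 1 ≤ k ∧ k + 1 < n}

/-- `Ω_nc(2n-1)`: the exterior algebra over `ℚ` on the formal symbols
`β^{4k+1}`, `1 ≤ k < n - 1`. -/
abbrev OmegaNC (n : ℕ) : Type := ExteriorAlgebra ℚ (NCIndex n →₀ ℚ)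

theorem pow_mem_evenOdd {m : ℕ} {A : Matrix (Fin m) (Fin m) (Ext m)}
    (hA : ∀ i j, A i j ∈ CliffordAlgebra.evenOdd 0 1) (d : ℕ) (i j : Fin m) :
    (A ^ d) i j ∈ CliffordAlgebra.evenOdd 0 (d : ZMod 2) := by
  induction d generalizing j with
  | zero =>
    rw [pow_zero, Matrix.one_apply]
    split_ifs
    · simpa using SetLike.one_mem_graded
        (CliffordAlgebra.evenOdd (0 : QuadraticForm ℝ (Module.Dual ℝ (symMat m))))
    · exact zero_mem _
  | succ d ih =>
    rw [pow_succ, Matrix.mul_apply, Nat.cast_succ]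
    exact Submodule.sum_mem _ fun k _ => SetLike.mul_mem_graded (ih k) (hA k j)

theorem beta_mem_odd (m k : ℕ) (X : SPD m) :
    beta m (4 * k + 1) X ∈ CliffordAlgebra.evenOdd 0 1 := by
  have h : ((4 * k + 1 : ℕ) : ZMod 2) = 1 := by
    have : ((4 : ℕ) : ZMod 2) = 0 := by decide
    push_cast at this ⊢
    rw [this]; simp
  rw [← h]
  unfold beta Matrix.trace
  refine Submodule.sum_mem _ fun i _ => ?_
  rw [Matrix.diag_apply]
  refine pow_mem_evenOdd (fun i j => ?_) _ i i
  rw [Matrix.mul_apply]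
  refine Submodule.sum_mem _ fun l _ => ?_
  rw [invMat, Matrix.map_apply, ← Algebra.smul_def]
  exact Submodule.smul_mem _ _ (CliffordAlgebra.ι_mem_evenOdd_one _ _)

theorem mul_self_of_odd {m : ℕ} {x : Ext m} (hx : x ∈ CliffordAlgebra.evenOdd 0 1) :
    x * x = 0 := by
  let Q : QuadraticForm ℝ (Module.Dual ℝ (symMat m)) := 0
  have h := CliffordAlgebra.map_mul_map_eq_neg_of_isOrtho_of_mem_evenOdd_one
    (QuadraticMap.Isometry.id Q) (QuadraticMap.Isometry.id Q)
    (fun a b => by simp [QuadraticMap.IsOrtho, Q]) x x hx hx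
  simp only [CliffordAlgebra.map_id, AlgHom.id_apply] at h
  have h2 : (2 : ℝ) • (x * x) = 0 := by
    rw [two_smul]
    nth_rewrite 1 [h]
    rw [neg_mul, neg_add_cancel]
  exact (smul_eq_zero.mp h2).resolve_left two_ne_zero

theorem linearCombination_beta_mul_self (n : ℕ) (v : NCIndex n →₀ ℚ) :
    Finsupp.linearCombination ℚ (fun k : NCIndex n => beta (2 * n) (4 * k.1 + 1)) v *
      Finsupp.linearCombination ℚ (fun k : NCIndex n => beta (2 * n) (4 * k.1 + 1)) v = 0 := by
  funext X
  rw [Pi.mul_apply, Pi.zero_apply]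
  apply mul_self_of_odd
  rw [Finsupp.linearCombination_apply, Finsupp.sum, Finset.sum_apply]
  refine Submodule.sum_mem _ fun k _ => ?_
  rw [Pi.smul_apply]
  exact Submodule.smul_of_tower_mem _ _ (beta_mem_odd _ _ _)

/-- The realisation `Ω_nc(2n-1) → Ω(𝒫_{2n})`, the homomorphism of `ℚ`-algebras which sends the
formal symbol `β^{4k+1}` to the form `tr ((X⁻¹ dX)^{4k+1})`. -/
def realize (n : ℕ) : OmegaNC n →ₐ[ℚ] Form (2 * n) :=
  ExteriorAlgebra.lift ℚ
    ⟨Finsupp.linearCombination ℚ (fun k : NCIndex n => beta (2 * n) (4 * k.1 + 1)),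
      linearCombination_beta_mul_self n⟩

/-- The map `ω ↦ ω ∧ φ^{2n}` on `Ω_nc(2n-1)`. -/
def wedgePhi (n : ℕ) : OmegaNC n →ₗ[ℚ] Form (2 * n) :=
  (LinearMap.mulRight ℚ (phi n)).comp (realize n).toLinearMap

end

end PfaffianForms

/-! All the forms involved are equivariant under X ↦ gᵀXg, and this action is transitive on positive
definite matrices (`exists_congr_onePt`), so identities and contractions can be tested at X = 1.
There β^{4k+1} becomes tr(dX^{4k+1}) (`oddTrace`) and φ becomes Pf(dX²). Both halves of the theorem
rest on `pfaffian_mul_oddTraces_ne_zero`: the product of Pf(dX²) with all tr(dX^{4k+1}), 0 ≤ k < n,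
is non-zero.

That in turn follows from `coordVolume_mem_pfaffianIdeal`: the volume element is Pf(dX²) times a
polynomial in the traces tr(dX^d). The only traces that survive are the scalar d = 0 and d = 1, 5,
…, 4n-3 (`trace_dMat_pow_cases`). Since 2n + (1 + 5 + ⋯ + (4n-3)) = n(2n+1) is the top degree, only
the product of all odd traces can contribute to the volume.

To reach the volume element, adjoin anticommuting variables η_1, …, η_m with m = 2n. The element
η_1⋯η_m ⊗ vol is multiplied by det(g)^{m+2} under a change of basis g. The exponent is even, so this
is a polynomial in the entries of gᵀg. Write the transformed element as a polynomial in a generic g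
and pair it, in the Fischer product, with det(g)^{m+2} itself, in the manner of Cayley's Ω-process.
The result is a positive multiple of the original element. On the other hand, multiplication by an
entry of gᵀg is adjoint to a Laplacian ∑_k ∂_{ki}∂_{kj}, and these Laplacians preserve the algebra
generated by the traces and the chains uᵀdX^d u (`ChainData.laplacian_mem`). Setting g = 0 leaves a
polynomial in the traces and in ηᵀdX^dη. The Berezin integral over η then isolates vol. Integration
by parts along the vector fields (dX^b η)∂_η turns each ηᵀdX^{b+2}η into ηᵀdX²η at the cost of
traces (`berezin_prod_mul_pow_mem`), and the integral of (ηᵀdX²η)^n is a multiple of Pf(dX²).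

For part (1), the left side w at X = 1 is killed by the Euler contraction, while dX_{00} ∧ w is an
integral form of top degree, hence an integer multiple of the volume; contracting gives w = cη. For
part (2), a non-zero kernel, being a left ideal, would contain the product of all the generators
(`basis_univ_mem_of_ne_bot`), contradicting the non-vanishing. -/

open scoped Matrix

namespace PfaffianForms

noncomputable section

/-! ### The top coefficient functional on an exterior algebra -/

section TopCoeff

open ExteriorAlgebra Module

variable {V : Type*} [AddCommGroup V] [Module ℝ V] {N : ℕ} (b : Basis (Fin N) ℝ V)

/-- The coefficient of `b 0 ∧ ⋯ ∧ b (N-1)` of an element of the exterior algebra. -/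
def topCoeff : ExteriorAlgebra ℝ V →ₗ[ℝ] ℝ :=
  liftAlternating fun i => if h : i = N then h ▸ b.det else 0

theorem topCoeff_ιMulti (v : Fin N → V) : topCoeff b (ιMulti ℝ N v) = b.det v := by
  rw [topCoeff, liftAlternating_apply_ιMulti]
  simp

theorem topCoeff_ιMulti_of_ne {p : ℕ} (hp : p ≠ N) (v : Fin p → V) :
    topCoeff b (ιMulti ℝ p v) = 0 := by
  rw [topCoeff, liftAlternating_apply_ιMulti]
  simp [hp]

theorem topCoeff_ιMulti_self : topCoeff b (ιMulti ℝ N b) = 1 := by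
  rw [topCoeff_ιMulti, Basis.det_self]

theorem topCoeff_of_mem_exteriorPower {p : ℕ} (hp : p ≠ N) {x : ExteriorAlgebra ℝ V}
    (hx : x ∈ ⋀[ℝ]^p V) : topCoeff b x = 0 := by
  rw [← ιMulti_span_fixedDegree] at hx
  induction hx using Submodule.span_induction with
  | mem x h => obtain ⟨v, rfl⟩ := h; exact topCoeff_ιMulti_of_ne b hp v
  | zero => simp
  | add x y _ _ hx hy => simp [hx, hy]
  | smul c x _ hx => simp [hx]

/-- The top exterior power is a line: an alternating map in N variables is determined by its values
on permutations of the basis, where both sides carry the same sign. -/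
theorem eq_topCoeff_smul {x : ExteriorAlgebra ℝ V} (hx : x ∈ ⋀[ℝ]^N V) :
    x = topCoeff b x • ιMulti ℝ N b := by
  rw [← ιMulti_span_fixedDegree] at hx
  induction hx using Submodule.span_induction with
  | mem x h =>
    obtain ⟨v, rfl⟩ := h
    rw [topCoeff_ιMulti]
    have h3 : (ιMulti ℝ N -
      (LinearMap.toSpanSingleton ℝ _ (ιMulti ℝ N b)).compAlternatingMap b.det) = 0 := by
      refine Basis.ext_alternating b fun w hw => ?_
      obtain ⟨σ, rfl⟩ : ∃ σ : Equiv.Perm (Fin N), w = σ :=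
        ⟨Equiv.ofBijective w (Finite.injective_iff_bijective.mp hw), rfl⟩
      have h4 := (ιMulti ℝ N).map_perm b σ
      have h5 := b.det.map_perm b σ
      simp only [Function.comp_def, Basis.det_self] at h4 h5
      simp [h4, h5]
    have h4 := DFunLike.congr_fun h3 v
    simpa [sub_eq_zero] using h4
  | zero => simp
  | add x y _ _ hx hy => rw [map_add, add_smul, ← hx, ← hy]
  | smul c x _ hx => rw [map_smul, smul_assoc, ← hx]

theorem topCoeff_map (f : V →ₗ[ℝ] V) (x : ExteriorAlgebra ℝ V) :
    topCoeff b (ExteriorAlgebra.map f x) = LinearMap.det f * topCoeff b x := by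
  suffices h : topCoeff b ∘ₗ (ExteriorAlgebra.map f).toLinearMap = LinearMap.det f • topCoeff b from
    LinearMap.congr_fun h x
  refine lhom_ext fun p => AlternatingMap.ext fun v => ?_
  simp only [LinearMap.compAlternatingMap_apply, LinearMap.comp_apply, AlgHom.toLinearMap_apply,
    map_apply_ιMulti, LinearMap.smul_apply]
  by_cases hp : p = N
  · subst hp
    rw [topCoeff_ιMulti, topCoeff_ιMulti, Basis.det_comp, smul_eq_mul]
  · rw [topCoeff_ιMulti_of_ne _ hp, topCoeff_ιMulti_of_ne _ hp, smul_zero]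

/-- Contraction with d followed by multiplication by w is the even derivation extending v ↦ d(v)w,
so it acts on one factor of a product at a time, without signs. -/
theorem ι_mul_contractLeft_ιMulti (d : Dual ℝ V) (w : V) {p : ℕ} (v : Fin p → V) :
    ι ℝ w * CliffordAlgebra.contractLeft (Q := (0 : QuadraticForm ℝ V)) d (ιMulti ℝ p v) =
      ∑ s, ιMulti ℝ p (Function.update v s (d (v s) • w)) := by
  induction p with
  | zero =>
    rw [ιMulti_zero_apply]
    have := CliffordAlgebra.contractLeft_one (Q := (0 : QuadraticForm ℝ V)) d
    rw [show CliffordAlgebra.contractLeft (Q := (0 : QuadraticForm ℝ V)) d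
      (1 : ExteriorAlgebra ℝ V) = 0 from this]
    simp
  | succ p ih =>
    rw [ιMulti_succ_apply]
    have h1 : CliffordAlgebra.contractLeft (Q := (0 : QuadraticForm ℝ V)) d
        (ι ℝ (v 0) * ιMulti ℝ p (Matrix.vecTail v)) = d (v 0) • ιMulti ℝ p (Matrix.vecTail v) -
          ι ℝ (v 0) * CliffordAlgebra.contractLeft (Q := (0 : QuadraticForm ℝ V)) d
            (ιMulti ℝ p (Matrix.vecTail v)) :=
      CliffordAlgebra.contractLeft_ι_mul (Q := (0 : QuadraticForm ℝ V)) d _ _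
    have h2 : ι ℝ w * ι ℝ (v 0) = - (ι ℝ (v 0) * ι ℝ w) :=
      eq_neg_of_add_eq_zero_left (ι_add_mul_swap w (v 0))
    rw [h1, mul_sub, mul_smul_comm, ← mul_assoc, h2, neg_mul, sub_neg_eq_add, mul_assoc, ih,
      Fin.sum_univ_succ, Finset.mul_sum, ιMulti_succ_apply]
    congr 1
    · simp only [Function.update_self, map_smul, smul_mul_assoc]
      congr 2
    · refine Finset.sum_congr rfl fun s _ => ?_
      rw [ιMulti_succ_apply, Function.update_of_ne (Fin.succ_ne_zero s).symm]
      congr 2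
      funext t
      simp only [Matrix.vecTail, Function.comp_apply, Function.update_apply, Fin.succ_inj]

/-- The derivation induced by an elementary matrix acts on the top power by its trace. In
coordinates this is Cramer's rule: the sum over replaced columns is the k-th entry of A ·
cramer(A)(e_l) = det(A) e_l. -/
theorem topCoeff_ι_mul_contractLeft (k l : Fin N) (x : ExteriorAlgebra ℝ V) :
    topCoeff b (ι ℝ (b l) * CliffordAlgebra.contractLeft (Q := (0 : QuadraticForm ℝ V))
      (b.coord k) x) = if k = l then topCoeff b x else 0 := by
  suffices h : topCoeff b ∘ₗ LinearMap.mulLeft ℝ (ι ℝ (b l)) ∘ₗ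
      CliffordAlgebra.contractLeft (Q := (0 : QuadraticForm ℝ V)) (b.coord k) =
      (if k = l then (1 : ℝ) else 0) • topCoeff b by
    have := LinearMap.congr_fun h x
    split_ifs at this ⊢ <;> simpa using this
  refine lhom_ext fun p => AlternatingMap.ext fun v => ?_
  simp only [LinearMap.compAlternatingMap_apply, LinearMap.comp_apply, LinearMap.mulLeft_apply,
    LinearMap.smul_apply]
  rw [ι_mul_contractLeft_ιMulti, map_sum]
  by_cases hp : p = N
  · subst hp
    simp only [topCoeff_ιMulti, Basis.det_apply]
    have h := congrFun (Matrix.mulVec_cramer (b.toMatrix v) (Pi.single l 1)) k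
    have h3 : ∀ s, (b.toMatrix (Function.update v s (b.coord k (v s) • b l))).det =
        b.toMatrix v k s * (b.toMatrix v).cramer (Pi.single l 1) s := by
      intro s
      rw [Basis.toMatrix_update, Matrix.cramer_apply, map_smul, Finsupp.coe_smul,
        Matrix.det_updateCol_smul, Basis.repr_self, Finsupp.single_eq_pi_single]
      rfl
    simp only [h3]
    rw [Matrix.mulVec, dotProduct] at h
    rw [h]
    simp [Pi.single_apply, mul_comm]
  · simp [topCoeff_ιMulti_of_ne _ hp]

/-- A word in the basis vectors has as top coefficient either zero or the determinant of a matrix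
with entries 0 and 1. -/
theorem topCoeff_mem_int {x : ExteriorAlgebra ℝ V}
    (hx : x ∈ Subring.closure (Set.range fun i => ι ℝ (b i))) : ∃ z : ℤ, topCoeff b x = z := by
  have h : x ∈ AddSubgroup.closure
      (Submonoid.closure (Set.range fun i => ι ℝ (b i)) : Set (ExteriorAlgebra ℝ V)) := by
    rwa [← Subring.mem_closure_iff]
  clear hx
  induction h using AddSubgroup.closure_induction with
  | mem x h =>
    obtain ⟨l, hl, rfl⟩ := Submonoid.exists_list_of_mem_closure h
    choose f hf using hl
    have : l.prod = ιMulti ℝ l.length (fun i => b (f l[i] (List.getElem_mem i.2))) := by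
      rw [ιMulti_apply]
      congr 1
      refine List.ext_getElem (by simp) fun i h1 h2 => ?_
      simpa using (hf l[i] (List.getElem_mem h1)).symm
    rw [this]
    by_cases hp : l.length = N
    · have hgen : ∀ (p : ℕ) (hp : p = N) (g : Fin p → Fin N),
          ∃ z : ℤ, topCoeff b (ιMulti ℝ p fun i => b (g i)) = z := by
        rintro p rfl g
        refine ⟨(Matrix.of fun i j => if g j = i then (1 : ℤ) else 0).det, ?_⟩
        rw [topCoeff_ιMulti, Basis.det_apply]
        refine Eq.trans ?_ ((Int.castRingHom ℝ).map_det _).symm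
        congr 1
        ext i j
        simp [Basis.toMatrix_apply, Finsupp.single_apply]
      exact hgen _ hp _
    · exact ⟨0, by rw [topCoeff_ιMulti_of_ne _ hp]; simp⟩
  | zero => exact ⟨0, by simp⟩
  | add x y _ _ hx hy =>
    obtain ⟨a, ha⟩ := hx
    obtain ⟨c, hc⟩ := hy
    exact ⟨a + c, by simp [ha, hc]⟩
  | neg x _ hx =>
    obtain ⟨a, ha⟩ := hx
    exact ⟨-a, by simp [ha]⟩

end TopCoeff

/-! ### Parity and contraction -/

section Parity

open ExteriorAlgebra Module

variable {V W : Type*} [AddCommGroup V] [Module ℝ V] [AddCommGroup W] [Module ℝ W]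

/-- The grade involution of the exterior algebra. -/
def parity : ExteriorAlgebra ℝ V →ₐ[ℝ] ExteriorAlgebra ℝ V :=
  CliffordAlgebra.involute (Q := (0 : QuadraticForm ℝ V))

@[simp] theorem parity_ι (v : V) : parity (ι ℝ v) = -ι ℝ v :=
  CliffordAlgebra.involute_ι v

/-- Contraction of an element of the exterior algebra with a linear form. -/
def contract (d : Dual ℝ V) : ExteriorAlgebra ℝ V →ₗ[ℝ] ExteriorAlgebra ℝ V :=
  CliffordAlgebra.contractLeft (Q := (0 : QuadraticForm ℝ V)) d

theorem contract_ι_mul (d : Dual ℝ V) (v : V) (x : ExteriorAlgebra ℝ V) :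
    contract d (ι ℝ v * x) = d v • x - ι ℝ v * contract d x :=
  CliffordAlgebra.contractLeft_ι_mul (Q := (0 : QuadraticForm ℝ V)) d v x

theorem contract_algebraMap (d : Dual ℝ V) (r : ℝ) :
    contract d (algebraMap ℝ (ExteriorAlgebra ℝ V) r) = 0 :=
  CliffordAlgebra.contractLeft_algebraMap (Q := (0 : QuadraticForm ℝ V)) d r

theorem contract_one (d : Dual ℝ V) : contract d (1 : ExteriorAlgebra ℝ V) = 0 := by
  simpa using contract_algebraMap d 1

theorem contract_ι (d : Dual ℝ V) (v : V) :
    contract d (ι ℝ v) = algebraMap ℝ (ExteriorAlgebra ℝ V) (d v) :=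
  CliffordAlgebra.contractLeft_ι (Q := (0 : QuadraticForm ℝ V)) d v

/-- Induction on an element of the exterior algebra, multiplying by vectors on the left. -/
theorem exterior_left_induction {P : ExteriorAlgebra ℝ V → Prop}
    (algebraMap : ∀ r, P (algebraMap ℝ _ r)) (add : ∀ x y, P x → P y → P (x + y))
    (ι_mul : ∀ x m, P x → P (ι ℝ m * x)) (x : ExteriorAlgebra ℝ V) : P x :=
  CliffordAlgebra.left_induction (Q := (0 : QuadraticForm ℝ V)) algebraMap add ι_mul x

theorem contract_mul (d : Dual ℝ V) (x y : ExteriorAlgebra ℝ V) :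
    contract d (x * y) = contract d x * y + parity x * contract d y := by
  induction x using exterior_left_induction with
  | algebraMap r =>
    rw [contract_algebraMap, AlgHom.commutes, ← Algebra.smul_def, ← Algebra.smul_def, map_smul,
      zero_mul, zero_add]
  | add x x' hx hx' => rw [add_mul, map_add, map_add, map_add, hx, hx']; noncomm_ring
  | ι_mul x v hx =>
    rw [mul_assoc, contract_ι_mul, contract_ι_mul, hx, map_mul, parity_ι, sub_mul, smul_mul_assoc]
    noncomm_ring

theorem contract_map (f : V →ₗ[ℝ] W) (d : Dual ℝ W) (x : ExteriorAlgebra ℝ V) :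
    contract d (ExteriorAlgebra.map f x) = ExteriorAlgebra.map f (contract (d ∘ₗ f) x) := by
  induction x using exterior_left_induction with
  | algebraMap r => rw [AlgHom.commutes, contract_algebraMap, contract_algebraMap, map_zero]
  | add x x' hx hx' => simp only [map_add, hx, hx']
  | ι_mul x v hx =>
    simp only [map_mul, map_apply_ι, contract_ι_mul, map_sub, map_smul, hx, LinearMap.comp_apply]

theorem mul_ι_eq (x : ExteriorAlgebra ℝ V) (v : V) : x * ι ℝ v = ι ℝ v * parity x := by
  induction x using exterior_left_induction with
  | algebraMap r => rw [AlgHom.commutes, Algebra.commutes]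
  | add x x' hx hx' => rw [map_add, add_mul, mul_add, hx, hx']
  | ι_mul x w hx =>
    have h2 : ι ℝ w * ι ℝ v = - (ι ℝ v * ι ℝ w) := eq_neg_of_add_eq_zero_left (ι_add_mul_swap w v)
    rw [mul_assoc, hx, ← mul_assoc, h2, map_mul, parity_ι]
    noncomm_ring

/-- Even elements are central, because moving a vector past x costs exactly the grade involution of
x. -/
theorem commute_of_parity_eq {x : ExteriorAlgebra ℝ V} (hx : parity x = x)
    (y : ExteriorAlgebra ℝ V) : x * y = y * x := by
  induction y using exterior_left_induction with
  | algebraMap r => rw [Algebra.commutes]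
  | add y y' hy hy' => rw [mul_add, add_mul, hy, hy']
  | ι_mul y v hy => rw [← mul_assoc, mul_ι_eq, hx, mul_assoc, hy, mul_assoc]

end Parity

/-! ### The Pfaffian as a top coefficient -/

section Pfaffian

open ExteriorAlgebra Module TensorProduct

theorem sum_pow_eq_sum_ofFn {R ι : Type*} [Ring R] [Fintype ι] (z : ι → R) (p : ℕ) :
    (∑ q, z q) ^ p = ∑ κ : Fin p → ι, (List.ofFn fun i => z (κ i)).prod := by
  induction p with
  | zero => simp
  | succ p ih =>
    rw [pow_succ', ih, Finset.sum_mul_sum, ← Finset.sum_product', Finset.univ_product_univ]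
    refine Fintype.sum_equiv (Fin.consEquiv fun _ => ι) _ _ fun x => ?_
    simp [List.ofFn_succ, Fin.consEquiv]

theorem prod_ofFn_tmul {A B : Type*} [Ring A] [Algebra ℝ A] [Ring B] [Algebra ℝ B] {p : ℕ}
    (x : Fin p → A) (y : Fin p → B) :
    (List.ofFn fun i => x i ⊗ₜ[ℝ] y i).prod = (List.ofFn x).prod ⊗ₜ[ℝ] (List.ofFn y).prod := by
  induction p with
  | zero => simp [Algebra.TensorProduct.one_def]
  | succ p ih =>
    simp only [List.ofFn_succ, List.prod_cons, ih, Algebra.TensorProduct.tmul_mul_tmul]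

/-- The exterior algebra on `ℝ^m`. -/
abbrev EtaAlg (m : ℕ) : Type := ExteriorAlgebra ℝ (Fin m → ℝ)

/-- The generators of the exterior algebra on `ℝ^m`. -/
def eta1 {m : ℕ} (k : Fin m) : EtaAlg m := ι ℝ (Pi.single k 1)

/-- The Berezin integral over the first factor of `⋀ℝ^m ⊗ A`. -/
def berezin (m : ℕ) (A : Type*) [Ring A] [Algebra ℝ A] : EtaAlg m ⊗[ℝ] A →ₗ[ℝ] A :=
  (TensorProduct.lid ℝ A).toLinearMap ∘ₗ
    LinearMap.rTensor A (topCoeff (Pi.basisFun ℝ (Fin m)))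

@[simp] theorem berezin_tmul {m : ℕ} {A : Type*} [Ring A] [Algebra ℝ A] (x : EtaAlg m) (a : A) :
    berezin m A (x ⊗ₜ a) = topCoeff (Pi.basisFun ℝ (Fin m)) x • a := by
  simp [berezin]

/-- The element `∑ η_k η_l M_{kl}`. -/
def quadElt {m : ℕ} {A : Type*} [Ring A] [Algebra ℝ A] (M : Matrix (Fin m) (Fin m) A) :
    EtaAlg m ⊗[ℝ] A :=
  ∑ k, ∑ l, (eta1 k * eta1 l) ⊗ₜ[ℝ] M k l

theorem quadElt_eq_sum_prod {m : ℕ} {A : Type*} [Ring A] [Algebra ℝ A]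
    (M : Matrix (Fin m) (Fin m) A) :
    quadElt M = ∑ q : Fin m × Fin m, (eta1 q.1 * eta1 q.2) ⊗ₜ[ℝ] M q.1 q.2 :=
  (Fintype.sum_prod_type' fun k l => (eta1 k * eta1 l) ⊗ₜ[ℝ] M k l).symm

theorem ιMulti_two_mul {m n : ℕ} (f : Fin (2 * n) → Fin m) :
    (List.ofFn fun i : Fin n => (eta1 (f ⟨2 * i.1, by omega⟩) * eta1 (f ⟨2 * i.1 + 1, by omega⟩)
      : EtaAlg m)).prod = ιMulti ℝ (2 * n) fun s => Pi.single (f s) 1 := by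
  rw [ιMulti_apply, List.ofFn_mul', List.prod_flatten, List.map_ofFn]
  congr 2
  funext i
  simp [List.ofFn_succ, eta1]

/-- A repeated index kills the wedge, so only permutations remain, each contributing its sign. -/
theorem sum_topCoeff_smul {m : ℕ} {A : Type*} [AddCommGroup A] [Module ℝ A]
    (G : (Fin m → Fin m) → A) :
    ∑ f : Fin m → Fin m,
        topCoeff (Pi.basisFun ℝ (Fin m)) (ιMulti ℝ m fun s => Pi.single (f s) 1) • G f =
      ∑ σ : Equiv.Perm (Fin m), (Equiv.Perm.sign σ : ℤ) • G σ := by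
  refine (Fintype.sum_of_injective (fun σ : Equiv.Perm (Fin m) => (σ : Fin m → Fin m))
    DFunLike.coe_injective _ _ (fun f hf => ?_) (fun σ => ?_)).symm
  · have : ¬ Function.Injective f := fun h =>
      hf ⟨Equiv.ofBijective f (Finite.injective_iff_bijective.mp h), rfl⟩
    rw [ιMulti_eq_zero_of_not_inj, map_zero, zero_smul]
    intro h
    exact this fun a b hab => h (by simp [hab])
  · have h := (ιMulti ℝ m).map_perm (Pi.basisFun ℝ (Fin m)) σ
    have h2 : (ιMulti ℝ m fun s => Pi.single (σ s) (1 : ℝ)) =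
      (Equiv.Perm.sign σ) • ιMulti ℝ m (Pi.basisFun ℝ (Fin m)) := by
      rw [← h]
      congr 1
      funext s
      simp
    rw [h2, map_zsmul_unit, topCoeff_ιMulti_self]
    rcases Int.units_eq_one_or (Equiv.Perm.sign σ) with h | h <;> simp [h]

/-- Functions on `2n` letters correspond to functions from `n` letters to pairs. -/
def pairEquiv (n : ℕ) (α : Type*) : (Fin n → α × α) ≃ (Fin (2 * n) → α) where
  toFun κ s := if s.1 % 2 = 0 then (κ ⟨s.1 / 2, by omega⟩).1 else (κ ⟨s.1 / 2, by omega⟩).2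
  invFun f i := (f ⟨2 * i.1, by omega⟩, f ⟨2 * i.1 + 1, by omega⟩)
  left_inv κ := by
    funext i
    have h : (2 * i.1 + 1) / 2 = i.1 := by omega
    simp [h]
  right_inv f := by
    funext s
    dsimp only
    split_ifs with h
    · congr 1; ext; dsimp only; omega
    · congr 1; ext; dsimp only; omega

/-- The Pfaffian is a Gaussian Berezin integral. No commutativity of A is needed: expanding the
power keeps the matrix entries in the same order as in the definition of `pfaffian`. -/
theorem berezin_quadElt_pow {n : ℕ} {A : Type*} [Ring A] [Algebra ℝ A]
    (M : Matrix (Fin (2 * n)) (Fin (2 * n)) A) :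
    berezin (2 * n) A (quadElt M ^ n) = (2 ^ n * n.factorial : ℝ) • pfaffian n M := by
  rw [quadElt_eq_sum_prod, sum_pow_eq_sum_ofFn]
  rw [pfaffian, smul_smul, mul_inv_cancel₀ (by positivity), one_smul, ← sum_topCoeff_smul
    (fun f => (List.ofFn fun i : Fin n =>
      M (f ⟨2 * i.1, by omega⟩) (f ⟨2 * i.1 + 1, by omega⟩)).prod), map_sum]
  refine Fintype.sum_equiv (pairEquiv n (Fin (2 * n))) _ _ fun κ => ?_
  obtain ⟨f, rfl⟩ := (pairEquiv n (Fin (2 * n))).symm.surjective κ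
  rw [Equiv.apply_symm_apply, prod_ofFn_tmul, berezin_tmul, ← ιMulti_two_mul]
  rfl

theorem sum_comm_four {ι A : Type*} [Fintype ι] [AddCommMonoid A] (F : ι → ι → ι → ι → A) :
    ∑ i, ∑ j, ∑ k, ∑ l, F i j k l = ∑ k, ∑ l, ∑ i, ∑ j, F i j k l := by
  calc ∑ i, ∑ j, ∑ k, ∑ l, F i j k l = ∑ i, ∑ k, ∑ j, ∑ l, F i j k l :=
        Finset.sum_congr rfl fun i _ => Finset.sum_comm
    _ = ∑ k, ∑ i, ∑ j, ∑ l, F i j k l := Finset.sum_comm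
    _ = ∑ k, ∑ i, ∑ l, ∑ j, F i j k l :=
        Finset.sum_congr rfl fun k _ => Finset.sum_congr rfl fun i _ => Finset.sum_comm
    _ = ∑ k, ∑ l, ∑ i, ∑ j, F i j k l := Finset.sum_congr rfl fun k _ => Finset.sum_comm

theorem quadElt_congr {m : ℕ} {A : Type*} [Ring A] [Algebra ℝ A] (g : Matrix (Fin m) (Fin m) ℝ)
    (M : Matrix (Fin m) (Fin m) A) :
    quadElt ((g.map (algebraMap ℝ A))ᵀ * M * g.map (algebraMap ℝ A)) =
      Algebra.TensorProduct.map (ExteriorAlgebra.map (Matrix.mulVecLin gᵀ)) (AlgHom.id ℝ A)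
        (quadElt M) := by
  have h1 : ∀ k, ExteriorAlgebra.map (Matrix.mulVecLin gᵀ) (eta1 k) = ∑ i, g k i • eta1 i := by
    intro k
    simp only [eta1, map_apply_ι, ← map_smul, ← map_sum]
    congr 1
    ext i
    simp [Pi.single_apply, Finset.sum_apply]
  have h2 : ∀ i j, ((g.map (algebraMap ℝ A))ᵀ * M * g.map (algebraMap ℝ A)) i j =
      ∑ k, ∑ l, (g k i * g l j) • M k l := by
    intro i j
    simp only [Matrix.mul_apply, Finset.sum_mul, Matrix.transpose_apply, Matrix.map_apply]
    rw [Finset.sum_comm]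
    refine Finset.sum_congr rfl fun k _ => Finset.sum_congr rfl fun l _ => ?_
    rw [← Algebra.smul_def, ← Algebra.commutes, ← Algebra.smul_def, smul_smul, mul_comm]
  simp only [quadElt, map_sum, Algebra.TensorProduct.map_tmul, AlgHom.id_apply, map_mul, h1, h2,
    Finset.sum_mul_sum, TensorProduct.sum_tmul, TensorProduct.tmul_sum]
  rw [sum_comm_four]
  refine Finset.sum_congr rfl fun k _ => Finset.sum_congr rfl fun l _ =>
    Finset.sum_congr rfl fun i _ => Finset.sum_congr rfl fun j _ => ?_
  rw [smul_mul_smul_comm, TensorProduct.tmul_smul, TensorProduct.smul_tmul']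

theorem berezin_map {m : ℕ} {A : Type*} [Ring A] [Algebra ℝ A] (f : (Fin m → ℝ) →ₗ[ℝ] Fin m → ℝ)
    (x : EtaAlg m ⊗[ℝ] A) :
    berezin m A (Algebra.TensorProduct.map (ExteriorAlgebra.map f) (AlgHom.id ℝ A) x) =
      LinearMap.det f • berezin m A x := by
  induction x using TensorProduct.induction_on with
  | zero => simp
  | add x y hx hy => simp only [map_add, smul_add, hx, hy]
  | tmul x a => simp [topCoeff_map, mul_smul]

/-- A congruence of the matrix is a linear change of the variables η, under which the Berezin
integral scales by the determinant. -/
theorem pfaffian_congr {n : ℕ} {A : Type*} [Ring A] [Algebra ℝ A]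
    (g : Matrix (Fin (2 * n)) (Fin (2 * n)) ℝ) (M : Matrix (Fin (2 * n)) (Fin (2 * n)) A) :
    pfaffian n ((g.map (algebraMap ℝ A))ᵀ * M * g.map (algebraMap ℝ A)) =
      g.det • pfaffian n M := by
  have h := berezin_quadElt_pow ((g.map (algebraMap ℝ A))ᵀ * M * g.map (algebraMap ℝ A))
  rw [quadElt_congr, ← map_pow, berezin_map, berezin_quadElt_pow, smul_comm,
    ← Matrix.toLin'_apply', LinearMap.det_toLin', Matrix.det_transpose] at h
  exact (smul_right_injective A (r := (2 ^ n * n.factorial : ℝ)) (by positivity) h).symm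

/-- For commuting elements of square zero, the p-th power of the sum is p! times the elementary
symmetric polynomial. This divisibility cancels the n! in the denominator of the Pfaffian. -/
theorem sum_pow_mem_factorial {R ι : Type*} [Ring R] (L : Subring R) (z : ι → R)
    (hL : ∀ i, z i ∈ L) (hz : ∀ i, z i * z i = 0) (hc : ∀ i j, z i * z j = z j * z i)
    (s : Finset ι) (p : ℕ) : ∃ e ∈ L, (∑ i ∈ s, z i) ^ p = p.factorial • e := by
  classical
  induction s using Finset.induction_on generalizing p with
  | empty =>
    rcases p with _ | p
    · exact ⟨1, L.one_mem, by simp⟩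
    · exact ⟨0, L.zero_mem, by simp⟩
  | insert a s ha ih =>
    rcases p with _ | p
    · exact ⟨1, L.one_mem, by simp⟩
    obtain ⟨e, he, h1⟩ := ih (p + 1)
    obtain ⟨e', he', h2⟩ := ih p
    refine ⟨e + z a * e', L.add_mem he (L.mul_mem (hL a) he'), ?_⟩
    have hcomm : Commute (z a) (∑ i ∈ s, z i) := Commute.sum_right _ _ _ fun i _ => hc a i
    have key : ∀ q, (z a + ∑ i ∈ s, z i) ^ (q + 1) =
        (∑ i ∈ s, z i) ^ (q + 1) + (q + 1) • (z a * (∑ i ∈ s, z i) ^ q) := by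
      intro q
      induction q with
      | zero => simp [add_comm]
      | succ q ihq =>
        rw [pow_succ, ihq, add_mul, mul_add, mul_add, ← pow_succ, smul_mul_assoc, smul_mul_assoc,
          mul_assoc (z a), mul_assoc (z a), ← pow_succ, ← (hcomm.pow_right q).eq, ← mul_assoc (z a),
          hz, zero_mul, smul_zero, zero_add, ← (hcomm.pow_right (q + 1)).eq, succ_nsmul _ (q + 1)]
        abel
    rw [Finset.sum_insert ha, key, h1, h2, smul_add, Nat.factorial_succ, mul_smul_comm, smul_smul]

/-- The Pfaffian of an antisymmetric matrix is an integral polynomial in its entries. -/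
theorem pfaffian_mem_closure {n : ℕ} {A : Type*} [Ring A] [Algebra ℝ A]
    (M : Matrix (Fin (2 * n)) (Fin (2 * n)) A) (hM : ∀ i j, M j i = -M i j)
    (hc : ∀ i j k l, M i j * M k l = M k l * M i j) (L : Subring A) (hL : ∀ i j, M i j ∈ L) :
    pfaffian n M ∈ L := by
  have hdiag : ∀ i, M i i = 0 := by
    intro i
    have h := hM i i
    have h2 : (2 : ℝ) • M i i = 0 := by
      rw [two_smul]; nth_rewrite 1 [h]; exact neg_add_cancel _
    exact (smul_eq_zero.mp h2).resolve_left two_ne_zero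
  have hanti : ∀ i j : Fin (2 * n), (eta1 i * eta1 j : EtaAlg (2 * n)) = -(eta1 j * eta1 i) :=
    fun i j => eq_neg_of_add_eq_zero_left (ι_add_mul_swap _ _)
  let z : Fin (2 * n) × Fin (2 * n) → EtaAlg (2 * n) ⊗[ℝ] A :=
    fun q => (eta1 q.1 * eta1 q.2) ⊗ₜ[ℝ] M q.1 q.2
  let s : Finset (Fin (2 * n) × Fin (2 * n)) := Finset.univ.filter fun q => q.1 < q.2
  -- Antisymmetry of both M and η_kη_l makes the terms (k, l) and (l, k) equal; the resulting factor
  -- 2, raised to the n-th power, cancels the 2^n in the Pfaffian.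
  have hsum : quadElt M = 2 • ∑ q ∈ s, z q := by
    rw [quadElt_eq_sum_prod, ← Finset.sum_filter_add_sum_filter_not Finset.univ
      (fun q : Fin (2 * n) × Fin (2 * n) => q.1 < q.2), two_smul]
    congr 1
    rw [← Finset.sum_filter_add_sum_filter_not (Finset.univ.filter _)
      (fun q : Fin (2 * n) × Fin (2 * n) => q.2 < q.1), Finset.filter_filter, Finset.filter_filter]
    refine (congrArg₂ (· + ·) ?_ (Finset.sum_eq_zero fun q hq => ?_)).trans (add_zero _)
    · refine Finset.sum_bij' (fun q _ => q.swap) (fun q _ => q.swap) ?_ ?_ ?_ ?_ ?_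
      · simp [s]
      · simp +contextual [s, le_of_lt]
      · simp
      · simp
      · intro q _
        simp only [z, Prod.fst_swap, Prod.snd_swap]
        rw [hM q.1 q.2, hanti q.2 q.1]
        simp [TensorProduct.neg_tmul, TensorProduct.tmul_neg]
    · rw [Finset.mem_filter] at hq
      rw [show q.2 = q.1 from le_antisymm (not_lt.mp hq.2.1) (not_lt.mp hq.2.2), hdiag,
        TensorProduct.tmul_zero]
  have heta : ∀ i j k l : Fin (2 * n), (eta1 i * eta1 j * (eta1 k * eta1 l) : EtaAlg (2 * n)) =
      eta1 k * eta1 l * (eta1 i * eta1 j) := fun i j k l =>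
    commute_of_parity_eq (by simp [eta1]) _
  have hsq : ∀ i j : Fin (2 * n), (eta1 i * eta1 j * (eta1 i * eta1 j) : EtaAlg (2 * n)) = 0 := by
    intro i j
    rw [mul_assoc, ← mul_assoc (eta1 j), hanti j i, neg_mul, mul_neg, ← mul_assoc, ← mul_assoc,
      eta1, ι_sq_zero]
    simp
  obtain ⟨e, he, hpow⟩ := sum_pow_mem_factorial (Subring.closure (Set.range z)) z
    (fun i => Subring.subset_closure ⟨i, rfl⟩)
    (fun q => by simp only [z, Algebra.TensorProduct.tmul_mul_tmul, hsq, TensorProduct.zero_tmul])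
    (fun q r => by
      simp only [z, Algebra.TensorProduct.tmul_mul_tmul]
      rw [heta, hc]) s n
  have h := berezin_quadElt_pow M
  rw [hsum, smul_pow, hpow, ← Nat.cast_smul_eq_nsmul ℝ, ← Nat.cast_smul_eq_nsmul ℝ, smul_smul,
    map_smul] at h
  push_cast at h
  rw [← smul_right_injective A (r := (2 ^ n * n.factorial : ℝ)) (by positivity) h]
  clear hpow h
  rw [Subring.mem_closure_iff] at he
  induction he using AddSubgroup.closure_induction with
  | mem x hx =>
    have : ∃ w ∈ Subring.closure (Set.range fun i => ι ℝ (Pi.basisFun ℝ (Fin (2 * n)) i)),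
        ∃ a ∈ L, x = w ⊗ₜ[ℝ] a := by
      induction hx using Submonoid.closure_induction with
      | mem x hx =>
        obtain ⟨q, rfl⟩ := hx
        refine ⟨_, Subring.mul_mem _ (Subring.subset_closure ⟨q.1, rfl⟩)
          (Subring.subset_closure ⟨q.2, rfl⟩), _, hL q.1 q.2, ?_⟩
        simp [z, eta1]
      | one => exact ⟨1, Subring.one_mem _, 1, L.one_mem, Algebra.TensorProduct.one_def⟩
      | mul x y _ _ hx hy =>
        obtain ⟨w, hw, a, ha, rfl⟩ := hx
        obtain ⟨w', hw', a', ha', rfl⟩ := hy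
        exact ⟨_, Subring.mul_mem _ hw hw', _, L.mul_mem ha ha',
          Algebra.TensorProduct.tmul_mul_tmul _ _ _ _⟩
    obtain ⟨w, hw, a, ha, rfl⟩ := this
    obtain ⟨c, hc⟩ := topCoeff_mem_int _ hw
    rw [berezin_tmul, hc, Int.cast_smul_eq_zsmul]
    exact zsmul_mem ha c
  | zero => simp
  | add x y _ _ hx hy => rw [map_add]; exact add_mem hx hy
  | neg x _ hx => rw [map_neg]; exact neg_mem hx

end Pfaffian

/-! ### Powers of a symmetric matrix with anticommuting entries -/

section OddMatrix

variable {m : ℕ} {Q : Type*} [Ring Q] {A : Matrix (Fin m) (Fin m) Q}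

theorem entry_mul_pow_entry (hA : ∀ i j k l, A i j * A k l = -(A k l * A i j)) (d : ℕ)
    (i j k l : Fin m) : A i j * (A ^ d) k l = (-1) ^ d * ((A ^ d) k l * A i j) := by
  induction d generalizing k l with
  | zero => by_cases h : k = l <;> simp [h]
  | succ d ih =>
    rw [pow_succ, Matrix.mul_apply, Finset.mul_sum, Finset.sum_mul, Finset.mul_sum]
    refine Finset.sum_congr rfl fun r _ => ?_
    rw [← mul_assoc, ih, mul_assoc, mul_assoc ((A ^ d) k r), hA i j r l, pow_succ]
    simp only [mul_neg, mul_one, neg_mul, mul_assoc]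

/-- The sign of the reversal of a product of `d` odd elements. -/
def revSign (d : ℕ) : ℤ := (-1) ^ (d.choose 2)

theorem revSign_succ (d : ℕ) : revSign (d + 1) = (-1) ^ d * revSign d := by
  rw [revSign, revSign, Nat.choose_succ_succ, pow_add, Nat.choose_one_right]

/-- Transposing a power of a symmetric matrix reverses each product of d anticommuting entries,
which takes d(d-1)/2 transpositions. -/
theorem pow_apply_swap (hA : ∀ i j k l, A i j * A k l = -(A k l * A i j))
    (hs : ∀ i j, A j i = A i j) (d : ℕ) (i j : Fin m) :
    (A ^ d) j i = revSign d • (A ^ d) i j := by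
  induction d generalizing i j with
  | zero => simp [Matrix.one_apply, eq_comm, revSign]
  | succ d ih =>
    rw [pow_succ', Matrix.mul_apply, ← pow_succ', pow_succ, Matrix.mul_apply, Finset.smul_sum]
    refine Finset.sum_congr rfl fun k _ => ?_
    rw [ih i k, mul_smul_comm, entry_mul_pow_entry hA, revSign_succ, hs k j, mul_comm, mul_smul]
    congr 1
    rcases neg_one_pow_eq_or ℤ d with h | h <;> rcases neg_one_pow_eq_or Q d with h' | h' <;>
      rcases Nat.even_or_odd d with hd | hd <;> simp [hd.neg_one_pow]

end OddMatrix

/-! ### Stability of the algebra of chains under contraction operators -/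

/-- A symmetric matrix `A` of odd elements and a family of column vectors `u` commuting with its
entries, in an algebra which carries derivations that are dual to the entries of `u`. -/
structure ChainData (m : ℕ) (I J Q : Type*) [Ring Q] [Algebra ℝ Q] where
  A : Matrix (Fin m) (Fin m) Q
  u : Fin m → I → Q
  α : Q →ₐ[ℝ] Q
  γ : I → Q →ₐ[ℝ] Q
  D : Fin m → J → Q →ₗ[ℝ] Q
  e : J → I → ℝ
  sgn : I → I → ℝ
  A_symm : ∀ i j, A j i = A i j
  mul_A : ∀ y k l, y * A k l = A k l * α y
  mul_u : ∀ y k q, y * u k q = u k q * γ q y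
  α_A : ∀ k l, α (A k l) = -A k l
  α_u : ∀ k q, α (u k q) = u k q
  γ_A : ∀ q k l, γ q (A k l) = A k l
  γ_u : ∀ q k p, γ q (u k p) = sgn q p • u k p
  D_mul : ∀ k j x y, D k j (x * y) = D k j x * y + x * D k j y
  D_A : ∀ k j i l, D k j (A i l) = 0
  D_u : ∀ k j l q, D k j (u l q) = if k = l then algebraMap ℝ Q (e j q) else 0

namespace ChainData

variable {m : ℕ} {I J Q : Type*} [Ring Q] [Algebra ℝ Q] (C : ChainData m I J Q)

/-- The open chain `uᵀ A^d u`. -/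
def chain (d : ℕ) (p q : I) : Q := ∑ k, ∑ l, C.u k p * (C.A ^ d) k l * C.u l q

/-- The half-open chain `A^d u`. -/
def vec (d : ℕ) (q : I) (k : Fin m) : Q := ∑ l, (C.A ^ d) k l * C.u l q

/-- The algebra generated by the chains and the traces of powers. -/
def chainAlg : Subalgebra ℝ Q :=
  Algebra.adjoin ℝ ({x | ∃ d p q, x = C.chain d p q} ∪ {x | ∃ d, x = (C.A ^ d).trace})

theorem chain_mem (d : ℕ) (p q : I) : C.chain d p q ∈ C.chainAlg :=
  Algebra.subset_adjoin (Or.inl ⟨d, p, q, rfl⟩)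

theorem trace_mem (d : ℕ) : (C.A ^ d).trace ∈ C.chainAlg :=
  Algebra.subset_adjoin (Or.inr ⟨d, rfl⟩)

theorem anticomm (i j k l : Fin m) : C.A i j * C.A k l = -(C.A k l * C.A i j) := by
  rw [C.mul_A, C.α_A, mul_neg]

theorem mul_pow_A (y : Q) (d : ℕ) (k l : Fin m) :
    y * (C.A ^ d) k l = (C.A ^ d) k l * (C.α ^ d) y := by
  induction d generalizing k l with
  | zero => by_cases h : k = l <;> simp [h]
  | succ d ih =>
    rw [pow_succ, Matrix.mul_apply, Finset.mul_sum, Finset.sum_mul, pow_succ']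
    refine Finset.sum_congr rfl fun r _ => ?_
    rw [← mul_assoc, ih, mul_assoc, C.mul_A, mul_assoc]
    rfl

theorem α_pow_u (d : ℕ) (k : Fin m) (q : I) : (C.α ^ d) (C.u k q) = C.u k q := by
  induction d with
  | zero => rfl
  | succ d ih => rw [pow_succ', AlgHom.mul_apply, ih, C.α_u]

theorem u_mul_pow_A (d : ℕ) (j k l : Fin m) (q : I) :
    C.u j q * (C.A ^ d) k l = (C.A ^ d) k l * C.u j q := by
  rw [C.mul_pow_A, C.α_pow_u]

theorem mul_vec (y : Q) (d : ℕ) (q : I) (k : Fin m) :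
    y * C.vec d q k = C.vec d q k * C.γ q ((C.α ^ d) y) := by
  rw [vec, Finset.mul_sum, Finset.sum_mul]
  refine Finset.sum_congr rfl fun l _ => ?_
  rw [← mul_assoc, C.mul_pow_A, mul_assoc, C.mul_u, mul_assoc]

theorem α_pow_entry (d : ℕ) (k l : Fin m) : C.α ((C.A ^ d) k l) = (-1 : ℝ) ^ d • (C.A ^ d) k l := by
  induction d generalizing k l with
  | zero => by_cases h : k = l <;> simp [h]
  | succ d ih =>
    rw [pow_succ, Matrix.mul_apply, map_sum, Finset.smul_sum]
    refine Finset.sum_congr rfl fun r _ => ?_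
    rw [map_mul, ih, C.α_A, pow_succ]
    simp

theorem γ_pow_entry (q : I) (d : ℕ) (k l : Fin m) : C.γ q ((C.A ^ d) k l) = (C.A ^ d) k l := by
  induction d generalizing k l with
  | zero => by_cases h : k = l <;> simp [h]
  | succ d ih =>
    rw [pow_succ, Matrix.mul_apply, map_sum]
    refine Finset.sum_congr rfl fun r _ => ?_
    rw [map_mul, ih, C.γ_A]

/-- Chains and traces are eigenvectors of `α`, with eigenvalue (-1)^d. -/
theorem α_mem {x : Q} (hx : x ∈ C.chainAlg) : C.α x ∈ C.chainAlg := by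
  suffices h : C.chainAlg ≤ C.chainAlg.comap C.α from h hx
  refine Algebra.adjoin_le ?_
  rintro x (⟨d, p, q, rfl⟩ | ⟨d, rfl⟩)
  · have : C.α (C.chain d p q) = (-1 : ℝ) ^ d • C.chain d p q := by
      simp [chain, map_sum, map_mul, C.α_u, C.α_pow_entry, Finset.smul_sum]
    change C.α _ ∈ C.chainAlg
    rw [this]
    exact Subalgebra.smul_mem _ (C.chain_mem d p q) _
  · have : C.α (C.A ^ d).trace = (-1 : ℝ) ^ d • (C.A ^ d).trace := by
      simp [Matrix.trace, map_sum, C.α_pow_entry, Finset.smul_sum]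
    change C.α _ ∈ C.chainAlg
    rw [this]
    exact Subalgebra.smul_mem _ (C.trace_mem d) _

theorem α_pow_mem (d : ℕ) {x : Q} (hx : x ∈ C.chainAlg) : (C.α ^ d) x ∈ C.chainAlg := by
  induction d with
  | zero => exact hx
  | succ d ih => rw [pow_succ', AlgHom.mul_apply]; exact C.α_mem ih

theorem γ_mem (r : I) {x : Q} (hx : x ∈ C.chainAlg) : C.γ r x ∈ C.chainAlg := by
  suffices h : C.chainAlg ≤ C.chainAlg.comap (C.γ r) from h hx
  refine Algebra.adjoin_le ?_
  rintro x (⟨d, p, q, rfl⟩ | ⟨d, rfl⟩)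
  · have : C.γ r (C.chain d p q) = (C.sgn r q * C.sgn r p) • C.chain d p q := by
      simp [chain, map_sum, map_mul, C.γ_u, C.γ_pow_entry, Finset.smul_sum, mul_smul]
    change C.γ r _ ∈ C.chainAlg
    rw [this]
    exact Subalgebra.smul_mem _ (C.chain_mem d p q) _
  · have : C.γ r (C.A ^ d).trace = (C.A ^ d).trace := by
      simp [Matrix.trace, map_sum, C.γ_pow_entry]
    change C.γ r _ ∈ C.chainAlg
    rw [this]
    exact C.trace_mem d

/-- The space of vectors spanned over the algebra of chains by the half-open chains. -/
def vecSpan : Submodule ℝ (Fin m → Q) :=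
  Submodule.span ℝ {v | ∃ d q, ∃ s ∈ C.chainAlg, v = fun k => C.vec d q k * s}

/-- Coefficients are kept on the right; one arriving on the left is moved across at the cost of the
automorphisms `α` and `γ`, which preserve the algebra of chains. -/
theorem mul_mem_vecSpan {x : Q} (hx : x ∈ C.chainAlg) {v : Fin m → Q} (hv : v ∈ C.vecSpan) :
    (fun k => x * v k) ∈ C.vecSpan := by
  induction hv using Submodule.span_induction with
  | mem v h =>
    obtain ⟨d, q, s, hs, rfl⟩ := h
    refine Submodule.subset_span ⟨d, q, C.γ q ((C.α ^ d) x) * s,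
      mul_mem (C.γ_mem q (C.α_pow_mem d hx)) hs, ?_⟩
    funext k
    rw [← mul_assoc, C.mul_vec, mul_assoc]
  | zero => convert zero_mem C.vecSpan using 1; funext k; simp
  | add v w _ _ hv hw => convert add_mem hv hw using 1; funext k; simp [mul_add]
  | smul c v _ hv => convert C.vecSpan.smul_mem c hv using 1; funext k; simp

theorem vecSpan_mul_mem {x : Q} (hx : x ∈ C.chainAlg) {v : Fin m → Q} (hv : v ∈ C.vecSpan) :
    (fun k => v k * x) ∈ C.vecSpan := by
  induction hv using Submodule.span_induction with
  | mem v h =>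
    obtain ⟨d, q, s, hs, rfl⟩ := h
    exact Submodule.subset_span ⟨d, q, s * x, mul_mem hs hx, by funext k; rw [mul_assoc]⟩
  | zero => convert zero_mem C.vecSpan using 1; funext k; simp
  | add v w _ _ hv hw => convert add_mem hv hw using 1; funext k; simp [add_mul]
  | smul c v _ hv => convert C.vecSpan.smul_mem c hv using 1; funext k; simp

theorem D_one (k : Fin m) (j : J) : C.D k j 1 = 0 := by
  have h := C.D_mul k j 1 1
  rw [mul_one, one_mul, mul_one] at h
  exact left_eq_add.mp h

theorem D_pow_entry (k : Fin m) (j : J) (d : ℕ) (i l : Fin m) : C.D k j ((C.A ^ d) i l) = 0 := by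
  induction d generalizing i l with
  | zero => by_cases h : i = l <;> simp [h, C.D_one]
  | succ d ih =>
    rw [pow_succ, Matrix.mul_apply, map_sum]
    refine Finset.sum_eq_zero fun r _ => ?_
    rw [C.D_mul, ih, C.D_A, zero_mul, mul_zero, add_zero]

theorem D_vec (k : Fin m) (j : J) (d : ℕ) (q : I) (i : Fin m) :
    C.D k j (C.vec d q i) = C.e j q • (C.A ^ d) i k := by
  rw [vec, map_sum, Finset.sum_eq_single k]
  · rw [C.D_mul, C.D_pow_entry, C.D_u, if_pos rfl, zero_mul, zero_add, ← Algebra.commutes,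
      Algebra.smul_def]
  · intro l _ hl
    rw [C.D_mul, C.D_pow_entry, C.D_u, if_neg hl.symm, zero_mul, mul_zero, add_zero]
  · simp

/-- The derivation removes one of the two end columns and leaves a half-open chain. When the right
end is removed, the power of `A` has to be transposed, whence `revSign`. -/
theorem D_chain (k : Fin m) (j : J) (d : ℕ) (p q : I) :
    C.D k j (C.chain d p q) =
      C.e j p • C.vec d q k + (C.e j q * revSign d) • C.vec d p k := by
  have h : C.chain d p q = ∑ i, C.u i p * C.vec d q i := by
    simp only [chain, vec, Finset.mul_sum, mul_assoc]
  rw [h, map_sum]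
  simp only [C.D_mul, C.D_vec, Finset.sum_add_distrib, C.D_u]
  congr 1
  · simp [Algebra.smul_def]
  · simp only [vec, Finset.smul_sum, mul_smul_comm, mul_smul]
    refine Finset.sum_congr rfl fun i _ => ?_
    rw [C.u_mul_pow_A, pow_apply_swap C.anticomm C.A_symm d k i, smul_mul_assoc,
      Int.cast_smul_eq_zsmul]

theorem D_mem_vecSpan (j : J) {x : Q} (hx : x ∈ C.chainAlg) :
    (fun k => C.D k j x) ∈ C.vecSpan := by
  have hvec : ∀ d q, C.vec d q ∈ C.vecSpan := fun d q =>
    Submodule.subset_span ⟨d, q, 1, one_mem _, by simp⟩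
  induction hx using Algebra.adjoin_induction with
  | mem x h =>
    rcases h with ⟨d, p, q, rfl⟩ | ⟨d, rfl⟩
    · simp only [D_chain]
      exact add_mem (C.vecSpan.smul_mem _ (hvec d q)) (C.vecSpan.smul_mem _ (hvec d p))
    · convert zero_mem C.vecSpan using 1
      funext k
      simp [Matrix.trace, map_sum, C.D_pow_entry]
  | algebraMap r =>
    convert zero_mem C.vecSpan using 1
    funext k
    simp [Algebra.algebraMap_eq_smul_one, C.D_one]
  | add x y _ _ hx hy => convert add_mem hx hy using 1; funext k; simp
  | mul x y hx' hy' hx hy =>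
    simp only [C.D_mul]
    exact add_mem (C.vecSpan_mul_mem hy' hx) (C.mul_mem_vecSpan hx' hy)

/-- Two half-open chains glue along their free ends, once the first power of `A` is transposed. -/
theorem sum_vec_mul_vec (a b : ℕ) (q r : I) :
    ∑ k, C.vec a q k * C.vec b r k = (revSign a : ℝ) • C.chain (a + b) q r := by
  simp only [chain, vec, pow_add, Matrix.mul_apply, Finset.sum_mul_sum, Finset.smul_sum]
  rw [Finset.sum_comm]
  refine Finset.sum_congr rfl fun l _ => ?_
  rw [Finset.sum_comm]
  refine Finset.sum_congr rfl fun l' _ => ?_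
  rw [Finset.mul_sum, Finset.sum_mul, Finset.smul_sum]
  refine Finset.sum_congr rfl fun k _ => ?_
  rw [pow_apply_swap C.anticomm C.A_symm a l k, smul_mul_assoc, ← C.u_mul_pow_A a l l k q,
    Int.cast_smul_eq_zsmul]
  simp only [smul_mul_assoc, mul_assoc]

theorem sum_mul_mem {v w : Fin m → Q} (hv : v ∈ C.vecSpan) (hw : w ∈ C.vecSpan) :
    ∑ k, v k * w k ∈ C.chainAlg := by
  induction hv using Submodule.span_induction with
  | mem v h =>
    obtain ⟨d, q, s, hs, rfl⟩ := h
    have hw' := C.mul_mem_vecSpan hs hw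
    simp only [mul_assoc]
    generalize hw'' : (fun k => s * w k) = w' at hw'
    simp only [funext_iff] at hw''
    simp only [hw'']
    clear hw''
    induction hw' using Submodule.span_induction with
    | mem w' h =>
      obtain ⟨b, r, s', hs', rfl⟩ := h
      simp only [← mul_assoc, ← Finset.sum_mul, sum_vec_mul_vec]
      exact mul_mem (C.chainAlg.smul_mem (C.chain_mem _ _ _) _) hs'
    | zero => simp
    | add v v' _ _ hv hv' => simpa [mul_add, Finset.sum_add_distrib] using add_mem hv hv'
    | smul c v _ hv => simpa [← Finset.smul_sum] using C.chainAlg.smul_mem hv c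
  | zero => simp
  | add v v' _ _ hv hv' => simpa [add_mul, Finset.sum_add_distrib] using add_mem hv hv'
  | smul c v _ hv =>
    simpa [← Finset.smul_sum] using C.chainAlg.smul_mem hv c

/-- By the Leibniz rule, the divergence either removes the end column of the half-open chain, which
closes it up to a trace, or opens a chain in the coefficient, which is then glued to the half-open
one. -/
theorem sum_D_mem (i : J) {v : Fin m → Q} (hv : v ∈ C.vecSpan) :
    ∑ k, C.D k i (v k) ∈ C.chainAlg := by
  induction hv using Submodule.span_induction with
  | mem v h =>
    obtain ⟨d, q, s, hs, rfl⟩ := h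
    simp only [C.D_mul, C.D_vec, Finset.sum_add_distrib, smul_mul_assoc, ← Finset.smul_sum,
      ← Finset.sum_mul]
    refine add_mem (C.chainAlg.smul_mem (mul_mem (C.trace_mem d) hs) _) (C.sum_mul_mem ?_
      (C.D_mem_vecSpan i hs))
    exact Submodule.subset_span ⟨d, q, 1, one_mem _, by simp⟩
  | zero => simp
  | add v v' _ _ hv hv' => simpa [Finset.sum_add_distrib] using add_mem hv hv'
  | smul c v _ hv =>
    simpa [← Finset.smul_sum] using C.chainAlg.smul_mem hv c

/-- The Laplacians preserve the algebra of chains. -/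
theorem laplacian_mem (i j : J) {x : Q} (hx : x ∈ C.chainAlg) :
    ∑ k, C.D k i (C.D k j x) ∈ C.chainAlg :=
  C.sum_D_mem i (C.D_mem_vecSpan j hx)

end ChainData

/-! ### The coordinate volume element -/

section Volume

open ExteriorAlgebra Module

/-- The pairs `(i, j)`, `i ≤ j`, in lexicographic order. -/
def upperPairs (m : ℕ) : List (Fin m × Fin m) :=
  (List.finRange m).flatMap fun i => ((List.finRange m).filter fun j => i ≤ j).map fun j => (i, j)

theorem mem_upperPairs {m : ℕ} {q : Fin m × Fin m} : q ∈ upperPairs m ↔ q.1 ≤ q.2 := by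
  obtain ⟨i, j⟩ := q
  simp [upperPairs]

theorem nodup_upperPairs (m : ℕ) : (upperPairs m).Nodup := by
  rw [upperPairs, List.nodup_flatMap]
  refine ⟨fun i _ => ((List.nodup_finRange m).filter _).map fun a b h => by simpa using h, ?_⟩
  refine (List.nodup_finRange m).imp fun {a b} hab => ?_
  rw [Function.onFun, List.disjoint_left]
  rintro ⟨x, y⟩ hx hy
  simp only [List.mem_map, Prod.mk.injEq] at hx hy
  obtain ⟨_, _, rfl, _⟩ := hx
  obtain ⟨_, _, rfl, _⟩ := hy
  exact hab rfl

/-- The linear functional `X ↦ X_{ij}` on symmetric matrices. -/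
def entry {m : ℕ} (i j : Fin m) : Dual ℝ (symMat m) :=
  (Matrix.entryLinearMap ℝ ℝ i j).comp (symMat m).subtype

theorem entry_apply {m : ℕ} (i j : Fin m) (X : symMat m) : entry i j X = X.1 i j := rfl

theorem dX_eq {m : ℕ} (i j : Fin m) : dX i j = ι ℝ (entry i j) := rfl

theorem entry_comm {m : ℕ} (i j : Fin m) : entry i j = entry j i := by
  ext X
  exact congrFun (congrFun X.2 j) i

theorem dX_comm {m : ℕ} (i j : Fin m) : (dX i j : Ext m) = dX j i := by
  rw [dX_eq, entry_comm, dX_eq]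

theorem coordVolume_eq_prod (m : ℕ) :
    coordVolume m = ((upperPairs m).map fun q => dX q.1 q.2).prod := by
  rw [coordVolume, upperPairs, List.map_flatMap]
  simp only [List.map_map]
  rfl

/-- The coordinates `X_{ij}`, `i ≤ j`, of a symmetric matrix. -/
def symEquiv (m : ℕ) : symMat m ≃ₗ[ℝ] ({q // q ∈ upperPairs m} → ℝ) where
  toFun X q := X.1 q.1.1 q.1.2
  map_add' X Y := rfl
  map_smul' c X := rfl
  invFun f := ⟨Matrix.of fun i j => f ⟨(min i j, max i j), mem_upperPairs.2 min_le_max⟩, by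
    change Matrix.transpose _ = _
    ext i j
    simp only [Matrix.transpose_apply, Matrix.of_apply, min_comm j i, max_comm j i]⟩
  left_inv X := by
    ext i j
    simp only [Matrix.of_apply]
    rcases le_total i j with h | h
    · simp [h]
    · simpa [h] using congrFun (congrFun X.2 i) j
  right_inv f := by
    funext q
    have h := mem_upperPairs.1 q.2
    simp [h]

/-- The basis of linear coordinates on the space of symmetric matrices. -/
def volBasis (m : ℕ) : Basis (Fin (upperPairs m).length) ℝ (Dual ℝ (symMat m)) :=
  ((Basis.ofEquivFun (symEquiv m)).reindex
    ((nodup_upperPairs m).getEquiv _).symm).dualBasis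

theorem volBasis_apply (m : ℕ) (s : Fin (upperPairs m).length) :
    volBasis m s = entry ((upperPairs m).get s).1 ((upperPairs m).get s).2 := by
  ext X
  simp [volBasis, Basis.coe_dualBasis, entry_apply]
  rfl

theorem coordVolume_eq_ιMulti (m : ℕ) :
    coordVolume m = ιMulti ℝ (upperPairs m).length (volBasis m) := by
  rw [coordVolume_eq_prod, ιMulti_apply]
  congr 1
  refine List.ext_getElem (by simp) fun i h1 h2 => ?_
  simp [volBasis_apply, dX_eq]

theorem coordVolume_mem (m : ℕ) :
    coordVolume m ∈ ⋀[ℝ]^(upperPairs m).length (Dual ℝ (symMat m)) := by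
  rw [coordVolume_eq_ιMulti]
  exact ιMulti_range ℝ _ ⟨_, rfl⟩

theorem topCoeff_coordVolume (m : ℕ) : topCoeff (volBasis m) (coordVolume m) = 1 := by
  rw [coordVolume_eq_ιMulti, topCoeff_ιMulti_self]

theorem coordVolume_ne_zero (m : ℕ) : coordVolume m ≠ 0 := fun h => by
  have := topCoeff_coordVolume m
  rw [h, map_zero] at this
  exact zero_ne_one this

theorem map_mem_exteriorPower {V W : Type*} [AddCommGroup V] [Module ℝ V] [AddCommGroup W]
    [Module ℝ W] (f : V →ₗ[ℝ] W) {p : ℕ} {x : ExteriorAlgebra ℝ V} (hx : x ∈ ⋀[ℝ]^p V) :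
    ExteriorAlgebra.map f x ∈ ⋀[ℝ]^p W := by
  rw [← ιMulti_span_fixedDegree] at hx
  induction hx using Submodule.span_induction with
  | mem x h => obtain ⟨v, rfl⟩ := h; rw [map_apply_ιMulti]; exact ιMulti_range ℝ _ ⟨_, rfl⟩
  | zero => rw [map_zero]; exact zero_mem _
  | add x y _ _ hx hy => rw [map_add]; exact add_mem hx hy
  | smul c x _ hx => rw [map_smul]; exact Submodule.smul_mem _ _ hx

/-- This also turns the volume element into a tool for computing determinants of maps on symmetric
matrices. -/
theorem map_coordVolume {m : ℕ} (f : Dual ℝ (symMat m) →ₗ[ℝ] Dual ℝ (symMat m)) :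
    ExteriorAlgebra.map f (coordVolume m) = LinearMap.det f • coordVolume m := by
  have h := eq_topCoeff_smul (volBasis m) (map_mem_exteriorPower f (coordVolume_mem m))
  rwa [topCoeff_map, topCoeff_coordVolume, mul_one, ← coordVolume_eq_ιMulti] at h

theorem congr_mul {m : ℕ} (g h : Matrix (Fin m) (Fin m) ℝ) :
    congr (g * h) = congr h ∘ₗ congr g := by
  ext X : 2
  simp [congr, Matrix.transpose_mul, Matrix.mul_assoc]

theorem congr_one (m : ℕ) : congr (1 : Matrix (Fin m) (Fin m) ℝ) = LinearMap.id := by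
  ext X : 2
  simp [congr]

theorem dualMap_congr_entry {m : ℕ} (g : Matrix (Fin m) (Fin m) ℝ) (i j : Fin m) :
    (congr g).dualMap (entry i j) = ∑ k, ∑ l, (g k i * g l j) • entry k l := by
  ext X
  simp only [LinearMap.dualMap_apply, entry_apply, congr, LinearMap.coe_mk, AddHom.coe_mk,
    Matrix.mul_apply, Matrix.transpose_apply, Finset.sum_mul, LinearMap.sum_apply,
    LinearMap.smul_apply, smul_eq_mul]
  rw [Finset.sum_comm]
  exact Finset.sum_congr rfl fun k _ => Finset.sum_congr rfl fun l _ => by ring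

/-- Index i occurs m - i times as a first entry and i + 1 times as a second entry, hence m + 1 times
in all. -/
theorem prod_upperPairs {m : ℕ} (d : Fin m → ℝ) :
    ((upperPairs m).map fun q => d q.1 * d q.2).prod = (∏ i, d i) ^ (m + 1) := by
  have h1 : ((upperPairs m).map fun q => d q.1 * d q.2).prod =
      ∏ i, ∏ j ∈ Finset.Ici i, (d i * d j) := by
    rw [upperPairs, List.map_flatMap, List.flatMap, List.prod_flatten, List.map_map, ← List.prod_ofFn, List.ofFn_eq_map]
    congr 1
    refine List.map_congr_left fun i _ => ?_
    rw [Function.comp_apply, List.map_map, ← List.prod_toFinset _ ((List.nodup_finRange m).filter _)]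
    refine Finset.prod_congr ?_ fun j _ => rfl
    ext j
    simp
  have h2 : ∏ i, ∏ j ∈ Finset.Ici i, d j = ∏ j, ∏ i ∈ Finset.Iic j, d j :=
    Finset.prod_comm' (by simp)
  rw [h1]
  simp only [Finset.prod_mul_distrib]
  rw [h2, ← Finset.prod_mul_distrib, ← Finset.prod_pow]
  refine Finset.prod_congr rfl fun i _ => ?_
  rw [Finset.prod_const, Finset.prod_const, ← pow_add, Fin.card_Ici, Fin.card_Iic]
  congr 1
  omega

theorem det_congr_diagonal {m : ℕ} (d : Fin m → ℝ) :
    LinearMap.det (congr (Matrix.diagonal d)).dualMap = (∏ i, d i) ^ (m + 1) := by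
  have h1 := map_coordVolume (congr (Matrix.diagonal d)).dualMap
  have h2 : ∀ l : List (Fin m × Fin m), ExteriorAlgebra.map (congr (Matrix.diagonal d)).dualMap
      ((l.map fun q => dX q.1 q.2).prod) =
      (l.map fun q => d q.1 * d q.2).prod • (l.map fun q => dX q.1 q.2).prod := by
    intro l
    induction l with
    | nil => simp
    | cons q l ih =>
      have h3 : (congr (Matrix.diagonal d)).dualMap (entry q.1 q.2) =
          (d q.1 * d q.2) • entry q.1 q.2 := by
        rw [dualMap_congr_entry, Finset.sum_eq_single q.1, Finset.sum_eq_single q.2] <;>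
          simp +contextual [Matrix.diagonal_apply]
      rw [List.map_cons, List.prod_cons, map_mul, ih, dX_eq, map_apply_ι, h3, map_smul,
        smul_mul_smul_comm, List.map_cons, List.prod_cons]
  rw [coordVolume_eq_prod, h2, prod_upperPairs, ← coordVolume_eq_prod] at h1
  exact (smul_left_injective ℝ (coordVolume_ne_zero m) h1).symm

/-- Both sides are multiplicative in g, so diagonal matrices and transvections suffice. -/
theorem det_congr {m : ℕ} (g : Matrix (Fin m) (Fin m) ℝ) :
    LinearMap.det (congr g).dualMap = g.det ^ (m + 1) := by
  have hmul : ∀ g h : Matrix (Fin m) (Fin m) ℝ, LinearMap.det (congr (g * h)).dualMap =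
      LinearMap.det (congr g).dualMap * LinearMap.det (congr h).dualMap := by
    intro g h
    rw [congr_mul, ← LinearMap.dualMap_comp_dualMap, LinearMap.det_comp]
  refine Matrix.diagonal_transvection_induction
    (fun g => LinearMap.det (congr g).dualMap = g.det ^ (m + 1)) g ?_ ?_ ?_
  · intro d _
    rw [det_congr_diagonal, Matrix.det_diagonal]
  · rintro ⟨i, j, hij, c⟩
    rw [Matrix.TransvectionStruct.det, one_pow]
    simp only [Matrix.TransvectionStruct.toMatrix_mk]
    -- Conjugation by this diagonal matrix takes T(c) to T(2c) = T(c)². The determinant attached to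
    -- T(c) therefore equals its own square, and being non-zero it is 1.
    set d : Fin m → ℝ := fun k => if k = i then 2 else 1
    have hd : (∏ k, d k) ^ (m + 1) ≠ 0 :=
      pow_ne_zero _ (Finset.prod_ne_zero_iff.mpr fun k _ => by simp only [d]; split_ifs <;> norm_num)
    have h1 : Matrix.diagonal d * Matrix.transvection i j c =
        Matrix.transvection i j (c + c) * Matrix.diagonal d := by
      ext k l
      simp only [Matrix.diagonal_mul, Matrix.mul_diagonal, Matrix.transvection, Matrix.add_apply,
        Matrix.one_apply, Matrix.single_apply, d]
      by_cases h : i = k ∧ j = l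
      · obtain ⟨rfl, rfl⟩ := h
        simp only [hij, hij.symm, if_true, if_false, and_self]
        ring
      · by_cases hkl : k = l
        · subst hkl; simp [h]
        · simp [h, hkl]
    have h2 := congrArg (fun g => LinearMap.det (congr g).dualMap) h1
    have h3 := congrArg (fun g => LinearMap.det (congr g).dualMap)
      (Matrix.transvection_mul_transvection_same i j hij c c)
    have h4 := congrArg (fun g => LinearMap.det (congr g).dualMap)
      (Matrix.transvection_mul_transvection_same i j hij c (-c))
    simp only [hmul, det_congr_diagonal, add_neg_cancel, Matrix.transvection_zero, congr_one] at h2 h3 h4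
    have h5 : LinearMap.det (congr (Matrix.transvection i j c)).dualMap ≠ 0 := by
      intro h
      rw [h, zero_mul, LinearMap.dualMap_id, LinearMap.det_id] at h4
      exact zero_ne_one h4
    rw [← h3] at h2
    have h6 := mul_right_cancel₀ hd ((mul_comm _ _).trans h2)
    exact mul_left_cancel₀ h5 (h6.symm.trans (mul_one _).symm)
  · intro A B hA hB
    rw [hmul, hA, hB, Matrix.det_mul, mul_pow]

end Volume

/-! ### The Fischer pairing on polynomials -/

section Fischer

open MvPolynomial TensorProduct

variable {σ : Type*}

/-- The Fischer pairing `⟨f, h⟩ = ∑ s! f_s h_s`. -/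
def fischer [Fintype σ] : MvPolynomial σ ℝ →ₗ[ℝ] MvPolynomial σ ℝ →ₗ[ℝ] ℝ :=
  (basisMonomials σ ℝ).constr ℝ fun s => (∏ i, ((s i).factorial : ℝ)) • lcoeff ℝ s

theorem fischer_monomial [Fintype σ] (s : σ →₀ ℕ) (a : ℝ) (h : MvPolynomial σ ℝ) :
    fischer (monomial s a) h = a * (∏ i, ((s i).factorial : ℝ)) * coeff s h := by
  have h1 : (monomial s a : MvPolynomial σ ℝ) = a • basisMonomials σ ℝ s := by
    rw [coe_basisMonomials, smul_monomial, smul_eq_mul, mul_one]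
  rw [h1, map_smul, fischer, Module.Basis.constr_basis]
  simp [lcoeff, mul_assoc]

/-- Multiplication by a variable is adjoint to its partial derivative, because (s_i + 1)! = (s_i +
1) · s_i!. -/
theorem fischer_X_mul [Fintype σ] (i : σ) (f h : MvPolynomial σ ℝ) :
    fischer (X i * f) h = fischer f (pderiv i h) := by
  classical
  induction f using MvPolynomial.induction_on' with
  | monomial s a =>
    rw [X, monomial_mul, one_mul, fischer_monomial, fischer_monomial, coeff_pderiv, add_comm,
      ← Finset.mul_prod_erase _ _ (Finset.mem_univ i),
      ← Finset.mul_prod_erase _ (fun j => ((s j).factorial : ℝ)) (Finset.mem_univ i)]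
    have h1 : ∏ j ∈ Finset.univ.erase i, (((s + Finsupp.single i 1 : σ →₀ ℕ) j).factorial : ℝ) =
        ∏ j ∈ Finset.univ.erase i, ((s j).factorial : ℝ) := by
      refine Finset.prod_congr rfl fun j hj => ?_
      simp [(Finset.ne_of_mem_erase hj).symm]
    rw [h1]
    simp only [Finsupp.add_apply, Finsupp.single_eq_same, Nat.factorial_succ]
    push_cast
    ring
  | add f g hf hg => simp only [mul_add, map_add, LinearMap.add_apply, hf, hg]

theorem fischer_one [Fintype σ] (h : MvPolynomial σ ℝ) : fischer 1 h = constantCoeff h := by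
  rw [← C_1, ← monomial_zero', fischer_monomial]
  simp [constantCoeff_eq]

theorem fischer_self_pos [Fintype σ] {f : MvPolynomial σ ℝ} (hf : f ≠ 0) : 0 < fischer f f := by
  have h1 : ∀ h, fischer f h =
      ∑ s ∈ f.support, coeff s f * (∏ i, ((s i).factorial : ℝ)) * coeff s h := by
    intro h
    conv_lhs => rw [f.as_sum]
    rw [map_sum, LinearMap.sum_apply]
    exact Finset.sum_congr rfl fun s _ => fischer_monomial _ _ _
  rw [h1]
  refine Finset.sum_pos (fun s hs => ?_) (support_nonempty.mpr hf)
  have h2 : coeff s f ≠ 0 := mem_support_iff.mp hs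
  have h3 : 0 < ∏ i, ((s i).factorial : ℝ) := Finset.prod_pos fun i _ => by positivity
  calc 0 < (∏ i, ((s i).factorial : ℝ)) * (coeff s f * coeff s f) :=
        mul_pos h3 (mul_self_pos.mpr h2)
    _ = _ := by ring

/-! ### Fischer pairing, derivatives and evaluation with coefficients in an algebra -/

variable (Ξ : Type*) [Ring Ξ] [Algebra ℝ Ξ]

/-- The Fischer pairing with a polynomial on polynomials with coefficients in `Ξ`. -/
def fischerTensor [Fintype σ] (f : MvPolynomial σ ℝ) : MvPolynomial σ ℝ ⊗[ℝ] Ξ →ₗ[ℝ] Ξ :=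
  (TensorProduct.lid ℝ Ξ).toLinearMap ∘ₗ LinearMap.rTensor Ξ (fischer f)

/-- Partial derivatives of polynomials with coefficients in `Ξ`. -/
def pderivTensor (i : σ) : MvPolynomial σ ℝ ⊗[ℝ] Ξ →ₗ[ℝ] MvPolynomial σ ℝ ⊗[ℝ] Ξ :=
  LinearMap.rTensor Ξ (pderiv i).toLinearMap

/-- Evaluation of polynomials with coefficients in `Ξ`. -/
def evalTensor (g : σ → ℝ) : MvPolynomial σ ℝ ⊗[ℝ] Ξ →ₐ[ℝ] Ξ :=
  (Algebra.TensorProduct.lid ℝ Ξ).toAlgHom.comp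
    (Algebra.TensorProduct.map (aeval g) (AlgHom.id ℝ Ξ))

variable {Ξ}

@[simp] theorem fischerTensor_tmul [Fintype σ] (f p : MvPolynomial σ ℝ) (x : Ξ) :
    fischerTensor Ξ f (p ⊗ₜ x) = fischer f p • x := by
  simp [fischerTensor]

@[simp] theorem pderivTensor_tmul (i : σ) (p : MvPolynomial σ ℝ) (x : Ξ) :
    pderivTensor Ξ i (p ⊗ₜ x) = pderiv i p ⊗ₜ x := by
  simp [pderivTensor]

@[simp] theorem evalTensor_tmul (g : σ → ℝ) (p : MvPolynomial σ ℝ) (x : Ξ) :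
    evalTensor Ξ g (p ⊗ₜ x) = aeval g p • x := by
  simp [evalTensor]

theorem fischerTensor_X_mul [Fintype σ] (i : σ) (f : MvPolynomial σ ℝ) (F : MvPolynomial σ ℝ ⊗[ℝ] Ξ) :
    fischerTensor Ξ (X i * f) F = fischerTensor Ξ f (pderivTensor Ξ i F) := by
  induction F using TensorProduct.induction_on with
  | zero => simp
  | add x y hx hy => simp only [map_add, hx, hy]
  | tmul p x => simp [fischer_X_mul]

theorem fischerTensor_one [Fintype σ] (F : MvPolynomial σ ℝ ⊗[ℝ] Ξ) :
    fischerTensor Ξ 1 F = evalTensor Ξ 0 F := by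
  induction F using TensorProduct.induction_on with
  | zero => simp
  | add x y hx hy => simp only [map_add, hx, hy]
  | tmul p x => simp [fischer_one]

theorem pderivTensor_mul (i : σ) (F G : MvPolynomial σ ℝ ⊗[ℝ] Ξ) :
    pderivTensor Ξ i (F * G) = pderivTensor Ξ i F * G + F * pderivTensor Ξ i G := by
  induction F using TensorProduct.induction_on with
  | zero => simp
  | add x y hx hy => simp only [map_add, add_mul, hx, hy]; abel
  | tmul p x =>
    induction G using TensorProduct.induction_on with
    | zero => simp
    | add x y hx hy => simp only [map_add, mul_add, hx, hy]; abel
    | tmul q y =>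
      simp only [Algebra.TensorProduct.tmul_mul_tmul, pderivTensor_tmul, Derivation.leibniz,
        smul_eq_mul, TensorProduct.add_tmul]
      rw [add_comm, mul_comm q]

/-- A polynomial with coefficients in `Ξ` is determined, under Fischer pairings, by its values. -/
theorem fischerTensor_eq_of_eval [Fintype σ] {F : MvPolynomial σ ℝ ⊗[ℝ] Ξ} {p : MvPolynomial σ ℝ} {x : Ξ}
    (h : ∀ g : σ → ℝ, evalTensor Ξ g F = aeval g p • x) (f : MvPolynomial σ ℝ) :
    fischerTensor Ξ f F = fischer f p • x := by
  -- Testing against linear forms on Ξ reduces to real polynomials, which are determined by their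
  -- values.
  rw [← sub_eq_zero, ← Module.forall_dual_apply_eq_zero_iff ℝ]
  intro l
  let L : MvPolynomial σ ℝ ⊗[ℝ] Ξ →ₗ[ℝ] MvPolynomial σ ℝ :=
    (TensorProduct.rid ℝ (MvPolynomial σ ℝ)).toLinearMap ∘ₗ LinearMap.lTensor _ l
  have h1 : ∀ G, l (fischerTensor Ξ f G) = fischer f (L G) := by
    intro G
    induction G using TensorProduct.induction_on with
    | zero => simp
    | add x y hx hy => simp only [map_add, hx, hy]
    | tmul p x => simp [L, mul_comm]
  have h2 : ∀ g G, l (evalTensor Ξ g G) = aeval g (L G) := by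
    intro g G
    induction G using TensorProduct.induction_on with
    | zero => simp
    | add x y hx hy => simp only [map_add, hx, hy]
    | tmul p x => simp [L, mul_comm]
  have h3 : L F = l x • p := by
    refine MvPolynomial.funext fun g => ?_
    have := congrArg l (h g)
    have h4 : ∀ q : MvPolynomial σ ℝ, aeval g q = eval g q :=
      fun q => RingHom.congr_fun (coe_aeval_eq_eval g) q
    rw [h2, map_smul, h4, h4] at this
    rw [this, smul_eval, smul_eq_mul, mul_comm]
  rw [map_sub, h1, h3, map_smul, map_smul, smul_eq_mul, smul_eq_mul, mul_comm, sub_self]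

end Fischer

/-! ### The volume element as an invariant -/

section Invariant

open ExteriorAlgebra Module TensorProduct MvPolynomial

/-- The algebra `⋀ℝ^m ⊗ ⋀(symMat m)^*`. -/
abbrev Coef (m : ℕ) : Type := EtaAlg m ⊗[ℝ] Ext m

/-- Polynomials in the entries of an `m × m` matrix with coefficients in `Coef m`. -/
abbrev PolyCoef (m : ℕ) : Type := MvPolynomial (Fin m × Fin m) ℝ ⊗[ℝ] Coef m

/-- The inclusion of `Ext m` in `PolyCoef m`. -/
def extIncl (m : ℕ) : Ext m →ₐ[ℝ] PolyCoef m :=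
  (Algebra.TensorProduct.includeRight).comp Algebra.TensorProduct.includeRight

theorem extIncl_apply {m : ℕ} (x : Ext m) : extIncl m x = 1 ⊗ₜ (1 ⊗ₜ x) := rfl

/-- The algebra automorphism of `PolyCoef m` induced by the grade involution of `Ext m`. -/
def extParity (m : ℕ) : PolyCoef m →ₐ[ℝ] PolyCoef m :=
  Algebra.TensorProduct.map (AlgHom.id ℝ _) (Algebra.TensorProduct.map (AlgHom.id ℝ _) parity)

/-- The algebra automorphism of `PolyCoef m` induced by the grade involution of `⋀ℝ^m`. -/
def etaParity (m : ℕ) : PolyCoef m →ₐ[ℝ] PolyCoef m :=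
  Algebra.TensorProduct.map (AlgHom.id ℝ _) (Algebra.TensorProduct.map parity (AlgHom.id ℝ _))

theorem polyCoef_induction {m : ℕ} {P : PolyCoef m → Prop} (add : ∀ x y, P x → P y → P (x + y))
    (tmul : ∀ p w x, P (p ⊗ₜ (w ⊗ₜ x))) (x : PolyCoef m) : P x := by
  induction x using TensorProduct.induction_on with
  | zero => simpa using tmul 0 0 0
  | add x y hx hy => exact add _ _ hx hy
  | tmul p y =>
    induction y using TensorProduct.induction_on with
    | zero => simpa using tmul 0 0 0
    | add x y hx hy => rw [TensorProduct.tmul_add]; exact add _ _ hx hy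
    | tmul w x => exact tmul p w x

theorem mul_extIncl {m : ℕ} (y : PolyCoef m) (v : Dual ℝ (symMat m)) :
    y * extIncl m (ι ℝ v) = extIncl m (ι ℝ v) * extParity m y := by
  induction y using polyCoef_induction with
  | add x y hx hy => rw [map_add, add_mul, mul_add, hx, hy]
  | tmul p w x =>
    simp only [extIncl_apply, extParity, Algebra.TensorProduct.map_tmul,
      Algebra.TensorProduct.tmul_mul_tmul, mul_one, one_mul, mul_ι_eq, AlgHom.id_apply]

theorem mul_eta {m : ℕ} (y : PolyCoef m) (v : Fin m → ℝ) :
    y * (1 ⊗ₜ (ι ℝ v ⊗ₜ 1)) = (1 ⊗ₜ (ι ℝ v ⊗ₜ 1)) * etaParity m y := by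
  induction y using polyCoef_induction with
  | add x y hx hy => rw [map_add, add_mul, mul_add, hx, hy]
  | tmul p w x =>
    simp only [etaParity, Algebra.TensorProduct.map_tmul,
      Algebra.TensorProduct.tmul_mul_tmul, mul_one, one_mul, mul_ι_eq, AlgHom.id_apply]

theorem mul_poly {m : ℕ} (y : PolyCoef m) (p : MvPolynomial (Fin m × Fin m) ℝ) :
    y * (p ⊗ₜ 1) = (p ⊗ₜ 1) * y := by
  induction y using polyCoef_induction with
  | add x y hx hy => rw [add_mul, mul_add, hx, hy]
  | tmul q w x =>
    simp only [Algebra.TensorProduct.tmul_mul_tmul, mul_one, one_mul, mul_comm q p]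

/-- The columns of a generic matrix, together with the column of generators of `⋀ℝ^m`. -/
def column {m : ℕ} (k : Fin m) : Option (Fin m) → PolyCoef m
  | some i => X (k, i) ⊗ₜ 1
  | none => 1 ⊗ₜ (eta1 k ⊗ₜ 1)

/-- The chains built from the matrix `dX`, the columns of a generic matrix and the generators of
`⋀ℝ^m`. -/
def chainData (m : ℕ) : ChainData m (Option (Fin m)) (Fin m) (PolyCoef m) where
  A := (dMat m).map (extIncl m)
  u := column
  α := extParity m
  γ
    | some _ => AlgHom.id ℝ _
    | none => etaParity m
  D k j := pderivTensor (Coef m) (k, j)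
  e
    | j, some i => if j = i then 1 else 0
    | _, none => 0
  -- Only two η's anticommute; the entries of the generic matrix are central.
  sgn
    | none, none => -1
    | _, _ => 1
  A_symm i j := by simp [dMat, dX_comm i j]
  mul_A y k l := mul_extIncl y _
  mul_u
    | y, k, some i => mul_poly y _
    | y, k, none => mul_eta y _
  α_A k l := by simp [dMat, extIncl_apply, extParity, dX_eq, TensorProduct.tmul_neg]
  α_u
    | k, some i => by simp [column, extParity, Algebra.TensorProduct.one_def]
    | k, none => by simp [column, extParity]
  γ_A
    | some i, k, l => rfl
    | none, k, l => by simp [extIncl_apply, etaParity]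
  γ_u
    | some i, k, p => by simp
    | none, k, some i => by simp [column, etaParity, Algebra.TensorProduct.one_def]
    | none, k, none => by
      simp only [column, etaParity, eta1, Algebra.TensorProduct.map_tmul, map_one, parity_ι,
        TensorProduct.neg_tmul, TensorProduct.tmul_neg]
      exact (neg_one_smul ℝ _).symm
  D_mul k j x y := pderivTensor_mul _ x y
  D_A k j i l := by simp [extIncl_apply]
  D_u
    | k, j, l, some i => by
      by_cases h : k = l <;> by_cases h' : j = i <;>
        simp [column, pderiv_X, h, h', eq_comm, Algebra.TensorProduct.one_def]
    | k, j, l, none => by simp [column]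

theorem chainData_pow {m : ℕ} (d : ℕ) (k l : Fin m) :
    ((chainData m).A ^ d) k l = extIncl m ((dMat m ^ d) k l) := by
  have h : (chainData m).A = (extIncl m).toRingHom.mapMatrix (dMat m) := rfl
  rw [h, ← map_pow]
  rfl

/-- The algebra generated by the traces of powers of `dX` and the elements
`∑ η_k η_l (dX^d)_{kl}`. -/
def invAlg (m : ℕ) : Subalgebra ℝ (Coef m) :=
  Algebra.adjoin ℝ ({x | ∃ d, x = 1 ⊗ₜ (dMat m ^ d).trace} ∪ {x | ∃ d, x = quadElt (dMat m ^ d)})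

/-- At g = 0 every chain with an end in a column of the generic matrix vanishes; only the traces and
the chains with both ends in η survive. -/
theorem eval_zero_mem {m : ℕ} {F : PolyCoef m} (hF : F ∈ (chainData m).chainAlg) :
    evalTensor (Coef m) 0 F ∈ invAlg m := by
  suffices h : (chainData m).chainAlg ≤ (invAlg m).comap (evalTensor (Coef m) 0) from h hF
  refine Algebra.adjoin_le ?_
  rintro x (⟨d, p, q, rfl⟩ | ⟨d, rfl⟩)
  · change evalTensor (Coef m) 0 _ ∈ invAlg m
    have h : ∀ k i, evalTensor (Coef m) 0 ((chainData m).u k (some i)) = 0 := by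
      intro k i
      simp [chainData, column]
    simp only [ChainData.chain, map_sum, map_mul]
    rcases p with _ | i
    · rcases q with _ | j
      · have : quadElt (dMat m ^ d) = ∑ k, ∑ l,
            evalTensor (Coef m) 0 ((chainData m).u k none) *
            evalTensor (Coef m) 0 (((chainData m).A ^ d) k l) *
            evalTensor (Coef m) 0 ((chainData m).u l none) := by
          simp only [chainData_pow, extIncl_apply]
          simp [chainData, column, quadElt]
        rw [← this]
        exact Algebra.subset_adjoin (Or.inr ⟨d, rfl⟩)
      · simp [h]
    · simp [h]
  · change evalTensor (Coef m) 0 _ ∈ invAlg m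
    have : evalTensor (Coef m) 0 ((chainData m).A ^ d).trace =
        (1 : EtaAlg m) ⊗ₜ[ℝ] (dMat m ^ d).trace := by
      simp only [Matrix.trace, Matrix.diag_apply, map_sum, chainData_pow, extIncl_apply,
        TensorProduct.tmul_sum]
      simp
    rw [this]
    exact Algebra.subset_adjoin (Or.inl ⟨d, rfl⟩)

/-! ### Gram polynomials, Laplacians and the generic determinant -/

/-- The entries of `gᵀ g` for the generic matrix `g`. -/
def gramPoly {m : ℕ} (i j : Fin m) : MvPolynomial (Fin m × Fin m) ℝ := ∑ k, X (k, i) * X (k, j)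

/-- Pairing with a polynomial in the entries of gᵀg amounts to applying the corresponding polynomial
in the Laplacians and evaluating at 0. The Laplacians stay within the chains, and evaluation lands
in `invAlg`. -/
theorem fischerTensor_mem_invAlg {m : ℕ} {f : MvPolynomial (Fin m × Fin m) ℝ}
    (hf : f ∈ Algebra.adjoin ℝ {x | ∃ i j : Fin m, x = gramPoly i j}) {F : PolyCoef m}
    (hF : F ∈ (chainData m).chainAlg) : fischerTensor (Coef m) f F ∈ invAlg m := by
  -- Phrasing the property as stability under multiplication by f makes it pass to products; f' = 1
  -- recovers the claim.
  suffices h : ∀ f', (∀ F ∈ (chainData m).chainAlg, fischerTensor (Coef m) f' F ∈ invAlg m) →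
      ∀ F ∈ (chainData m).chainAlg, fischerTensor (Coef m) (f * f') F ∈ invAlg m by
    have h1 := h 1 (fun F hF => by rw [fischerTensor_one]; exact eval_zero_mem hF) F hF
    rwa [mul_one] at h1
  clear hF F
  have hadd : ∀ (f g : MvPolynomial (Fin m × Fin m) ℝ) (F : PolyCoef m),
      fischerTensor (Coef m) (f + g) F = fischerTensor (Coef m) f F + fischerTensor (Coef m) g F := by
    intro f g F
    simp [fischerTensor, LinearMap.rTensor_add]
  have hsmul : ∀ (r : ℝ) (f : MvPolynomial (Fin m × Fin m) ℝ) (F : PolyCoef m),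
      fischerTensor (Coef m) (r • f) F = r • fischerTensor (Coef m) f F := by
    intro r f F
    simp [fischerTensor, LinearMap.rTensor_smul]
  induction hf using Algebra.adjoin_induction with
  | mem f hf =>
    obtain ⟨i, j, rfl⟩ := hf
    intro f' hf' F hF
    have hsum : fischerTensor (Coef m) (gramPoly i j * f') F = fischerTensor (Coef m) f'
        (∑ k, pderivTensor (Coef m) (k, j) (pderivTensor (Coef m) (k, i) F)) := by
      have h0 : ∀ s : Finset (Fin m), fischerTensor (Coef m) (∑ k ∈ s, X (k, i) * X (k, j) * f') F =
          ∑ k ∈ s, fischerTensor (Coef m) (X (k, i) * X (k, j) * f') F := by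
        classical
        intro s
        induction s using Finset.induction_on with
        | empty => simp [fischerTensor]
        | insert a s ha ih => rw [Finset.sum_insert ha, hadd, ih, Finset.sum_insert ha]
      rw [gramPoly, Finset.sum_mul, h0, map_sum]
      refine Finset.sum_congr rfl fun k _ => ?_
      rw [mul_assoc, fischerTensor_X_mul, fischerTensor_X_mul]
    rw [hsum]
    exact hf' _ ((chainData m).laplacian_mem j i hF)
  | algebraMap r =>
    intro f' hf' F hF
    rw [← Algebra.smul_def, hsmul]
    exact (invAlg m).smul_mem (hf' F hF) r
  | add f g _ _ hf hg =>
    intro f' hf' F hF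
    rw [add_mul, hadd]
    exact add_mem (hf f' hf' F hF) (hg f' hf' F hF)
  | mul f g _ _ hf hg =>
    intro f' hf' F hF
    rw [mul_assoc]
    exact hf _ (hg _ hf') F hF

/-- The determinant of the generic matrix. -/
def genDet (m : ℕ) : MvPolynomial (Fin m × Fin m) ℝ :=
  (Matrix.of fun k i => (X (k, i) : MvPolynomial (Fin m × Fin m) ℝ)).det

theorem aeval_genDet {m : ℕ} (g : Fin m × Fin m → ℝ) :
    aeval g (genDet m) = (Matrix.of fun k i => g (k, i)).det := by
  rw [genDet, AlgHom.map_det]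
  congr 1
  ext k i
  simp

theorem genDet_ne_zero (m : ℕ) : genDet m ≠ 0 := by
  intro h
  have h1 := aeval_genDet (m := m) fun q => if q.1 = q.2 then 1 else 0
  rw [h, map_zero, show (Matrix.of fun k i : Fin m => if (k, i).1 = (k, i).2 then (1 : ℝ) else 0) = 1
    from by ext k i; simp [Matrix.one_apply], Matrix.det_one] at h1
  exact zero_ne_one h1

/-- det(g)² = det(gᵀg). -/
theorem genDet_sq_mem (m : ℕ) :
    genDet m ^ 2 ∈ Algebra.adjoin ℝ {x | ∃ i j : Fin m, x = gramPoly i j} := by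
  have h : genDet m ^ 2 = (Matrix.of fun i j : Fin m => gramPoly i j).det := by
    rw [sq, genDet]
    nth_rewrite 1 [← Matrix.det_transpose]
    rw [← Matrix.det_mul]
    congr 1
  rw [h, Matrix.det_apply]
  refine Subalgebra.sum_mem _ fun σ _ => ?_
  rw [Units.smul_def]
  refine Subalgebra.zsmul_mem _ (Subalgebra.prod_mem _ fun i _ => ?_) _
  exact Algebra.subset_adjoin ⟨_, _, rfl⟩

/-- The product of all generators of `⋀ℝ^m`. -/
def etaTop (m : ℕ) : EtaAlg m := ιMulti ℝ m (Pi.basisFun ℝ (Fin m))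

/-- The image of the product of `etaTop` and `coordVolume` under a generic change of basis. -/
def genericTop (m : ℕ) : PolyCoef m :=
  (List.ofFn fun i : Fin m => (chainData m).chain 0 none (some i)).prod *
    ((upperPairs m).map fun q => (chainData m).chain 1 (some q.1) (some q.2)).prod

theorem genericTop_mem (m : ℕ) : genericTop m ∈ (chainData m).chainAlg := by
  refine mul_mem (list_prod_mem fun x hx => ?_) (list_prod_mem fun x hx => ?_)
  · obtain ⟨i, rfl⟩ := List.mem_ofFn.1 hx
    exact ChainData.chain_mem _ _ _ _
  · obtain ⟨i, _, rfl⟩ := List.mem_map.1 hx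
    exact ChainData.chain_mem _ _ _ _

/-- The exponent m + 2 combines one factor det(g) from the η's with m + 1 from the volume element of
symmetric matrices. -/
theorem eval_genericTop {m : ℕ} (g : Fin m × Fin m → ℝ) :
    evalTensor (Coef m) g (genericTop m) =
      aeval g (genDet m ^ (m + 2)) • (etaTop m ⊗ₜ coordVolume m) := by
  set G : Matrix (Fin m) (Fin m) ℝ := Matrix.of fun k i => g (k, i) with hG
  have h1 : ∀ i, evalTensor (Coef m) g ((chainData m).chain 0 none (some i)) =
      ExteriorAlgebra.map (Matrix.toLin' G) (eta1 i) ⊗ₜ 1 := by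
    intro i
    have h2 : ExteriorAlgebra.map (Matrix.toLin' G) (eta1 i) = ∑ k, g (k, i) • eta1 k := by
      simp only [eta1, map_apply_ι, ← map_smul, ← map_sum]
      congr 1
      ext k
      simp [hG, Pi.single_apply, Finset.sum_apply]
    rw [h2, TensorProduct.sum_tmul]
    simp only [ChainData.chain, map_sum, map_mul, chainData_pow, extIncl_apply, pow_zero]
    refine Finset.sum_congr rfl fun k _ => ?_
    rw [Finset.sum_eq_single k]
    · simp [chainData, column, TensorProduct.smul_tmul']
    · intro l _ hl
      simp [hl.symm]
    · simp
  have h3 : ∀ i j, evalTensor (Coef m) g ((chainData m).chain 1 (some i) (some j)) =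
      1 ⊗ₜ ExteriorAlgebra.map (congr G).dualMap (dX i j) := by
    intro i j
    rw [dX_eq, map_apply_ι, dualMap_congr_entry]
    simp only [ChainData.chain, map_sum, map_mul, chainData_pow, extIncl_apply, pow_one,
      TensorProduct.tmul_sum]
    refine Finset.sum_congr rfl fun k _ => Finset.sum_congr rfl fun l _ => ?_
    simp [chainData, column, hG, dMat, dX_eq, smul_smul, mul_comm]
  have h4 : (List.ofFn fun i : Fin m => ExteriorAlgebra.map (Matrix.toLin' G) (eta1 i)
      ⊗ₜ[ℝ] (1 : Ext m)).prod = G.det • (etaTop m ⊗ₜ 1) := by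
    rw [prod_ofFn_tmul]
    have h5 : (List.ofFn fun i : Fin m => ExteriorAlgebra.map (Matrix.toLin' G) (eta1 i)).prod =
        ExteriorAlgebra.map (Matrix.toLin' G) (etaTop m) := by
      rw [etaTop, ιMulti_apply, map_list_prod, List.map_ofFn]
      congr 2
      funext i
      simp [eta1]
    have h6 := eq_topCoeff_smul (Pi.basisFun ℝ (Fin m))
      (map_mem_exteriorPower (Matrix.toLin' G) (ιMulti_range ℝ m ⟨Pi.basisFun ℝ (Fin m), rfl⟩))
    rw [topCoeff_map, topCoeff_ιMulti_self, mul_one, LinearMap.det_toLin'] at h6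
    rw [h5, etaTop, h6, TensorProduct.smul_tmul']
    congr 2
    simp
  have h7 : ∀ l : List (Fin m × Fin m), (l.map fun q =>
      (1 : EtaAlg m) ⊗ₜ[ℝ] ExteriorAlgebra.map (congr G).dualMap (dX q.1 q.2)).prod =
      1 ⊗ₜ ExteriorAlgebra.map (congr G).dualMap (l.map fun q => dX q.1 q.2).prod := by
    intro l
    induction l with
    | nil => simp [Algebra.TensorProduct.one_def]
    | cons q l ih =>
      simp only [List.map_cons, List.prod_cons, ih, map_mul, Algebra.TensorProduct.tmul_mul_tmul,
        one_mul]
  rw [genericTop, map_mul, map_list_prod, map_list_prod, List.map_ofFn, List.map_map]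
  simp only [Function.comp_def, h1, h3]
  rw [h4, h7, ← coordVolume_eq_prod, map_coordVolume, det_congr, map_pow, aeval_genDet, ← hG,
    TensorProduct.tmul_smul, smul_mul_smul_comm, Algebra.TensorProduct.tmul_mul_tmul, mul_one,
    one_mul, pow_succ' _ (m + 1)]

/-- For even `m`, the volume element is expressed through the invariants in `invAlg m`. -/
theorem etaTop_tmul_coordVolume_mem (n : ℕ) :
    etaTop (2 * n) ⊗ₜ coordVolume (2 * n) ∈ invAlg (2 * n) := by
  set f := genDet (2 * n) ^ (2 * n + 2) with hf
  have h1 : f ∈ Algebra.adjoin ℝ {x | ∃ i j : Fin (2 * n), x = gramPoly i j} := by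
    -- Evenness of the matrix size enters here: the exponent must be even for the power of the
    -- determinant to be a polynomial in the entries of gᵀg.
    rw [hf, show 2 * n + 2 = 2 * (n + 1) by ring, pow_mul]
    exact pow_mem (genDet_sq_mem _) _
  have h2 := fischerTensor_mem_invAlg h1 (genericTop_mem (2 * n))
  -- The generic element is f times the wanted one, so pairing it with f produces the scalar ⟨f, f⟩
  -- > 0.
  rw [fischerTensor_eq_of_eval (eval_genericTop (m := 2 * n)), ← hf] at h2
  have h3 : fischer f f ≠ 0 := (fischer_self_pos (pow_ne_zero _ (genDet_ne_zero _))).ne'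
  have h4 := (invAlg (2 * n)).smul_mem h2 (fischer f f)⁻¹
  rwa [smul_smul, inv_mul_cancel₀ h3, one_smul] at h4

end Invariant

/-! ### Berezin integrals of products of quadratic elements -/

section Berezin

open ExteriorAlgebra Module TensorProduct

variable {m : ℕ}

theorem dMat_anticomm (i j k l : Fin m) : dMat m i j * dMat m k l = -(dMat m k l * dMat m i j) :=
  eq_neg_of_add_eq_zero_left (ι_add_mul_swap _ _)

theorem dMat_symm (i j : Fin m) : dMat m j i = dMat m i j := dX_comm j i

theorem dMat_pow_swap (d : ℕ) (i j : Fin m) :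
    (dMat m ^ d) j i = revSign d • (dMat m ^ d) i j :=
  pow_apply_swap dMat_anticomm dMat_symm d i j

theorem parity_parity (x : Ext m) : parity (parity x) = x :=
  CliffordAlgebra.involute_involute x

theorem parity_dMat_pow (d : ℕ) (k l : Fin m) :
    parity ((dMat m ^ d) k l) = (-1 : ℝ) ^ d • (dMat m ^ d) k l := by
  induction d generalizing k l with
  | zero => by_cases h : k = l <;> simp [h]
  | succ d ih =>
    rw [pow_succ, Matrix.mul_apply, map_sum, Finset.smul_sum]
    refine Finset.sum_congr rfl fun r _ => ?_
    rw [map_mul, ih, pow_succ]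
    simp [dMat, dX_eq]

theorem dMat_pow_mul (d : ℕ) (k l : Fin m) (y : Ext m) :
    (dMat m ^ d) k l * y = (parity ^ d : Ext m →ₐ[ℝ] Ext m) y * (dMat m ^ d) k l := by
  induction d generalizing k l y with
  | zero => by_cases h : k = l <;> simp [h]
  | succ d ih =>
    rw [pow_succ, Matrix.mul_apply, Finset.mul_sum, Finset.sum_mul]
    refine Finset.sum_congr rfl fun r _ => ?_
    have h : dMat m r l * y = parity y * dMat m r l := by
      have := mul_ι_eq (parity y) (entry r l)
      rw [parity_parity] at this
      exact this.symm
    rw [mul_assoc, h, ← mul_assoc, ih, ← mul_assoc, pow_succ, AlgHom.mul_apply]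

/-- The algebra generated by the traces of the powers of `dX`. -/
def traceAlg (m : ℕ) : Subalgebra ℝ (Ext m) :=
  Algebra.adjoin ℝ {x | ∃ d, x = (dMat m ^ d).trace}

theorem trace_mem_traceAlg (d : ℕ) : (dMat m ^ d).trace ∈ traceAlg m :=
  Algebra.subset_adjoin ⟨d, rfl⟩

theorem parity_mem_traceAlg {x : Ext m} (hx : x ∈ traceAlg m) : parity x ∈ traceAlg m := by
  suffices h : traceAlg m ≤ (traceAlg m).comap parity from h hx
  refine Algebra.adjoin_le ?_
  rintro x ⟨d, rfl⟩
  have : parity (dMat m ^ d).trace = (-1 : ℝ) ^ d • (dMat m ^ d).trace := by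
    simp only [Matrix.trace, Matrix.diag_apply, map_sum, parity_dMat_pow, Finset.smul_sum]
  change parity _ ∈ traceAlg m
  rw [this]
  exact (traceAlg m).smul_mem (trace_mem_traceAlg d) _

theorem parity_pow_mem_traceAlg (d : ℕ) {x : Ext m} (hx : x ∈ traceAlg m) :
    (parity ^ d : Ext m →ₐ[ℝ] Ext m) x ∈ traceAlg m := by
  induction d with
  | zero => exact hx
  | succ d ih => rw [pow_succ', AlgHom.mul_apply]; exact parity_mem_traceAlg ih

/-- The element `∑ η_k η_l (dX^d)_{kl}`. -/
def quadPow (m d : ℕ) : Coef m := quadElt (dMat m ^ d)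

theorem eta1_anticomm (i j : Fin m) : (eta1 i * eta1 j : EtaAlg m) = -(eta1 j * eta1 i) :=
  eq_neg_of_add_eq_zero_left (ι_add_mul_swap _ _)

theorem quadElt_transpose {A : Type*} [Ring A] [Algebra ℝ A] (M : Matrix (Fin m) (Fin m) A) :
    quadElt Mᵀ = -quadElt M := by
  rw [quadElt, Finset.sum_comm, quadElt, ← Finset.sum_neg_distrib]
  refine Finset.sum_congr rfl fun k _ => ?_
  rw [← Finset.sum_neg_distrib]
  refine Finset.sum_congr rfl fun l _ => ?_
  rw [eta1_anticomm, TensorProduct.neg_tmul, Matrix.transpose_apply]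

theorem quadElt_zsmul {A : Type*} [Ring A] [Algebra ℝ A] (c : ℤ) (M : Matrix (Fin m) (Fin m) A) :
    quadElt (c • M) = c • quadElt M := by
  simp only [quadElt, Finset.smul_sum, Matrix.smul_apply]
  refine Finset.sum_congr rfl fun k _ => Finset.sum_congr rfl fun l _ => ?_
  rw [← Int.cast_smul_eq_zsmul ℝ, ← Int.cast_smul_eq_zsmul ℝ, TensorProduct.tmul_smul]

/-- A symmetric matrix contracted with the anticommuting products η_kη_l gives zero. -/
theorem quadPow_eq_zero {d : ℕ} (hd : revSign d = 1) : quadPow m d = 0 := by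
  have h := quadElt_transpose (dMat m ^ d)
  have h2 : (dMat m ^ d)ᵀ = dMat m ^ d := by
    ext i j
    rw [Matrix.transpose_apply, dMat_pow_swap, hd, one_smul]
  rw [h2] at h
  have h3 : (2 : ℝ) • quadElt (dMat m ^ d) = 0 := by
    rw [two_smul]
    nth_rewrite 1 [h]
    exact neg_add_cancel _
  exact (smul_eq_zero.mp h3).resolve_left two_ne_zero

theorem quadPow_mul_tmul (d : ℕ) (y : Ext m) :
    quadPow m d * (1 ⊗ₜ y) = (1 ⊗ₜ (parity ^ d : Ext m →ₐ[ℝ] Ext m) y) * quadPow m d := by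
  simp only [quadPow, quadElt, Finset.sum_mul, Finset.mul_sum, Algebra.TensorProduct.tmul_mul_tmul,
    one_mul, mul_one, dMat_pow_mul]

theorem prod_quadPow_mul_tmul (ds : List ℕ) {y : Ext m} (hy : y ∈ traceAlg m) :
    ∃ z ∈ traceAlg m,
      (ds.map (quadPow m)).prod * (1 ⊗ₜ y) = (1 ⊗ₜ z) * (ds.map (quadPow m)).prod := by
  induction ds with
  | nil => exact ⟨y, hy, by simp⟩
  | cons d ds ih =>
    obtain ⟨z, hz, h⟩ := ih
    refine ⟨_, parity_pow_mem_traceAlg d hz, ?_⟩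
    rw [List.map_cons, List.prod_cons, mul_assoc, h, ← mul_assoc, quadPow_mul_tmul, mul_assoc]

/-- Traces can be collected on the left, since passing a quadratic element only twists them by the
grade involution. -/
theorem invAlg_le_span {x : Coef m} (hx : x ∈ invAlg m) :
    x ∈ Submodule.span ℝ {x : Coef m | ∃ r ∈ traceAlg m, ∃ ds : List ℕ,
      x = (1 ⊗ₜ r) * (ds.map (quadPow m)).prod} := by
  induction hx using Algebra.adjoin_induction with
  | mem x hx =>
    rcases hx with ⟨d, rfl⟩ | ⟨d, rfl⟩
    · exact Submodule.subset_span ⟨_, trace_mem_traceAlg d, [], by simp⟩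
    · exact Submodule.subset_span ⟨1, one_mem _, [d], by
        simp [quadPow, ← Algebra.TensorProduct.one_def]⟩
  | algebraMap r =>
    rw [Algebra.algebraMap_eq_smul_one]
    exact Submodule.smul_mem _ _ (Submodule.subset_span ⟨1, one_mem _, [], by
      simp [← Algebra.TensorProduct.one_def]⟩)
  | add x y _ _ hx hy => exact add_mem hx hy
  | mul x y hx' hy' hx hy =>
    clear hx' hy'
    induction hx using Submodule.span_induction with
    | zero => rw [zero_mul]; exact zero_mem _
    | add x x' _ _ hx hx' => rw [add_mul]; exact add_mem hx hx'
    | smul c x _ hx => rw [smul_mul_assoc]; exact Submodule.smul_mem _ _ hx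
    | mem x hx =>
      obtain ⟨r, hr, ds, rfl⟩ := hx
      induction hy using Submodule.span_induction with
      | zero => rw [mul_zero]; exact zero_mem _
      | add x x' _ _ hx hx' => rw [mul_add]; exact add_mem hx hx'
      | smul c x _ hx => rw [mul_smul_comm]; exact Submodule.smul_mem _ _ hx
      | mem y hy =>
        obtain ⟨r', hr', ds', rfl⟩ := hy
        obtain ⟨z, hz, h⟩ := prod_quadPow_mul_tmul ds hr'
        refine Submodule.subset_span ⟨r * z, mul_mem hr hz, ds ++ ds', ?_⟩
        rw [List.map_append, List.prod_append, mul_assoc, ← mul_assoc _ (1 ⊗ₜ r'), h, mul_assoc,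
          ← mul_assoc, Algebra.TensorProduct.tmul_mul_tmul, mul_one]

theorem berezin_tmul_mul (r : Ext m) (ξ : Coef m) :
    berezin m (Ext m) ((1 ⊗ₜ r) * ξ) = r * berezin m (Ext m) ξ := by
  induction ξ using TensorProduct.induction_on with
  | zero => simp
  | add x y hx hy => simp only [mul_add, map_add, hx, hy]
  | tmul w x => simp

/-- Each quadratic element has degree two in η, and the integral sees only degree 2n. -/
theorem berezin_prod_of_length_ne {n : ℕ} {ds : List ℕ} (h : ds.length ≠ n) :
    berezin (2 * n) (Ext (2 * n)) (ds.map (quadPow (2 * n))).prod = 0 := by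
  have key : ∀ ds : List ℕ, (ds.map (quadPow (2 * n))).prod ∈ Submodule.span ℝ
      {x : Coef (2 * n) | ∃ w ∈ ⋀[ℝ]^(2 * ds.length) (Fin (2 * n) → ℝ), ∃ a, x = w ⊗ₜ a} := by
    intro ds
    induction ds with
    | nil =>
      refine Submodule.subset_span ⟨1, ?_, 1, ?_⟩
      · simp
      · simp [Algebra.TensorProduct.one_def]
    | cons d ds ih =>
      rw [List.map_cons, List.prod_cons]
      generalize (ds.map (quadPow (2 * n))).prod = x at ih ⊢
      induction ih using Submodule.span_induction with
      | zero => rw [mul_zero]; exact zero_mem _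
      | add x x' _ _ hx hx' => rw [mul_add]; exact add_mem hx hx'
      | smul c x _ hx => rw [mul_smul_comm]; exact Submodule.smul_mem _ _ hx
      | mem x hx =>
        obtain ⟨w, hw, a, rfl⟩ := hx
        rw [quadPow, quadElt]
        simp only [Finset.sum_mul, Algebra.TensorProduct.tmul_mul_tmul]
        refine Submodule.sum_mem _ fun k _ => Submodule.sum_mem _ fun l _ =>
          Submodule.subset_span ⟨_, ?_, _, rfl⟩
        rw [List.length_cons, mul_add, mul_one, add_comm, exteriorPower, pow_add, sq]
        exact Submodule.mul_mem_mul (Submodule.mul_mem_mul ⟨_, rfl⟩ ⟨_, rfl⟩) hw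
  have h2 := key ds
  generalize (ds.map (quadPow (2 * n))).prod = x at h2 ⊢
  induction h2 using Submodule.span_induction with
  | zero => simp
  | add x x' _ _ hx hx' => rw [map_add, hx, hx', add_zero]
  | smul c x _ hx => rw [map_smul, hx, smul_zero]
  | mem x hx =>
    obtain ⟨w, hw, a, rfl⟩ := hx
    rw [berezin_tmul, topCoeff_of_mem_exteriorPower _ (by omega) hw, zero_smul]

/-- The derivation of `⋀ℝ^m ⊗ A` replacing `η_k` by `η_l`. -/
def replaceEta {A : Type*} [Ring A] [Algebra ℝ A] (k l : Fin m) :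
    EtaAlg m ⊗[ℝ] A →ₗ[ℝ] EtaAlg m ⊗[ℝ] A :=
  LinearMap.rTensor A (LinearMap.mulLeft ℝ (eta1 l) ∘ₗ contract ((Pi.basisFun ℝ (Fin m)).coord k))

@[simp] theorem replaceEta_tmul {A : Type*} [Ring A] [Algebra ℝ A] (k l : Fin m) (w : EtaAlg m)
    (a : A) : replaceEta k l (w ⊗ₜ[ℝ] a) =
      (eta1 l * contract ((Pi.basisFun ℝ (Fin m)).coord k) w) ⊗ₜ a := by
  simp [replaceEta]

theorem berezin_replaceEta {A : Type*} [Ring A] [Algebra ℝ A] (k l : Fin m)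
    (x : EtaAlg m ⊗[ℝ] A) :
    berezin m A (replaceEta k l x) = if k = l then berezin m A x else 0 := by
  induction x using TensorProduct.induction_on with
  | zero => simp
  | add x y hx hy => simp only [map_add, hx, hy]; split_ifs <;> simp
  | tmul w a =>
    have h := topCoeff_ι_mul_contractLeft (Pi.basisFun ℝ (Fin m)) k l w
    rw [replaceEta_tmul, berezin_tmul, eta1, contract]
    rw [Pi.basisFun_apply] at h
    rw [h]
    split_ifs <;> simp

theorem replaceEta_mul {A : Type*} [Ring A] [Algebra ℝ A] (k l : Fin m)
    (x y : EtaAlg m ⊗[ℝ] A) :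
    replaceEta k l (x * y) = replaceEta k l x * y + x * replaceEta k l y := by
  induction x using TensorProduct.induction_on with
  | zero => simp
  | add x x' hx hx' => simp only [map_add, add_mul, hx, hx']; abel
  | tmul w a =>
    induction y using TensorProduct.induction_on with
    | zero => simp
    | add x x' hx hx' => simp only [map_add, mul_add, hx, hx']; abel
    | tmul w' a' =>
      simp only [Algebra.TensorProduct.tmul_mul_tmul, replaceEta_tmul, contract_mul, mul_add,
        TensorProduct.add_tmul, ← mul_assoc]
      rw [eta1, mul_ι_eq]

/-- The operator `∑_{kl} (dX^b)_{kl} η_l ∂/∂η_k`. -/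
def rotate (b : ℕ) (x : Coef m) : Coef m :=
  ∑ k, ∑ l, (1 ⊗ₜ (dMat m ^ b) k l) * replaceEta k l x

/-- The automorphism of `Coef m` induced by a power of the grade involution of `Ext m`. -/
def coefParity (m b : ℕ) : Coef m →ₐ[ℝ] Coef m :=
  Algebra.TensorProduct.map (AlgHom.id ℝ _) (parity ^ b)

theorem tmul_dMat_pow_mul (b : ℕ) (k l : Fin m) (x : Coef m) :
    (1 ⊗ₜ (dMat m ^ b) k l) * x = coefParity m b x * (1 ⊗ₜ (dMat m ^ b) k l) := by
  induction x using TensorProduct.induction_on with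
  | zero => simp
  | add x y hx hy => rw [mul_add, map_add, add_mul, hx, hy]
  | tmul w a => simp [coefParity, dMat_pow_mul]

/-- Integration by parts: the Berezin integral of the derivative along a linear vector field in η is
the integral times the trace of that field. -/
theorem berezin_rotate (b : ℕ) (x : Coef m) :
    berezin m (Ext m) (rotate b x) = (dMat m ^ b).trace * berezin m (Ext m) x := by
  simp only [rotate, map_sum, berezin_tmul_mul, berezin_replaceEta, Matrix.trace,
    Matrix.diag_apply, Finset.sum_mul]
  exact Finset.sum_congr rfl fun k _ => by simp

theorem rotate_mul (b : ℕ) (x y : Coef m) :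
    rotate b (x * y) = rotate b x * y + coefParity m b x * rotate b y := by
  simp only [rotate, replaceEta_mul, mul_add, Finset.sum_add_distrib, Finset.sum_mul,
    Finset.mul_sum]
  congr 1
  · simp only [mul_assoc]
  · refine Finset.sum_congr rfl fun k _ => Finset.sum_congr rfl fun l _ => ?_
    rw [← mul_assoc, tmul_dMat_pow_mul, mul_assoc]

theorem rotate_one (b : ℕ) : rotate b (1 : Coef m) = 0 := by
  simp [rotate, Algebra.TensorProduct.one_def, contract_one]

theorem contract_eta1 (k i : Fin m) : contract ((Pi.basisFun ℝ (Fin m)).coord k) (eta1 i) =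
    if i = k then 1 else 0 := by
  rw [eta1, contract_ι]
  by_cases h : i = k <;> simp [h]

theorem rotate_quadElt (b : ℕ) (M : Matrix (Fin m) (Fin m) (Ext m)) :
    rotate b (quadElt M) = quadElt ((dMat m ^ b)ᵀ * M) +
      quadElt (Matrix.of fun i l => ∑ k, (dMat m ^ b) k l * M i k) := by
  have h : ∀ k l, replaceEta k l (quadElt M) =
      ∑ j, (eta1 l * eta1 j) ⊗ₜ[ℝ] M k j + ∑ i, (eta1 i * eta1 l) ⊗ₜ[ℝ] M i k := by
    intro k l
    simp only [quadElt, map_sum, replaceEta_tmul, contract_mul, contract_eta1, mul_add,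
      TensorProduct.add_tmul, Finset.sum_add_distrib]
    congr 1
    · rw [Finset.sum_eq_single k]
      · simp
      · intro i _ hi; simp [hi]
      · simp
    · refine Finset.sum_congr rfl fun i _ => ?_
      rw [Finset.sum_eq_single k]
      · rw [← mul_assoc]
        rw [if_pos rfl, mul_one, eta1, eta1, mul_ι_eq]
      · intro i _ hi; simp [hi]
      · simp
  simp only [rotate, h, mul_add, Finset.sum_add_distrib, Finset.mul_sum,
    Algebra.TensorProduct.tmul_mul_tmul, one_mul]
  congr 1
  · rw [Finset.sum_comm, quadElt]
    refine Finset.sum_congr rfl fun l _ => ?_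
    rw [Finset.sum_comm]
    refine Finset.sum_congr rfl fun j _ => ?_
    rw [Matrix.mul_apply, TensorProduct.tmul_sum]
    rfl
  · simp only [quadElt, Matrix.of_apply, TensorProduct.tmul_sum]
    exact Finset.sum_comm.trans ((Finset.sum_congr rfl fun l _ => Finset.sum_comm).trans
      Finset.sum_comm)

/-- The field hits either η of ηᵀdX^dη. As dX^b is symmetric, both results are multiples of the
quadratic element of exponent b + d; they cancel if dX^d is symmetric and double if it is
antisymmetric. -/
theorem rotate_quadPow {b : ℕ} (hb : revSign b = 1) (d : ℕ) :
    rotate b (quadPow m d) = (1 - revSign d) • quadPow m (b + d) := by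
  have h1 : (dMat m ^ b)ᵀ = dMat m ^ b := by
    ext i j
    rw [Matrix.transpose_apply, dMat_pow_swap, hb, one_smul]
  have h2 : (Matrix.of fun i l => ∑ k, (dMat m ^ b) k l * (dMat m ^ d) i k) =
      revSign d • (dMat m ^ (b + d))ᵀ := by
    ext i l
    rw [Matrix.of_apply, Matrix.smul_apply, Matrix.transpose_apply, pow_add, Matrix.mul_apply,
      Finset.smul_sum]
    refine Finset.sum_congr rfl fun k _ => ?_
    rw [dMat_pow_swap b l k, hb, one_smul, dMat_pow_swap d k i, mul_smul_comm]
  rw [quadPow, rotate_quadElt, h1, ← pow_add, h2, quadElt_zsmul, quadElt_transpose, sub_smul,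
    one_smul, smul_neg, sub_eq_add_neg]
  rfl

theorem parity_pow_dMat_pow (b d : ℕ) (k l : Fin m) :
    (parity ^ b : Ext m →ₐ[ℝ] Ext m) ((dMat m ^ d) k l) =
      ((-1 : ℝ) ^ d) ^ b • (dMat m ^ d) k l := by
  induction b with
  | zero => simp
  | succ b ih => rw [pow_succ', AlgHom.mul_apply, ih, map_smul, parity_dMat_pow, smul_smul, ← pow_succ]

theorem coefParity_quadPow (b d : ℕ) :
    coefParity m b (quadPow m d) = ((-1 : ℝ) ^ d) ^ b • quadPow m d := by
  simp only [quadPow, quadElt, map_sum, coefParity, Algebra.TensorProduct.map_tmul, AlgHom.id_apply,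
    parity_pow_dMat_pow, TensorProduct.tmul_smul, Finset.smul_sum]

theorem coefParity_prod (b : ℕ) (ds : List ℕ) :
    ∃ c : ℝ, c ≠ 0 ∧
      coefParity m b (ds.map (quadPow m)).prod = c • (ds.map (quadPow m)).prod := by
  induction ds with
  | nil => exact ⟨1, one_ne_zero, by simp⟩
  | cons d ds ih =>
    obtain ⟨c, hc, h⟩ := ih
    refine ⟨((-1) ^ d) ^ b * c, mul_ne_zero (pow_ne_zero _ (pow_ne_zero _ (by norm_num))) hc, ?_⟩
    rw [List.map_cons, List.prod_cons, map_mul, h, coefParity_quadPow, smul_mul_smul_comm]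

theorem rotate_prod_mem {b : ℕ} (hb : revSign b = 1) (ds : List ℕ) :
    rotate b (ds.map (quadPow m)).prod ∈ Submodule.span ℝ
      {x : Coef m | ∃ ds' : List ℕ, ds'.length = ds.length ∧ x = (ds'.map (quadPow m)).prod} := by
  induction ds with
  | nil => simp [rotate_one]
  | cons d ds ih =>
    rw [List.map_cons, List.prod_cons, rotate_mul, rotate_quadPow hb, coefParity_quadPow]
    refine add_mem ?_ ?_
    · rw [← Int.cast_smul_eq_zsmul ℝ, smul_mul_assoc]
      exact Submodule.smul_mem _ _ (Submodule.subset_span ⟨(b + d) :: ds, by simp, by simp⟩)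
    · rw [smul_mul_assoc]
      refine Submodule.smul_mem _ _ ?_
      generalize rotate b (ds.map (quadPow m)).prod = x at ih ⊢
      induction ih using Submodule.span_induction with
      | zero => rw [mul_zero]; exact zero_mem _
      | add x x' _ _ hx hx' => rw [mul_add]; exact add_mem hx hx'
      | smul c x _ hx => rw [mul_smul_comm]; exact Submodule.smul_mem _ _ hx
      | mem x hx =>
        obtain ⟨ds', h, rfl⟩ := hx
        exact Submodule.subset_span ⟨d :: ds', by simp [h], by simp⟩

/-- This element is even in η and in dX separately, hence central. -/
theorem quadPow_two_comm (x : Coef m) : quadPow m 2 * x = x * quadPow m 2 := by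
  have h1 : ∀ k l (y : Ext m), (dMat m ^ 2) k l * y = y * (dMat m ^ 2) k l := by
    intro k l y
    have h : (parity ^ 2 : Ext m →ₐ[ℝ] Ext m) y = y := by
      rw [pow_two, AlgHom.mul_apply, parity_parity]
    rw [dMat_pow_mul, h]
  have h2 : ∀ (k l : Fin m) (w : EtaAlg m), eta1 k * eta1 l * w = w * (eta1 k * eta1 l) :=
    fun k l w => commute_of_parity_eq (by simp [eta1]) w
  induction x using TensorProduct.induction_on with
  | zero => simp
  | add x y hx hy => rw [mul_add, add_mul, hx, hy]
  | tmul w a =>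
    simp only [quadPow, quadElt, Finset.sum_mul, Finset.mul_sum,
      Algebra.TensorProduct.tmul_mul_tmul, h1, h2]

theorem rotate_quadPow_two_pow {b : ℕ} (hb : revSign b = 1) (k : ℕ) :
    rotate b (quadPow m 2 ^ (k + 1)) =
      (2 * (k + 1) : ℝ) • (quadPow m (b + 2) * quadPow m 2 ^ k) := by
  have h2 : rotate b (quadPow m 2) = (2 : ℝ) • quadPow m (b + 2) := by
    rw [rotate_quadPow hb, show (1 - revSign 2) = 2 from rfl, ← Int.cast_smul_eq_zsmul ℝ]
    norm_num
  have h3 : coefParity m b (quadPow m 2) = quadPow m 2 := by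
    rw [coefParity_quadPow]; simp
  induction k with
  | zero => simp [h2]
  | succ k ih =>
    rw [pow_succ', rotate_mul, ih, h2, h3, mul_smul_comm, ← mul_assoc, quadPow_two_comm, mul_assoc,
      ← pow_succ', smul_mul_assoc, ← add_smul]
    congr 1
    push_cast
    ring

/-- The multiples of the Pfaffian of `dX²` by elements of `traceAlg`. -/
def pfaffianIdeal (n : ℕ) : Submodule ℝ (Ext (2 * n)) :=
  (Subalgebra.toSubmodule (traceAlg (2 * n))).map
    (LinearMap.mulLeft ℝ (pfaffian n (dMat (2 * n) ^ 2)))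

theorem pfaffian_mem {n : ℕ} {A : Type*} [Ring A] [Algebra ℝ A]
    {M : Matrix (Fin (2 * n)) (Fin (2 * n)) A} {S : Subalgebra ℝ A} (h : ∀ i j, M i j ∈ S) :
    pfaffian n M ∈ S := by
  rw [pfaffian]
  refine S.smul_mem (S.sum_mem fun σ _ => S.zsmul_mem (list_prod_mem fun x hx => ?_) _) _
  obtain ⟨i, rfl⟩ := List.mem_ofFn.1 hx
  exact h _ _

theorem pfaffian_dMat_sq_comm {n : ℕ} (x : Ext (2 * n)) :
    pfaffian n (dMat (2 * n) ^ 2) * x = x * pfaffian n (dMat (2 * n) ^ 2) := by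
  have h : pfaffian n (dMat (2 * n) ^ 2) ∈ Subalgebra.center ℝ (Ext (2 * n)) := by
    refine pfaffian_mem fun i j => ?_
    rw [Subalgebra.mem_center_iff]
    intro y
    have h : (parity ^ 2 : Ext (2 * n) →ₐ[ℝ] Ext (2 * n)) y = y := by
      rw [pow_two, AlgHom.mul_apply, parity_parity]
    rw [dMat_pow_mul, h]
  exact (Subalgebra.mem_center_iff.1 h x).symm

theorem mul_mem_pfaffianIdeal {n : ℕ} {r x : Ext (2 * n)} (hr : r ∈ traceAlg (2 * n))
    (hx : x ∈ pfaffianIdeal n) : r * x ∈ pfaffianIdeal n := by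
  obtain ⟨y, hy, rfl⟩ := hx
  refine ⟨r * y, (mul_mem hr hy : r * y ∈ traceAlg (2 * n)), ?_⟩
  rw [LinearMap.mulLeft_apply, LinearMap.mulLeft_apply, ← mul_assoc, ← mul_assoc,
    pfaffian_dMat_sq_comm]

theorem map_mul_mem_of_smul {A E : Type*} [Ring A] [Algebra ℝ A] [AddCommGroup E] [Module ℝ E]
    {f : A →ₗ[ℝ] E} {V : Submodule ℝ E} {a b : ℝ} (ha : a ≠ 0) (hb : b ≠ 0) {x y : A}
    (h : f (a • x * b • y) ∈ V) : f (x * y) ∈ V := by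
  rw [smul_mul_smul_comm, map_smul] at h
  have h2 := V.smul_mem (a * b)⁻¹ h
  rwa [inv_smul_smul₀ (mul_ne_zero ha hb)] at h2

-- Induction on the number r of factors in `ds`, with k recording how many factors have already
-- become ηᵀdX²η. Integration by parts trades the last factor of `ds` for one more ηᵀdX²η, modulo
-- integrals with fewer factors in the list. When `ds` is empty the integral is a multiple of
-- Pf(dX²).
set_option maxHeartbeats 1000000 in
theorem berezin_prod_mul_pow_mem {n : ℕ} (ds : List ℕ) (k : ℕ) (h : ds.length + k = n) :
    berezin (2 * n) (Ext (2 * n)) ((ds.map (quadPow (2 * n))).prod * quadPow (2 * n) 2 ^ k) ∈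
      pfaffianIdeal n := by
  generalize hr : ds.length = r at h
  induction r generalizing ds k with
  | zero =>
    obtain rfl := List.eq_nil_of_length_eq_zero hr
    obtain rfl : k = n := by omega
    rw [List.map_nil, List.prod_nil, one_mul, quadPow, berezin_quadElt_pow]
    exact Submodule.smul_mem _ _ ⟨1, one_mem (traceAlg _), by simp⟩
  | succ r ih =>
    obtain ⟨ds, d, rfl⟩ : ∃ ds' d, ds = ds' ++ [d] :=
      ⟨ds.dropLast, ds.getLast (by rintro rfl; simp at hr), (List.dropLast_append_getLast _).symm⟩
    rw [List.length_append, List.length_singleton] at hr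
    have hr' : ds.length = r := by omega
    -- Either the factor vanishes, or d ≥ 2 and dX^{d-2} is symmetric, as `rotate_quadPow` requires.
    have hcases : revSign d = 1 ∨ ∃ b, d = b + 2 ∧ revSign b = 1 := by
      rcases d with _ | _ | b
      · exact Or.inl rfl
      · exact Or.inl rfl
      · have h1 : revSign (b + 2) = -revSign b := by
          rw [revSign_succ, revSign_succ, pow_succ]
          rcases neg_one_pow_eq_or ℤ b with h | h <;> simp [h]
        rcases neg_one_pow_eq_or ℤ (b.choose 2) with h | h
        · exact Or.inr ⟨b, rfl, h⟩
        · left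
          rw [h1, revSign, h, neg_neg]
    rw [List.map_append, List.prod_append, List.map_singleton, List.prod_singleton]
    rcases hcases with hd | ⟨b, rfl, hb⟩
    · rw [quadPow_eq_zero hd]
      simp
    · have h1 := berezin_rotate b
        ((ds.map (quadPow (2 * n))).prod * quadPow (2 * n) 2 ^ (k + 1))
      have h2 := mul_mem_pfaffianIdeal (trace_mem_traceAlg b) (ih ds (k + 1) hr' (by omega))
      obtain ⟨c, hc, hp⟩ := coefParity_prod (m := 2 * n) b ds
      have h3 : ∀ x ∈ Submodule.span ℝ {x : Coef (2 * n) | ∃ ds' : List ℕ,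
          ds'.length = ds.length ∧ x = (ds'.map (quadPow (2 * n))).prod},
          berezin (2 * n) (Ext (2 * n)) (x * quadPow (2 * n) 2 ^ (k + 1)) ∈ pfaffianIdeal n := by
        intro x hx
        induction hx using Submodule.span_induction with
        | zero => simp
        | add x x' _ _ hx hx' => rw [add_mul, map_add]; exact add_mem hx hx'
        | smul c x _ hx => rw [smul_mul_assoc, map_smul]; exact Submodule.smul_mem _ _ hx
        | mem x hx =>
          obtain ⟨ds', h, rfl⟩ := hx
          exact ih ds' (k + 1) (by omega) (by omega)
      rw [← h1, rotate_mul, map_add] at h2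
      have h4 := sub_mem h2 (h3 _ (rotate_prod_mem hb ds))
      rw [add_sub_cancel_left, rotate_quadPow_two_pow hb, hp] at h4
      rw [mul_assoc]
      exact map_mul_mem_of_smul hc (mul_ne_zero two_ne_zero (Nat.cast_add_one_ne_zero k)) h4

theorem berezin_mem_pfaffianIdeal {n : ℕ} {x : Coef (2 * n)} (hx : x ∈ invAlg (2 * n)) :
    berezin (2 * n) (Ext (2 * n)) x ∈ pfaffianIdeal n := by
  have h := invAlg_le_span hx
  clear hx
  induction h using Submodule.span_induction with
  | zero => simp
  | add x x' _ _ hx hx' => rw [map_add]; exact add_mem hx hx'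
  | smul c x _ hx => rw [map_smul]; exact Submodule.smul_mem _ _ hx
  | mem x hx =>
    obtain ⟨r, hr, ds, rfl⟩ := hx
    rw [berezin_tmul_mul]
    refine mul_mem_pfaffianIdeal hr ?_
    by_cases h : ds.length = n
    · simpa using berezin_prod_mul_pow_mem ds 0 (by omega)
    · rw [berezin_prod_of_length_ne h]
      exact zero_mem _

/-- The volume element is the product of the Pfaffian of `dX²` and a polynomial in the traces of
powers of `dX`. -/
theorem coordVolume_mem_pfaffianIdeal (n : ℕ) : coordVolume (2 * n) ∈ pfaffianIdeal n := by
  have h := berezin_mem_pfaffianIdeal (etaTop_tmul_coordVolume_mem n)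
  rwa [berezin_tmul, etaTop, topCoeff_ιMulti_self, one_smul] at h

end Berezin

/-! ### Matrices whose powers are traceless -/

section Nilpotent

open Polynomial

variable {ι C : Type*} [Fintype ι] [DecidableEq ι] [CommRing C]

/-- Jacobi's formula: differentiate one row at a time and recognise the cofactors. -/
theorem derivative_det (N : Matrix ι ι C[X]) :
    derivative N.det = (N.adjugate * N.map derivative).trace := by
  have h1 : derivative N.det = ∑ i, (N.updateRow i fun j => derivative (N i j)).det := by
    simp only [Matrix.det_apply, Units.smul_def]
    rw [map_sum, Finset.sum_comm]
    refine Finset.sum_congr rfl fun σ _ => ?_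
    rw [map_zsmul, derivative_prod_finset, Finset.smul_sum, ← Equiv.sum_comp σ fun x =>
      (Equiv.Perm.sign σ : ℤ) • ∏ i, N.updateRow x (fun j => derivative (N x j)) (σ i) i]
    refine Finset.sum_congr rfl fun a _ => ?_
    rw [← Finset.prod_erase_mul _ _ (Finset.mem_univ a), Matrix.updateRow_self]
    congr 2
    refine Finset.prod_congr rfl fun b hb => ?_
    rw [Matrix.updateRow_ne (σ.injective.ne (Finset.ne_of_mem_erase hb))]
  rw [h1, Matrix.trace_mul_comm]
  refine Finset.sum_congr rfl fun i _ => ?_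
  rw [← Matrix.cramer_transpose_apply, Matrix.cramer_eq_adjugate_mulVec, ← Matrix.adjugate_transpose,
    Matrix.mulVec, dotProduct, Matrix.diag_apply, Matrix.mul_apply]
  exact Finset.sum_congr rfl fun j _ => mul_comm _ _

/-- By Jacobi's formula the derivative of det(1 - XM) is -tr(adj(1 - XM) M). Expanding the inverse
as a geometric series to order K leaves only traces of positive powers of M and a multiple of X^K.
So X^K divides the derivative for every K, and the polynomial is constant. -/
theorem charpolyRev_eq_one [Algebra ℝ C] {M : Matrix ι ι C}
    (hM : ∀ k, (M ^ (k + 1)).trace = 0) : M.charpolyRev = 1 := by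
  set Y : Matrix ι ι C[X] := (X : C[X]) • M.map Polynomial.C with hY
  have hpow : ∀ k, Y ^ k = (X ^ k : C[X]) • (M ^ k).map Polynomial.C := by
    intro k
    rw [hY, _root_.smul_pow]
    congr 1
    exact (map_pow (Polynomial.C : C →+* C[X]).mapMatrix M k).symm
  have hY' : (1 - Y).map derivative = -M.map Polynomial.C := by
    ext1 i j
    by_cases h : i = j <;> simp [hY, h]
  have hder : derivative M.charpolyRev = 0 := by
    have hdvd : ∀ K, (X : C[X]) ^ K ∣ derivative M.charpolyRev := by
      intro K
      have h1 : derivative M.charpolyRev =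
          -((1 - Y).adjugate * M.map Polynomial.C).trace := by
        rw [Matrix.charpolyRev, derivative_det, hY', Matrix.mul_neg, Matrix.trace_neg]
      have h2 : (1 - Y).adjugate * (1 - Y ^ K) = (1 - Y).det • ∑ k ∈ Finset.range K, Y ^ k := by
        rw [← mul_neg_geom_sum, ← mul_assoc, Matrix.adjugate_mul, smul_mul_assoc, one_mul]
      have h3 : ((1 - Y).adjugate * (1 - Y ^ K) * M.map Polynomial.C).trace = 0 := by
        rw [h2, smul_mul_assoc, Matrix.trace_smul, Finset.sum_mul, Matrix.trace_sum,
          Finset.sum_eq_zero, smul_zero]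
        intro k _
        have : (M ^ k).map Polynomial.C * M.map Polynomial.C =
            (M ^ (k + 1)).map (Polynomial.C : C →+* C[X]) := by
          rw [pow_succ, Matrix.map_mul]
        rw [hpow, smul_mul_assoc, this, Matrix.trace_smul]
        have h4 : ((M ^ (k + 1)).map (Polynomial.C : C →+* C[X])).trace =
            Polynomial.C (M ^ (k + 1)).trace := by
          simp [Matrix.trace]
        rw [h4, hM, map_zero, smul_zero]
      rw [mul_sub, mul_one, sub_mul, Matrix.trace_sub, sub_eq_zero] at h3
      rw [h1, h3, hpow, mul_smul_comm, smul_mul_assoc, Matrix.trace_smul, smul_eq_mul, ← mul_neg]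
      exact dvd_mul_right _ _
    ext j
    exact X_pow_dvd_iff.1 (hdvd (j + 1)) j (Nat.lt_succ_self j)
  ext j
  rcases j with _ | j
  · rw [coeff_zero_eq_eval_zero, Matrix.eval_charpolyRev, coeff_one_zero]
  · have h := congrArg (fun p => p.coeff j) hder
    simp only [coeff_derivative, coeff_zero] at h
    -- Characteristic zero: a vanishing derivative forces all higher coefficients to vanish.
    have hu : IsUnit ((j : C) + 1) := by
      have := (Ne.isUnit (Nat.cast_add_one_ne_zero (R := ℝ) j)).map (algebraMap ℝ C)
      simpa using this
    rw [hu.mul_left_eq_zero] at h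
    rw [h, coeff_one, if_neg (Nat.succ_ne_zero j)]

/-- Over a commutative real algebra, a matrix all of whose powers are traceless is nilpotent. -/
theorem pow_card_eq_zero_of_trace [Algebra ℝ C] {M : Matrix ι ι C}
    (hM : ∀ k, (M ^ (k + 1)).trace = 0) : M ^ Fintype.card ι = 0 := by
  nontriviality C
  have h1 := charpolyRev_eq_one hM
  rw [← Matrix.reverse_charpoly] at h1
  -- Its reversal is 1; Cayley–Hamilton then gives nilpotency.
  have h2 : M.charpoly = X ^ Fintype.card ι := by
    ext j
    by_cases hj : j ≤ Fintype.card ι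
    · have h3 := congrArg (fun p => p.coeff (Fintype.card ι - j)) h1
      simp only [coeff_reverse, Matrix.charpoly_natDegree_eq_dim] at h3
      rw [revAt_le (Nat.sub_le _ _), Nat.sub_sub_self hj] at h3
      rw [h3, coeff_one, coeff_X_pow]
      congr 1
      simp only [eq_iff_iff]
      omega
    · rw [coeff_eq_zero_of_natDegree_lt, coeff_X_pow, if_neg (by omega)]
      rw [Matrix.charpoly_natDegree_eq_dim]
      omega
  have h3 := Matrix.aeval_self_charpoly M
  rwa [h2, map_pow, aeval_X] at h3

end Nilpotent

/-! ### Traces of powers of `dX` -/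

section Traces

open ExteriorAlgebra Module

variable {m : ℕ}

theorem eq_zero_of_eq_neg {E : Type*} [AddCommGroup E] [Module ℝ E] {x : E} (h : x = -x) :
    x = 0 := by
  have h2 : (2 : ℝ) • x = 0 := by
    rw [two_smul]
    nth_rw 1 [h]
    exact neg_add_cancel x
  exact (smul_eq_zero.mp h2).resolve_left two_ne_zero

theorem trace_dMat_pow_of_revSign {d : ℕ} (hd : revSign d = -1) : (dMat m ^ d).trace = 0 := by
  refine Finset.sum_eq_zero fun i _ => ?_
  have h := dMat_pow_swap d i i
  rw [hd, neg_one_zsmul] at h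
  exact eq_zero_of_eq_neg h

/-- Cyclically moving one odd entry past an odd number of odd entries changes the sign of the trace.
-/
theorem trace_dMat_pow_even (k : ℕ) : (dMat m ^ (2 * (k + 1))).trace = 0 := by
  have h : (dMat m ^ (2 * (k + 1))).trace = -(dMat m ^ (2 * (k + 1))).trace := by
    have hp : ∀ i j, (parity ^ (2 * k + 1) : Ext m →ₐ[ℝ] Ext m) (dMat m i j) = -dMat m i j := by
      intro i j
      have := parity_pow_dMat_pow (2 * k + 1) 1 i j
      rw [pow_one, pow_one, Odd.neg_one_pow ⟨k, rfl⟩, neg_one_smul] at this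
      exact this
    rw [show 2 * (k + 1) = 2 * k + 1 + 1 by ring]
    have h1 : dMat m ^ (2 * k + 1 + 1) = dMat m ^ (2 * k + 1) * dMat m := pow_succ _ _
    have h2 : dMat m ^ (2 * k + 1 + 1) = dMat m * dMat m ^ (2 * k + 1) := pow_succ' _ _
    nth_rw 1 [h1]
    rw [h2]
    simp only [Matrix.trace, Matrix.diag_apply, Matrix.mul_apply]
    rw [Finset.sum_comm, ← Finset.sum_neg_distrib]
    refine Finset.sum_congr rfl fun l _ => ?_
    rw [← Finset.sum_neg_distrib]
    refine Finset.sum_congr rfl fun i _ => ?_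
    rw [dMat_pow_mul, hp, neg_mul]
  exact eq_zero_of_eq_neg h

theorem dMat_sq_mem_center (i j : Fin m) : (dMat m ^ 2) i j ∈ Subalgebra.center ℝ (Ext m) := by
  rw [Subalgebra.mem_center_iff]
  intro y
  have h : (parity ^ 2 : Ext m →ₐ[ℝ] Ext m) y = y := by
    rw [pow_two, AlgHom.mul_apply, parity_parity]
  rw [dMat_pow_mul, h]

/-- Rosset's argument for the Amitsur–Levitzki theorem: dX² has entries in the commutative centre,
and all its positive powers are traceless, so its m-th power vanishes. -/
theorem dMat_pow_two_mul_eq_zero (m : ℕ) : dMat m ^ (2 * m) = 0 := by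
  let M : Matrix (Fin m) (Fin m) (Subalgebra.center ℝ (Ext m)) :=
    Matrix.of fun i j => ⟨(dMat m ^ 2) i j, dMat_sq_mem_center i j⟩
  have hM : ∀ k, (Subalgebra.center ℝ (Ext m)).val.toRingHom.mapMatrix (M ^ k) =
      dMat m ^ (2 * k) := by
    intro k
    rw [map_pow, pow_mul]
    rfl
  have h : M ^ Fintype.card (Fin m) = 0 := by
    refine pow_card_eq_zero_of_trace fun k => Subtype.ext ?_
    have h2 := trace_dMat_pow_even (m := m) k
    rw [← hM] at h2
    rw [ZeroMemClass.coe_zero, ← h2]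
    simp [Matrix.trace]
  rw [Fintype.card_fin] at h
  rw [← hM, h, map_zero]

theorem revSign_add_four (d : ℕ) : revSign (d + 4) = revSign d := by
  simp only [revSign_succ, pow_succ]
  rcases neg_one_pow_eq_or ℤ d with h | h <;> simp [h]

theorem revSign_four_mul_add (k d : ℕ) : revSign (4 * k + d) = revSign d := by
  induction k with
  | zero => simp
  | succ k ih => rw [show 4 * (k + 1) + d = 4 * k + d + 4 by ring, revSign_add_four, ih]

/-- The only non-vanishing traces of powers of `dX`. -/
theorem trace_dMat_pow_cases (n d : ℕ) : (dMat (2 * n) ^ d).trace = 0 ∨ d = 0 ∨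
    ∃ k < n, d = 4 * k + 1 := by
  by_cases h0 : d = 0
  · exact Or.inr (Or.inl h0)
  by_cases h4 : 4 * n ≤ d
  · left
    rw [← Nat.sub_add_cancel h4, pow_add, show 4 * n = 2 * (2 * n) by ring,
      dMat_pow_two_mul_eq_zero, mul_zero, Matrix.trace_zero]
  have h5 : d = 4 * (d / 4) + d % 4 := (Nat.div_add_mod d 4).symm
  have h6 : d % 4 < 4 := Nat.mod_lt _ (by norm_num)
  interval_cases h : d % 4
  · left
    -- The truncated subtraction is harmless: d is a non-zero multiple of 4.
    have := trace_dMat_pow_even (m := 2 * n) (2 * (d / 4) - 1)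
    rwa [show 2 * (2 * (d / 4) - 1 + 1) = d by omega] at this
  · exact Or.inr (Or.inr ⟨d / 4, by omega, h5⟩)
  · left
    refine trace_dMat_pow_of_revSign ?_
    rw [h5, revSign_four_mul_add]
    rfl
  · left
    refine trace_dMat_pow_of_revSign ?_
    rw [h5, revSign_four_mul_add]
    rfl

end Traces

/-! ### Left ideals of exterior algebras -/

section LeftIdeal

open ExteriorAlgebra Module Set.powersetCard

theorem exists_list_basis_exteriorAlgebra {K V I : Type*} [CommRing K] [AddCommGroup V] [Module K V]
    [LinearOrder I] (b : Basis I K V) (s : Finset I) :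
    ∃ l : List I, l.Nodup ∧ (∀ i, i ∈ l ↔ i ∈ s) ∧
      b.ExteriorAlgebra s = (l.map fun i => ι K (b i)).prod := by
  have h : s.card = s.card := rfl
  refine ⟨List.ofFn (s.orderEmbOfFin h), ?_, fun i => ?_, ?_⟩
  · exact List.nodup_ofFn.2 (s.orderEmbOfFin h).injective
  · rw [List.mem_ofFn, ← Set.mem_range, Finset.range_orderEmbOfFin]
    rfl
  · rw [basis_apply_ofCard b h, ιMulti_family, ιMulti_apply, List.map_ofFn]
    rfl

/-- In a non-zero element choose a monomial of least size and multiply by the monomial of the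
complementary index set. Every other monomial present meets that complement and dies, leaving a
non-zero multiple of the top one. -/
theorem basis_univ_mem_of_ne_bot {K V I : Type*} [Field K] [AddCommGroup V] [Module K V]
    [LinearOrder I] [Fintype I] (b : Basis I K V) {J : Submodule K (ExteriorAlgebra K V)}
    (hJ : ∀ x, ∀ y ∈ J, x * y ∈ J) (h0 : J ≠ ⊥) : b.ExteriorAlgebra Finset.univ ∈ J := by
  obtain ⟨y, hy, hy0⟩ := Submodule.exists_mem_ne_zero_of_ne_bot h0
  have hsupp : (b.ExteriorAlgebra.repr y).support.Nonempty := by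
    rw [Finsupp.support_nonempty_iff]
    exact (LinearEquiv.map_ne_zero_iff _).2 hy0
  obtain ⟨s, hs, hmin⟩ := Finset.exists_min_image _ Finset.card hsupp
  have h1 : b.ExteriorAlgebra sᶜ * y =
      b.ExteriorAlgebra.repr y s • (b.ExteriorAlgebra sᶜ * b.ExteriorAlgebra s) := by
    nth_rw 1 [← b.ExteriorAlgebra.linearCombination_repr y]
    rw [Finsupp.linearCombination_apply, Finsupp.sum, Finset.mul_sum, Finset.sum_eq_single s]
    · rw [mul_smul_comm]
    · intro t ht hts
      have hd : ¬Disjoint sᶜ t := by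
        intro h
        refine hts (Finset.eq_of_subset_of_card_le (fun i hi => ?_) (hmin t ht))
        by_contra his
        exact Finset.disjoint_left.1 h (Finset.mem_compl.2 his) hi
      have h2 := basis_mul_of_not_disjoint b (ofCard (s := sᶜ) rfl) (ofCard (s := t) rfl) hd
      rw [val_ofCard, val_ofCard] at h2
      rw [mul_smul_comm, h2, smul_zero]
    · intro h; exact absurd hs h
  have hd : Disjoint sᶜ s := disjoint_compl_left
  have h2 := basis_mul_of_disjoint b (ofCard (s := sᶜ) rfl) (ofCard (s := s) rfl) hd
  rw [val_ofCard, val_ofCard] at h2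
  have h3 : ((disjUnion (s := ofCard (s := sᶜ) rfl) (t := ofCard (s := s) rfl) hd :
      Set.powersetCard I _) : Finset I) = Finset.univ := by
    ext i
    simpa [disjUnion] using (em (i ∈ s)).symm
  rw [h3] at h2
  have h4 := hJ (b.ExteriorAlgebra sᶜ) y hy
  rw [h1, h2] at h4
  have hc : b.ExteriorAlgebra.repr y s ≠ 0 := Finsupp.mem_support_iff.1 hs
  have h5 := J.smul_mem (b.ExteriorAlgebra.repr y s)⁻¹ h4
  rw [inv_smul_smul₀ hc] at h5
  rcases Int.units_eq_one_or (permOfDisjoint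
    (s := ofCard (s := sᶜ) rfl) (t := ofCard (s := s) rfl) hd).sign with h | h
  · rwa [h, one_smul] at h5
  · rw [h, Units.neg_smul, one_smul] at h5
    simpa using J.neg_mem h5

end LeftIdeal

/-! ### Products of traces -/

section OddTraces

open ExteriorAlgebra Module

/-- The odd traces `tr dX^{4k+1}`. -/
def oddTrace (m k : ℕ) : Ext m := (dMat m ^ (4 * k + 1)).trace

theorem oddTrace_mem_odd (m k : ℕ) : oddTrace m k ∈ CliffordAlgebra.evenOdd 0 1 := by
  have h : ((4 * k + 1 : ℕ) : ZMod 2) = 1 := by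
    rw [ZMod.natCast_eq_one_iff_odd]
    exact ⟨2 * k, by ring⟩
  rw [← h]
  rw [oddTrace, Matrix.trace]
  exact Submodule.sum_mem _ fun i _ =>
    pow_mem_evenOdd (A := dMat m) (fun i j => CliffordAlgebra.ι_mem_evenOdd_one _ _) _ i i

theorem anticomm_of_odd {m : ℕ} {x y : Ext m} (hx : x ∈ CliffordAlgebra.evenOdd 0 1)
    (hy : y ∈ CliffordAlgebra.evenOdd 0 1) : x * y = -(y * x) := by
  have h := mul_self_of_odd (add_mem hx hy)
  rw [add_mul, mul_add, mul_add, mul_self_of_odd hx, mul_self_of_odd hy, zero_add, add_zero] at h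
  exact eq_neg_of_add_eq_zero_left h

theorem prod_eq_or_eq_neg_of_perm {m : ℕ} {l l' : List (Ext m)} (h : l.Perm l')
    (hl : ∀ x ∈ l, x ∈ CliffordAlgebra.evenOdd 0 1) : l.prod = l'.prod ∨ l.prod = -l'.prod := by
  induction h with
  | nil => exact Or.inl rfl
  | cons x h ih =>
    rcases ih fun y hy => hl y (List.mem_cons_of_mem _ hy) with h | h <;> simp [h]
  | swap x y l =>
    right
    have := anticomm_of_odd (hl y (by simp)) (hl x (by simp))
    simp only [List.prod_cons, ← mul_assoc, this, neg_mul]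
  | trans h1 h2 ih1 ih2 =>
    have h3 := ih2 fun x hx => hl x (h1.mem_iff.2 hx)
    rcases ih1 hl with h | h <;> rcases h3 with h' | h' <;> simp [h, h']

theorem dMat_pow_mem_exteriorPower {m : ℕ} (d : ℕ) (i j : Fin m) :
    (dMat m ^ d) i j ∈ ⋀[ℝ]^d (Dual ℝ (symMat m)) := by
  induction d generalizing j with
  | zero =>
    rw [pow_zero, Matrix.one_apply, exteriorPower, pow_zero]
    split_ifs
    · exact Submodule.one_le.1 le_rfl
    · exact zero_mem _
  | succ d ih =>
    rw [pow_succ, Matrix.mul_apply, exteriorPower, pow_succ]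
    exact Submodule.sum_mem _ fun k _ => Submodule.mul_mem_mul (ih k) ⟨_, rfl⟩

theorem oddTrace_mem_exteriorPower (m k : ℕ) :
    oddTrace m k ∈ ⋀[ℝ]^(4 * k + 1) (Dual ℝ (symMat m)) := by
  rw [oddTrace, Matrix.trace]
  exact Submodule.sum_mem _ fun i _ => dMat_pow_mem_exteriorPower _ i i

theorem list_prod_mem_exteriorPower {V ι : Type*} [AddCommGroup V] [Module ℝ V] (l : List ι)
    (f : ι → ExteriorAlgebra ℝ V) (d : ι → ℕ) (hf : ∀ i ∈ l, f i ∈ ⋀[ℝ]^(d i) V) :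
    (l.map f).prod ∈ ⋀[ℝ]^((l.map d).sum) V := by
  induction l with
  | nil => simp
  | cons i l ih =>
    rw [List.map_cons (f := f), List.map_cons (f := d), List.prod_cons, List.sum_cons, exteriorPower, pow_add]
    exact Submodule.mul_mem_mul (hf i (by simp)) (ih fun j hj => hf j (by simp [hj]))

theorem pfaffian_dMat_sq_mem_exteriorPower (n : ℕ) :
    pfaffian n (dMat (2 * n) ^ 2) ∈ ⋀[ℝ]^(2 * n) (Dual ℝ (symMat (2 * n))) := by
  refine Submodule.smul_mem _ _ (Submodule.sum_mem _ fun σ _ => zsmul_mem ?_ _)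
  rw [List.ofFn_eq_map]
  have h := list_prod_mem_exteriorPower (List.finRange n) (fun i : Fin n =>
    (dMat (2 * n) ^ 2) (σ ⟨2 * i.1, by omega⟩) (σ ⟨2 * i.1 + 1, by omega⟩)) (fun _ => 2)
    fun i _ => dMat_pow_mem_exteriorPower 2 _ _
  simpa [mul_comm] using h

/-- The algebra homomorphism from an abstract exterior algebra to the algebra of traces. -/
def traceHom (n : ℕ) : ExteriorAlgebra ℝ (Fin n → ℝ) →ₐ[ℝ] Ext (2 * n) :=
  ExteriorAlgebra.lift ℝ ⟨Fintype.linearCombination ℝ fun k : Fin n => oddTrace (2 * n) k, fun v => by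
    rw [Fintype.linearCombination_apply]
    exact mul_self_of_odd (Submodule.sum_mem _ fun k _ =>
      Submodule.smul_mem _ _ (oddTrace_mem_odd _ _))⟩

theorem traceHom_ι_basis (n : ℕ) (k : Fin n) :
    traceHom n (ι ℝ (Pi.basisFun ℝ (Fin n) k)) = oddTrace (2 * n) k := by
  rw [traceHom, lift_ι_apply]
  simp

theorem traceAlg_le_range (n : ℕ) : traceAlg (2 * n) ≤ (traceHom n).range := by
  refine Algebra.adjoin_le ?_
  rintro x ⟨d, rfl⟩
  rcases trace_dMat_pow_cases n d with h | rfl | ⟨k, hk, rfl⟩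
  · rw [h]; exact zero_mem _
  · rw [pow_zero, Matrix.trace_one]
    exact natCast_mem _ _
  · exact ⟨_, traceHom_ι_basis n ⟨k, hk⟩⟩

/-- Obtained by putting all d_i = 2 in `prod_upperPairs` and comparing exponents. -/
theorem length_upperPairs (m : ℕ) : 2 * (upperPairs m).length = m * (m + 1) := by
  have h := prod_upperPairs (m := m) fun _ => (2 : ℝ)
  rw [List.map_const', List.prod_replicate, Finset.prod_const, Finset.card_univ, Fintype.card_fin,
    ← pow_mul, ← sq, ← pow_mul] at h
  exact Nat.pow_right_injective le_rfl (by exact_mod_cast h)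

theorem sum_range_four_mul_add_one (n : ℕ) :
    ∑ k ∈ Finset.range n, (4 * k + 1) + 2 * n = n * (2 * n + 1) := by
  induction n with
  | zero => simp
  | succ n ih =>
    rw [Finset.sum_range_succ]
    linarith

/-- The product of the Pfaffian of `dX²` with all the odd traces does not vanish. -/
theorem pfaffian_mul_oddTraces_ne_zero (n : ℕ) {l : List ℕ} (hl : l.Perm (List.range n)) :
    pfaffian n (dMat (2 * n) ^ 2) * (l.map (oddTrace (2 * n))).prod ≠ 0 := by
  intro h0
  let b := Pi.basisFun ℝ (Fin n)
  let L : ExteriorAlgebra ℝ (Fin n → ℝ) →ₗ[ℝ] ℝ := topCoeff (volBasis (2 * n)) ∘ₗ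
    LinearMap.mulLeft ℝ (pfaffian n (dMat (2 * n) ^ 2)) ∘ₗ (traceHom n).toLinearMap
  -- If the product vanished, this functional would kill every monomial in the traces: the full one
  -- by hypothesis, up to reordering sign, and the others because their degree is too small. But the
  -- volume element lies in Pf(dX²) times the traces and has top coefficient 1.
  have hL : L = 0 := by
    refine b.ExteriorAlgebra.ext fun s => ?_
    obtain ⟨l', hl', hs, he⟩ := exists_list_basis_exteriorAlgebra b s
    have h1 : traceHom n (b.ExteriorAlgebra s) = (l'.map fun i : Fin n => oddTrace (2 * n) i).prod := by
      rw [he, map_list_prod, List.map_map]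
      congr 2
      funext i
      exact traceHom_ι_basis n i
    change topCoeff (volBasis (2 * n)) (pfaffian n (dMat (2 * n) ^ 2) *
      traceHom n (b.ExteriorAlgebra s)) = 0
    rw [h1]
    by_cases hu : s = Finset.univ
    · have hp : ((l'.map Fin.val).map (oddTrace (2 * n))).Perm (l.map (oddTrace (2 * n))) := by
        refine List.Perm.map _ (List.Perm.trans ?_ hl.symm)
        rw [List.perm_ext_iff_of_nodup (hl'.map Fin.val_injective) List.nodup_range]
        intro a
        simp only [List.mem_map, hs, hu, Finset.mem_univ, true_and, List.mem_range]
        exact ⟨fun ⟨i, hi⟩ => hi ▸ i.2, fun ha => ⟨⟨a, ha⟩, rfl⟩⟩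
      rw [List.map_map] at hp
      have h2 := prod_eq_or_eq_neg_of_perm hp (by
        intro x hx
        obtain ⟨i, _, rfl⟩ := List.mem_map.1 hx
        exact oddTrace_mem_odd _ _)
      change (l'.map fun i : Fin n => oddTrace (2 * n) i).prod = _ ∨
        (l'.map fun i : Fin n => oddTrace (2 * n) i).prod = _ at h2
      rcases h2 with h2 | h2 <;> simp [h2, h0]
    · have hmem : pfaffian n (dMat (2 * n) ^ 2) * (l'.map fun i : Fin n => oddTrace (2 * n) i).prod ∈
          ⋀[ℝ]^(2 * n + (l'.map fun i : Fin n => 4 * (i : ℕ) + 1).sum) (Dual ℝ (symMat (2 * n))) := by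
        rw [exteriorPower, pow_add]
        exact Submodule.mul_mem_mul (pfaffian_dMat_sq_mem_exteriorPower n)
          (list_prod_mem_exteriorPower l' _ _ fun i _ => oddTrace_mem_exteriorPower _ _)
      refine topCoeff_of_mem_exteriorPower _ ?_ hmem
      have h3 : (l'.map fun i : Fin n => 4 * (i : ℕ) + 1).sum = ∑ i ∈ s, (4 * (i : ℕ) + 1) := by
        have : s = l'.toFinset := by ext i; simp [hs]
        rw [this, List.sum_toFinset _ hl']
      have h4 : ∑ i ∈ s, (4 * (i : ℕ) + 1) < ∑ k ∈ Finset.range n, (4 * k + 1) := by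
        rw [← Fin.sum_univ_eq_sum_range fun k => 4 * k + 1]
        obtain ⟨i, hi⟩ := not_forall.1 (mt Finset.eq_univ_iff_forall.2 hu)
        exact Finset.sum_lt_sum_of_subset (Finset.subset_univ s) (Finset.mem_univ i) hi
          (Nat.succ_pos _) fun _ _ _ => Nat.zero_le _
      have h5 := sum_range_four_mul_add_one n
      have h6 := length_upperPairs (2 * n)
      rw [mul_assoc] at h6
      have h7 := Nat.eq_of_mul_eq_mul_left two_pos h6
      omega
  obtain ⟨r, hr, hT⟩ := coordVolume_mem_pfaffianIdeal n
  obtain ⟨y, rfl⟩ := traceAlg_le_range n hr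
  have h1 := topCoeff_coordVolume (2 * n)
  rw [← hT] at h1
  have h2 := LinearMap.congr_fun hL y
  exact zero_ne_one (h2.symm.trans h1)

end OddTraces

/-! ### Equivariance of the invariant forms -/

section Equivariance

open ExteriorAlgebra Module

variable {m : ℕ}

/-- The map induced by `X ↦ gᵀ X g` on the exterior algebra. -/
def congrMap (g : Matrix (Fin m) (Fin m) ℝ) : Ext m →ₐ[ℝ] Ext m :=
  ExteriorAlgebra.map (congr g).dualMap

/-- A real matrix with entries regarded as elements of the exterior algebra. -/
def scalarMat (g : Matrix (Fin m) (Fin m) ℝ) : Matrix (Fin m) (Fin m) (Ext m) :=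
  g.map (algebraMap ℝ (Ext m))

theorem scalarMat_mul (g h : Matrix (Fin m) (Fin m) ℝ) :
    scalarMat (g * h) = scalarMat g * scalarMat h :=
  map_mul (algebraMap ℝ (Ext m)).mapMatrix g h

theorem scalarMat_one : scalarMat (1 : Matrix (Fin m) (Fin m) ℝ) = 1 :=
  map_one (algebraMap ℝ (Ext m)).mapMatrix

theorem congrMap_scalarMat (g h : Matrix (Fin m) (Fin m) ℝ) :
    (congrMap g).mapMatrix (scalarMat h) = scalarMat h := by
  ext i j
  exact AlgHom.commutes _ _

theorem congrMap_dMat (g : Matrix (Fin m) (Fin m) ℝ) :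
    (congrMap g).mapMatrix (dMat m) = scalarMat gᵀ * dMat m * scalarMat g := by
  ext i j
  have h : congrMap g (dX i j) = ∑ k, ∑ l, (g k i * g l j) • dX k l := by
    rw [congrMap, dX_eq, map_apply_ι, dualMap_congr_entry]
    simp only [map_sum, map_smul]
    rfl
  rw [AlgHom.mapMatrix_apply, Matrix.map_apply]
  change congrMap g (dX i j) = _
  rw [h, Finset.sum_comm]
  simp only [Matrix.mul_apply, Finset.sum_mul]
  refine Finset.sum_congr rfl fun l _ => Finset.sum_congr rfl fun k _ => ?_
  simp only [scalarMat, Matrix.map_apply, Matrix.transpose_apply, ← Algebra.smul_def,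
    ← Algebra.commutes (g l j)]
  rw [smul_smul, mul_comm]
  rfl

theorem congr_mat (g : GL (Fin m) ℝ) (X : SPD m) :
    SPD.mat ⟨congr g.1 X.1, congr_posDef g X⟩ = g.1ᵀ * X.mat * g.1 := rfl

theorem GL_mul_inv (g : GL (Fin m) ℝ) : g.1 * g.1⁻¹ = 1 :=
  Matrix.mul_nonsing_inv _ ((Matrix.isUnit_iff_isUnit_det _).1 g.isUnit)

theorem GL_inv_mul (g : GL (Fin m) ℝ) : g.1⁻¹ * g.1 = 1 :=
  Matrix.nonsing_inv_mul _ ((Matrix.isUnit_iff_isUnit_det _).1 g.isUnit)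

theorem invMat_congr (g : GL (Fin m) ℝ) (X : SPD m) :
    invMat ⟨congr g.1 X.1, congr_posDef g X⟩ =
      scalarMat g.1⁻¹ * invMat X * scalarMat g.1ᵀ⁻¹ := by
  rw [invMat, congr_mat, Matrix.mul_inv_rev, Matrix.mul_inv_rev, ← mul_assoc]
  exact (scalarMat_mul _ _).trans (by rw [scalarMat_mul]; rfl)

theorem scalarMat_inv_mul (g : GL (Fin m) ℝ) : scalarMat g.1⁻¹ * scalarMat g.1 = 1 := by
  rw [← scalarMat_mul, GL_inv_mul, scalarMat_one]

theorem scalarMat_mul_inv (g : GL (Fin m) ℝ) : scalarMat g.1 * scalarMat g.1⁻¹ = 1 := by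
  rw [← scalarMat_mul, GL_mul_inv, scalarMat_one]

theorem scalarMat_transpose_inv_mul (g : GL (Fin m) ℝ) :
    scalarMat g.1ᵀ⁻¹ * scalarMat g.1ᵀ = 1 := by
  rw [← scalarMat_mul, ← Matrix.transpose_nonsing_inv, ← Matrix.transpose_mul, GL_mul_inv,
    Matrix.transpose_one, scalarMat_one]

theorem congrMap_invMat_mul_dMat (g : GL (Fin m) ℝ) (X : SPD m) :
    (congrMap g.1).mapMatrix (invMat ⟨congr g.1 X.1, congr_posDef g X⟩ * dMat m) =
      scalarMat g.1⁻¹ * (invMat X * dMat m) * scalarMat g.1 := by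
  have h : (congrMap g.1).mapMatrix (invMat ⟨congr g.1 X.1, congr_posDef g X⟩) =
      scalarMat g.1⁻¹ * invMat X * scalarMat g.1ᵀ⁻¹ := by
    rw [← invMat_congr]
    exact congrMap_scalarMat _ _
  rw [map_mul, h, congrMap_dMat]
  calc scalarMat g.1⁻¹ * invMat X * scalarMat g.1ᵀ⁻¹ * (scalarMat g.1ᵀ * dMat m * scalarMat g.1)
      = scalarMat g.1⁻¹ * invMat X * (scalarMat g.1ᵀ⁻¹ * scalarMat g.1ᵀ) * dMat m *
        scalarMat g.1 := by simp only [mul_assoc]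
    _ = _ := by rw [scalarMat_transpose_inv_mul, mul_one]; simp only [mul_assoc]

theorem trace_scalarMat_comm (g : Matrix (Fin m) (Fin m) ℝ) (Y : Matrix (Fin m) (Fin m) (Ext m)) :
    (Y * scalarMat g).trace = (scalarMat g * Y).trace := by
  simp only [Matrix.trace, Matrix.diag_apply, Matrix.mul_apply]
  rw [Finset.sum_comm]
  exact Finset.sum_congr rfl fun i _ => Finset.sum_congr rfl fun j _ =>
    (Algebra.commutes (g i j) (Y j i)).symm

theorem congrMap_beta (g : GL (Fin m) ℝ) (d : ℕ) (X : SPD m) :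
    congrMap g.1 (beta m d ⟨congr g.1 X.1, congr_posDef g X⟩) = beta m d X := by
  have h : ∀ Y : Matrix (Fin m) (Fin m) (Ext m),
      (scalarMat g.1⁻¹ * Y * scalarMat g.1) ^ d = scalarMat g.1⁻¹ * Y ^ d * scalarMat g.1 := by
    intro Y
    induction d with
    | zero => rw [pow_zero, pow_zero, mul_one, scalarMat_inv_mul]
    | succ d ih =>
      rw [pow_succ, ih]
      calc scalarMat g.1⁻¹ * Y ^ d * scalarMat g.1 * (scalarMat g.1⁻¹ * Y * scalarMat g.1)
          = scalarMat g.1⁻¹ * Y ^ d * (scalarMat g.1 * scalarMat g.1⁻¹) * Y * scalarMat g.1 := by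
            simp only [mul_assoc]
        _ = _ := by rw [scalarMat_mul_inv, mul_one, pow_succ]; simp only [mul_assoc]
  have h2 : congrMap g.1 (beta m d ⟨congr g.1 X.1, congr_posDef g X⟩) =
      ((congrMap g.1).mapMatrix
        ((invMat ⟨congr g.1 X.1, congr_posDef g X⟩ * dMat m) ^ d)).trace := by
    simp [beta, Matrix.trace]
  rw [h2, map_pow, congrMap_invMat_mul_dMat, h, trace_scalarMat_comm,
    ← mul_assoc, scalarMat_mul_inv, one_mul]
  rfl

theorem map_pfaffian {n : ℕ} {A B : Type*} [Ring A] [Algebra ℝ A] [Ring B] [Algebra ℝ B]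
    (f : A →ₐ[ℝ] B) (M : Matrix (Fin (2 * n)) (Fin (2 * n)) A) :
    f (pfaffian n M) = pfaffian n (f.mapMatrix M) := by
  simp only [pfaffian, map_smul, map_sum, map_zsmul, map_list_prod, List.map_ofFn]
  rfl

/-- The Pfaffian contributes det g and the square root |det g|, so only the sign remains. -/
theorem congrMap_phi {n : ℕ} (g : GL (Fin (2 * n)) ℝ) (X : SPD (2 * n)) :
    congrMap g.1 (phi n ⟨congr g.1 X.1, congr_posDef g X⟩) = eps g • phi n X := by
  have h : (congrMap g.1).mapMatrix
      (dMat (2 * n) * invMat ⟨congr g.1 X.1, congr_posDef g X⟩ * dMat (2 * n)) =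
      (scalarMat g.1)ᵀ * (dMat (2 * n) * invMat X * dMat (2 * n)) * scalarMat g.1 := by
    rw [mul_assoc, map_mul, congrMap_invMat_mul_dMat, congrMap_dMat]
    calc scalarMat g.1ᵀ * dMat (2 * n) * scalarMat g.1 *
          (scalarMat g.1⁻¹ * (invMat X * dMat (2 * n)) * scalarMat g.1)
        = scalarMat g.1ᵀ * dMat (2 * n) * (scalarMat g.1 * scalarMat g.1⁻¹) *
          (invMat X * dMat (2 * n)) * scalarMat g.1 := by simp only [mul_assoc]
      _ = _ := by rw [scalarMat_mul_inv, mul_one]; simp only [mul_assoc]; rfl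
  rw [phi, map_smul, map_pfaffian, h, scalarMat, pfaffian_congr, congr_mat, Matrix.det_mul,
    Matrix.det_mul, Matrix.det_transpose, phi, smul_smul, smul_smul]
  congr 1
  rw [show g.1.det * X.mat.det * g.1.det = g.1.det ^ 2 * X.mat.det by ring,
    Real.sqrt_mul (sq_nonneg _), Real.sqrt_sq_eq_abs, eps, mul_inv]
  ring

theorem congrMap_contractEuler (g : GL (Fin m) ℝ) (ω : Form m) (X : SPD m) :
    congrMap g.1 (contractEuler ω ⟨congr g.1 X.1, congr_posDef g X⟩) =
      contract (Dual.eval ℝ (symMat m) X.1)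
        (congrMap g.1 (ω ⟨congr g.1 X.1, congr_posDef g X⟩)) :=
  (contract_map (congr g.1).dualMap (Dual.eval ℝ (symMat m) X.1) _).symm

/-- The factor is (det g / |det g|)^{2n+1}, an odd power of a sign. -/
theorem congrMap_eta {n : ℕ} (g : GL (Fin (2 * n)) ℝ) (X : SPD (2 * n)) :
    congrMap g.1 (eta n ⟨congr g.1 X.1, congr_posDef g X⟩) = eps g • eta n X := by
  have hdet : g.1.det ≠ 0 := ((Matrix.isUnit_iff_isUnit_det _).1 g.isUnit).ne_zero
  rw [eta, congrMap_contractEuler]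
  have h : congrMap g.1 (volumeForm n ⟨congr g.1 X.1, congr_posDef g X⟩) =
      eps g • volumeForm n X := by
    rw [volumeForm, map_smul, congrMap, map_coordVolume, det_congr, congr_mat, Matrix.det_mul,
      Matrix.det_mul, Matrix.det_transpose, volumeForm, smul_smul, smul_smul]
    congr 1
    rw [show g.1.det * X.mat.det * g.1.det = g.1.det ^ 2 * X.mat.det by ring,
      Real.sqrt_mul (sq_nonneg _), Real.sqrt_sq_eq_abs, eps, mul_pow, pow_succ |g.1.det|,
      pow_succ g.1.det, pow_mul, pow_mul g.1.det, sq_abs]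
    have h1 : (g.1.det ^ 2) ^ n ≠ 0 := pow_ne_zero _ (pow_ne_zero _ hdet)
    have h2 : |g.1.det| ≠ 0 := abs_ne_zero.2 hdet
    rw [mul_inv, mul_inv]
    field_simp
  rw [h, map_smul]
  rfl

theorem congrMap_injective (g : GL (Fin m) ℝ) : Function.Injective (congrMap g.1) := by
  have h : (congrMap g.1⁻¹).comp (congrMap g.1) = AlgHom.id ℝ _ := by
    rw [congrMap, congrMap, ExteriorAlgebra.map_comp_map, LinearMap.dualMap_comp_dualMap,
      ← congr_mul, GL_inv_mul, congr_one, LinearMap.dualMap_id, ExteriorAlgebra.map_id]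
  exact Function.LeftInverse.injective (g := congrMap g.1⁻¹) fun x => AlgHom.congr_fun h x

/-- The identity matrix. -/
def onePt (m : ℕ) : SPD m := ⟨⟨1, Matrix.isSymm_one⟩, Matrix.PosDef.one⟩

-- Transitivity of the action: a positive definite X factors as BᵀB, with B invertible because X is.
open scoped MatrixOrder Matrix.Norms.L2Operator in
theorem exists_congr_onePt (X : SPD m) :
    ∃ g : GL (Fin m) ℝ, X = ⟨congr g.1 (onePt m).1, congr_posDef g (onePt m)⟩ := by
  obtain ⟨B, hB⟩ := CStarAlgebra.nonneg_iff_eq_star_mul_self.mp X.2.posSemidef.nonneg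
  have hu : IsUnit B := isUnit_of_mul_isUnit_right (hB ▸ X.2.isUnit)
  refine ⟨hu.unit, Subtype.ext (Subtype.ext ?_)⟩
  rw [hB, Matrix.star_eq_conjTranspose, Matrix.conjTranspose_eq_transpose_of_trivial]
  simp [congr, onePt]

end Equivariance

/-! ### Contraction with the Euler vector field at the identity -/

section EulerAtOne

open ExteriorAlgebra Module

variable {m : ℕ}

/-- Contraction with the value of the Euler vector field at the identity matrix. -/
def contractOne (m : ℕ) : Ext m →ₗ[ℝ] Ext m := contract (Dual.eval ℝ (symMat m) (onePt m).1)

/-- The elements annihilated by contraction with the Euler vector field at the identity. -/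
def eulerKer (m : ℕ) : Subalgebra ℝ (Ext m) where
  carrier := {x | contractOne m x = 0}
  mul_mem' {x y} hx hy := by
    have hx : contractOne m x = 0 := hx
    have hy : contractOne m y = 0 := hy
    change contractOne m (x * y) = 0
    rw [contractOne, contract_mul]
    change contractOne m x * y + parity x * contractOne m y = 0
    rw [hx, hy, zero_mul, mul_zero, add_zero]
  add_mem' {x y} hx hy := by
    have hx : contractOne m x = 0 := hx
    have hy : contractOne m y = 0 := hy
    change contractOne m (x + y) = 0
    rw [map_add, hx, hy, add_zero]
  algebraMap_mem' r := contract_algebraMap _ r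

theorem mem_eulerKer {x : Ext m} : x ∈ eulerKer m ↔ contractOne m x = 0 := Iff.rfl

theorem contractOne_dX_mul (i j : Fin m) (x : Ext m) :
    contractOne m (dX i j * x) = (if i = j then x else 0) - dX i j * contractOne m x := by
  rw [dX_eq, contractOne, contract_ι_mul]
  congr 1
  change ((1 : Matrix (Fin m) (Fin m) ℝ) i j) • x = _
  rw [Matrix.one_apply]
  split_ifs <;> simp

theorem contractOne_dMat_pow_succ (d : ℕ) (i j : Fin m) :
    contractOne m ((dMat m ^ (d + 1)) i j) =
      (dMat m ^ d) i j - ∑ k, dX i k * contractOne m ((dMat m ^ d) k j) := by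
  rw [pow_succ', Matrix.mul_apply, map_sum]
  have h : ∀ k, contractOne m (dMat m i k * (dMat m ^ d) k j) =
      (if i = k then (dMat m ^ d) k j else 0) - dX i k * contractOne m ((dMat m ^ d) k j) :=
    fun k => contractOne_dX_mul i k _
  simp only [h, Finset.sum_sub_distrib, Finset.sum_ite_eq, Finset.mem_univ, if_true]

/-- At the identity, contraction replaces one factor dX by 1 with alternating signs; the terms
cancel in pairs, leaving one exactly when the exponent is odd. -/
theorem contractOne_dMat_pow (k : ℕ) (i j : Fin m) :
    contractOne m ((dMat m ^ (2 * k)) i j) = 0 ∧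
      contractOne m ((dMat m ^ (2 * k + 1)) i j) = (dMat m ^ (2 * k)) i j := by
  induction k generalizing i j with
  | zero =>
    have h : ∀ i j, contractOne m ((dMat m ^ (2 * 0)) i j) = 0 := by
      intro i j
      by_cases h : i = j <;> simp [h, contractOne, contract_one]
    refine ⟨h i j, ?_⟩
    rw [contractOne_dMat_pow_succ, Finset.sum_eq_zero, sub_zero]
    exact fun k _ => by rw [h, mul_zero]
  | succ k ih =>
    have h : ∀ i j, contractOne m ((dMat m ^ (2 * (k + 1))) i j) = 0 := by
      intro i j
      rw [show 2 * (k + 1) = 2 * k + 1 + 1 by ring, contractOne_dMat_pow_succ, sub_eq_zero]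
      conv_lhs => rw [pow_succ', Matrix.mul_apply]
      exact Finset.sum_congr rfl fun l _ => by rw [(ih l j).2]; rfl
    exact ⟨h i j, by rw [contractOne_dMat_pow_succ]; simp [h]⟩

/-- The contraction is tr(dX^{4k}), a positive even power. For k = 0 it would be the scalar m. -/
theorem oddTrace_mem_eulerKer {k : ℕ} (hk : 1 ≤ k) : oddTrace m k ∈ eulerKer m := by
  obtain ⟨k, rfl⟩ := Nat.exists_eq_add_of_le' hk
  have h := trace_dMat_pow_even (m := m) (2 * k + 1)
  rw [mem_eulerKer, oddTrace, Matrix.trace, map_sum, ← h]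
  refine Finset.sum_congr rfl fun i _ => ?_
  rw [Matrix.diag_apply, show 4 * (k + 1) = 2 * (2 * k + 1 + 1) by ring]
  exact (contractOne_dMat_pow _ i i).2

theorem pfaffian_dMat_sq_mem_eulerKer (n : ℕ) :
    pfaffian n (dMat (2 * n) ^ 2) ∈ eulerKer (2 * n) :=
  pfaffian_mem fun i j => (contractOne_dMat_pow 1 i j).1

/-! ### Values of the forms at the identity matrix -/

theorem invMat_onePt (m : ℕ) : invMat (onePt m) = 1 := by
  have h : (onePt m).mat = 1 := rfl
  rw [invMat, h, inv_one]
  exact scalarMat_one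

theorem beta_onePt (m k : ℕ) : beta m (4 * k + 1) (onePt m) = oddTrace m k := by
  rw [beta, invMat_onePt, one_mul, oddTrace]

theorem phi_onePt (n : ℕ) : phi n (onePt (2 * n)) = pfaffian n (dMat (2 * n) ^ 2) := by
  have h : (onePt (2 * n)).mat = 1 := rfl
  rw [phi, invMat_onePt, mul_one, h, Matrix.det_one, Real.sqrt_one, inv_one, one_smul, sq]

theorem eta_onePt (n : ℕ) : eta n (onePt (2 * n)) = contractOne (2 * n) (coordVolume (2 * n)) := by
  have h : (onePt (2 * n)).mat = 1 := rfl
  change contractOne (2 * n) (volumeForm n (onePt (2 * n))) = _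
  rw [volumeForm, h, Matrix.det_one, Real.sqrt_one, one_pow, inv_one, one_smul]

theorem betaProd_apply (n : ℕ) (X : SPD (2 * n)) :
    betaProd n X = ((List.range' 1 (n - 1)).map fun k => beta (2 * n) (4 * k + 1) X).prod := by
  have h := map_list_prod (Pi.evalRingHom (fun _ : SPD (2 * n) => Ext (2 * n)) X)
    ((List.range' 1 (n - 1)).map fun k => beta (2 * n) (4 * k + 1))
  rw [List.map_map] at h
  exact h

theorem betaProd_onePt (n : ℕ) :
    betaProd n (onePt (2 * n)) = ((List.range' 1 (n - 1)).map (oddTrace (2 * n))).prod := by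
  rw [betaProd_apply]
  congr 2
  funext k
  exact beta_onePt _ _

/-! ### Integrality and comparison with the projective volume form -/

/-- The subring generated by the forms `dX_{ij}`. -/
def integralForms (m : ℕ) : Subring (Ext m) :=
  Subring.closure (Set.range fun s => ι ℝ (volBasis m s))

theorem dX_mem_integralForms (i j : Fin m) : dX i j ∈ integralForms m := by
  wlog h : i ≤ j
  · rw [dX_comm]
    exact this j i (le_of_not_ge h)
  obtain ⟨s, hs⟩ := List.get_of_mem ((mem_upperPairs (q := (i, j))).2 h)
  refine Subring.subset_closure ⟨s, ?_⟩
  simp only [volBasis_apply, hs]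
  rfl

theorem dMat_pow_mem_integralForms (d : ℕ) (i j : Fin m) : (dMat m ^ d) i j ∈ integralForms m := by
  induction d generalizing j with
  | zero => by_cases h : i = j <;> simp [h, zero_mem, one_mem]
  | succ d ih =>
    rw [pow_succ, Matrix.mul_apply]
    exact sum_mem fun k _ => mul_mem (ih k) (dX_mem_integralForms _ _)

theorem oddTrace_mem_integralForms (k : ℕ) : oddTrace m k ∈ integralForms m := by
  rw [oddTrace, Matrix.trace]
  exact sum_mem fun i _ => dMat_pow_mem_integralForms _ i i

theorem pfaffian_dMat_sq_mem_integralForms (n : ℕ) :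
    pfaffian n (dMat (2 * n) ^ 2) ∈ integralForms (2 * n) := by
  refine pfaffian_mem_closure _ (fun i j => ?_) (fun i j k l => ?_) _
    fun i j => dMat_pow_mem_integralForms 2 i j
  · rw [dMat_pow_swap, show revSign 2 = -1 from rfl, neg_one_zsmul]
  · exact (Subalgebra.mem_center_iff.1 (dMat_sq_mem_center i j) _).symm

theorem betaProd_mul_phi_onePt_ne_zero {n : ℕ} (hn : 1 ≤ n) :
    (betaProd n * phi n) (onePt (2 * n)) ≠ 0 := by
  intro h
  have hl : List.range n = 0 :: List.range' 1 (n - 1) := by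
    obtain ⟨n, rfl⟩ := Nat.exists_eq_add_of_le' hn
    rw [List.range_eq_range', List.range'_succ]
    rfl
  refine pfaffian_mul_oddTraces_ne_zero n (List.Perm.refl _) ?_
  rw [pfaffian_dMat_sq_comm, hl, List.map_cons, List.prod_cons, mul_assoc, ← betaProd_onePt,
    ← phi_onePt]
  exact mul_eq_zero_of_right _ h

theorem four_mul_length_sum (n : ℕ) (hn : 1 ≤ n) :
    1 + (((List.range' 1 (n - 1)).map fun k => 4 * k + 1).sum + 2 * n) =
      (upperPairs (2 * n)).length := by
  obtain ⟨n, rfl⟩ := Nat.exists_eq_add_of_le' hn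
  have h5 := sum_range_four_mul_add_one (n + 1)
  have h6 := length_upperPairs (2 * (n + 1))
  rw [mul_assoc] at h6
  have h7 := Nat.eq_of_mul_eq_mul_left two_pos h6
  have h8 : ∑ k ∈ Finset.range (n + 1), (4 * k + 1) =
      1 + ((List.range' 1 (n + 1 - 1)).map fun k => 4 * k + 1).sum := by
    have h9 : List.range (n + 1) = 0 :: List.range' 1 n := by
      rw [List.range_eq_range', List.range'_succ]
    have : ∑ k ∈ Finset.range (n + 1), (4 * k + 1) =
        ((List.range (n + 1)).map fun k => 4 * k + 1).sum := rfl
    rw [this, h9, List.map_cons, List.sum_cons]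
    rfl
  omega

theorem exists_int_betaProd_mul_phi_onePt {n : ℕ} (hn : 1 ≤ n) : ∃ c : ℤ, c ≠ 0 ∧
    (betaProd n * phi n) (onePt (2 * n)) = (c : ℝ) • eta n (onePt (2 * n)) := by
  have hne := betaProd_mul_phi_onePt_ne_zero hn
  set w := (betaProd n * phi n) (onePt (2 * n)) with hw
  have hw' : w = ((List.range' 1 (n - 1)).map (oddTrace (2 * n))).prod *
      pfaffian n (dMat (2 * n) ^ 2) := by
    rw [hw, Pi.mul_apply, betaProd_onePt, phi_onePt]
  -- Any diagonal position would do: dX_{zz} contracts to 1 with the Euler field at the identity,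
  -- and wedging with it raises w to top degree.
  let z : Fin (2 * n) := ⟨0, by omega⟩
  have hker : contractOne (2 * n) w = 0 := by
    rw [hw', ← mem_eulerKer]
    refine mul_mem (list_prod_mem fun x hx => ?_) (pfaffian_dMat_sq_mem_eulerKer n)
    obtain ⟨k, hk, rfl⟩ := List.mem_map.1 hx
    exact oddTrace_mem_eulerKer (List.mem_range'_1.1 hk).1
  have hint : dX z z * w ∈ integralForms (2 * n) := by
    rw [hw']
    refine mul_mem (dX_mem_integralForms _ _) (mul_mem (list_prod_mem fun x hx => ?_)
      (pfaffian_dMat_sq_mem_integralForms n))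
    obtain ⟨k, hk, rfl⟩ := List.mem_map.1 hx
    exact oddTrace_mem_integralForms k
  have hdeg : dX z z * w ∈ ⋀[ℝ]^(upperPairs (2 * n)).length (Dual ℝ (symMat (2 * n))) := by
    rw [← four_mul_length_sum n hn, hw', exteriorPower, pow_add, pow_add, pow_one]
    exact Submodule.mul_mem_mul ⟨_, rfl⟩ (Submodule.mul_mem_mul
      (list_prod_mem_exteriorPower _ _ _ fun k _ => oddTrace_mem_exteriorPower _ k)
      (pfaffian_dMat_sq_mem_exteriorPower n))
  obtain ⟨c, hc⟩ := topCoeff_mem_int (volBasis (2 * n)) hint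
  have h1 := eq_topCoeff_smul (volBasis (2 * n)) hdeg
  rw [hc, ← coordVolume_eq_ιMulti] at h1
  have h2 := congrArg (contractOne (2 * n)) h1
  rw [contractOne_dX_mul, if_pos rfl, hker, mul_zero, sub_zero, map_smul, ← eta_onePt] at h2
  refine ⟨c, ?_, h2⟩
  rintro rfl
  rw [Int.cast_zero, zero_smul] at h2
  exact hne h2

theorem congrMap_betaProd {n : ℕ} (g : GL (Fin (2 * n)) ℝ) (X : SPD (2 * n)) :
    congrMap g.1 (betaProd n ⟨congr g.1 X.1, congr_posDef g X⟩) = betaProd n X := by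
  rw [betaProd_apply, betaProd_apply, map_list_prod, List.map_map]
  congr 2
  funext k
  exact congrMap_beta g _ X

/-- The product of the odd trace forms and the Pfaffian form is a multiple of the projective
volume orientation form. -/
theorem exists_int_betaProd_mul_phi {n : ℕ} (hn : 1 ≤ n) :
    ∃ c : ℤ, c ≠ 0 ∧ betaProd n * phi n = (c : ℝ) • eta n := by
  obtain ⟨c, hc, h⟩ := exists_int_betaProd_mul_phi_onePt hn
  refine ⟨c, hc, funext fun X => ?_⟩
  -- Both sides transform by the same character `eps`, so the identity at X = 1 propagates to every
  -- point.
  obtain ⟨g, rfl⟩ := exists_congr_onePt X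
  apply congrMap_injective g
  rw [Pi.mul_apply, Pi.smul_apply, map_mul, map_smul, congrMap_betaProd, congrMap_phi,
    congrMap_eta, mul_smul_comm, smul_comm, ← h]
  rfl

end EulerAtOne

/-! ### Smoothness of the invariant forms -/

section Smooth

open ExteriorAlgebra Module

attribute [local instance] Matrix.normedAddCommGroup Matrix.normedSpace

variable {m : ℕ}

/-- The open cone of positive definite matrices. -/
def posCone (m : ℕ) : Set (symMat m) := {Y | (Y : Matrix (Fin m) (Fin m) ℝ).PosDef}

/-- Real functions which are smooth on the cone of positive definite matrices. -/
def IsSmoothFun (f : symMat m → ℝ) : Prop := ContDiffOn ℝ ((⊤ : ℕ∞) : WithTop ℕ∞) f (posCone m)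

/-- The forms with smooth coefficients. -/
def smoothSpan (m : ℕ) : Submodule ℝ (Form m) :=
  Submodule.span ℝ {ω | ∃ (f : symMat m → ℝ) (c : Ext m), IsSmoothFun f ∧ ω = fun X => f X.1 • c}

theorem smul_const_mem_smoothSpan {f : symMat m → ℝ} (hf : IsSmoothFun f) (c : Ext m) :
    (fun X : SPD m => f X.1 • c) ∈ smoothSpan m :=
  Submodule.subset_span ⟨f, c, hf, rfl⟩

/-- The algebra of forms with smooth coefficients. -/
def smoothAlg (m : ℕ) : Subalgebra ℝ (Form m) :=
  (smoothSpan m).toSubalgebra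
    (by
      have h := smul_const_mem_smoothSpan (m := m) (f := fun _ => 1) contDiffOn_const 1
      simp only [one_smul] at h
      exact h)
    (by
      intro x y hx hy
      induction hx, hy using Submodule.span_induction₂ with
      | mem_mem x y hx hy =>
        obtain ⟨f, c, hf, rfl⟩ := hx
        obtain ⟨f', c', hf', rfl⟩ := hy
        have h := smul_const_mem_smoothSpan (ContDiffOn.mul hf hf') (c * c')
        have h2 : ((fun X : SPD m => f X.1 • c) * fun X : SPD m => f' X.1 • c') =
            fun X : SPD m => (f X.1 * f' X.1) • (c * c') := by
          funext X
          exact smul_mul_smul_comm _ _ _ _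
        rw [h2]
        exact h
      | zero_left y _ => rw [zero_mul]; exact zero_mem _
      | zero_right x _ => rw [mul_zero]; exact zero_mem _
      | add_left x y z _ _ _ hx hy => rw [add_mul]; exact add_mem hx hy
      | add_right x y z _ _ _ hx hy => rw [mul_add]; exact add_mem hx hy
      | smul_left r x y _ _ h => rw [smul_mul_assoc]; exact Submodule.smul_mem _ _ h
      | smul_right r x y _ _ h => rw [mul_smul_comm]; exact Submodule.smul_mem _ _ h)

theorem mem_smoothAlg {ω : Form m} : ω ∈ smoothAlg m ↔ ω ∈ smoothSpan m := Iff.rfl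

theorem isSmooth_of_mem_smoothAlg {ω : Form m} (h : ω ∈ smoothAlg m) : IsSmooth ω := by
  rw [mem_smoothAlg] at h
  induction h using Submodule.span_induction with
  | mem ω h =>
    obtain ⟨f, c, hf, rfl⟩ := h
    exact fun l => ⟨fun Y => f Y * l c, ContDiffOn.mul hf contDiffOn_const, fun X => by simp⟩
  | zero => exact IsSmooth.zero
  | add x y _ _ hx hy => exact hx.add hy
  | smul c x _ hx => exact hx.smul c

theorem isSmoothFun_entry (i j : Fin m) : IsSmoothFun fun Y : symMat m => Y.1 i j :=
  (LinearMap.toContinuousLinearMap (entry i j)).contDiff.contDiffOn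

theorem isSmoothFun_det {M : symMat m → Matrix (Fin m) (Fin m) ℝ}
    (hM : ∀ i j, IsSmoothFun fun Y => M Y i j) : IsSmoothFun fun Y => (M Y).det := by
  simp only [IsSmoothFun, Matrix.det_apply']
  exact ContDiffOn.sum fun σ _ => contDiffOn_const.mul (contDiffOn_prod fun i _ => hM _ _)

theorem isSmoothFun_inv {f : symMat m → ℝ} (hf : IsSmoothFun f) (h : ∀ Y ∈ posCone m, f Y ≠ 0) :
    IsSmoothFun fun Y => (f Y)⁻¹ :=
  ContDiffOn.inv hf h

/-- Cramer's rule writes the entry as a quotient of polynomials whose denominator is positive on the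
cone. -/
theorem isSmoothFun_inv_entry (i j : Fin m) : IsSmoothFun fun Y : symMat m => Y.1⁻¹ i j := by
  have h1 : ∀ Y : symMat m, Y.1⁻¹ i j = Y.1.det⁻¹ * (Y.1.updateRow j (Pi.single i 1)).det := by
    intro Y
    rw [Matrix.inv_def, Matrix.smul_apply, Matrix.adjugate_apply, Ring.inverse_eq_inv, smul_eq_mul]
  simp only [h1]
  refine ContDiffOn.mul (isSmoothFun_inv (isSmoothFun_det isSmoothFun_entry)
    fun Y hY => ne_of_gt (Matrix.PosDef.det_pos hY)) (isSmoothFun_det fun k l => ?_)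
  by_cases hk : k = j
  · subst hk
    simp only [Matrix.updateRow_self]
    exact contDiffOn_const
  · simp only [Matrix.updateRow_ne hk]
    exact isSmoothFun_entry k l

theorem isSmoothFun_sqrt_det_inv : IsSmoothFun fun Y : symMat m => (Real.sqrt Y.1.det)⁻¹ :=
  isSmoothFun_inv (ContDiffOn.sqrt (isSmoothFun_det isSmoothFun_entry)
    fun _ hY => ne_of_gt (Matrix.PosDef.det_pos hY))
    fun _ hY => ne_of_gt (Real.sqrt_pos.2 (Matrix.PosDef.det_pos hY))

/-- The matrix of constant forms `dX_{ij}`. -/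
def dForm (m : ℕ) : Matrix (Fin m) (Fin m) (Form m) := Matrix.of fun i j _ => dMat m i j

/-- The matrix of functions `X⁻¹`, regarded as forms of degree zero. -/
def invForm (m : ℕ) : Matrix (Fin m) (Fin m) (Form m) := Matrix.of fun i j X => invMat X i j

theorem matrix_mul_mem {ι A : Type*} [Fintype ι] [Ring A] [Algebra ℝ A] {S : Subalgebra ℝ A}
    {M N : Matrix ι ι A} (hM : ∀ i j, M i j ∈ S) (hN : ∀ i j, N i j ∈ S) (i j : ι) :
    (M * N) i j ∈ S := by
  rw [Matrix.mul_apply]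
  exact sum_mem fun k _ => mul_mem (hM _ _) (hN _ _)

theorem matrix_pow_mem {ι A : Type*} [Fintype ι] [DecidableEq ι] [Ring A] [Algebra ℝ A]
    {S : Subalgebra ℝ A} {M : Matrix ι ι A} (hM : ∀ i j, M i j ∈ S) (d : ℕ) (i j : ι) :
    (M ^ d) i j ∈ S := by
  induction d generalizing i j with
  | zero => by_cases h : i = j <;> simp [h, zero_mem, one_mem]
  | succ d ih =>
    rw [pow_succ]
    exact matrix_mul_mem ih hM i j

theorem dForm_mem (i j : Fin m) : dForm m i j ∈ smoothAlg m := by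
  have h := smul_const_mem_smoothSpan (m := m) (f := fun _ => 1) contDiffOn_const (dMat m i j)
  simp only [one_smul] at h
  exact h

theorem invForm_mem (i j : Fin m) : invForm m i j ∈ smoothAlg m := by
  have h := smul_const_mem_smoothSpan (isSmoothFun_inv_entry (m := m) i j) 1
  simp only [← Algebra.algebraMap_eq_smul_one] at h
  exact h

/-- Evaluation of forms at a point. -/
def evalForm (X : SPD m) : Form m →ₐ[ℝ] Ext m := Pi.evalAlgHom ℝ (fun _ : SPD m => Ext m) X

theorem beta_eq_trace (d : ℕ) : beta m d = ((invForm m * dForm m) ^ d).trace := by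
  funext X
  have h1 : (evalForm X).mapMatrix (invForm m * dForm m) = invMat X * dMat m := by
    rw [map_mul]
    rfl
  have h2 : evalForm X ((invForm m * dForm m) ^ d).trace =
      ((evalForm X).mapMatrix ((invForm m * dForm m) ^ d)).trace := by
    simp [Matrix.trace]
  change _ = evalForm X ((invForm m * dForm m) ^ d).trace
  rw [h2, map_pow, h1]
  rfl

theorem beta_mem_smoothAlg (d : ℕ) : beta m d ∈ smoothAlg m := by
  rw [beta_eq_trace, Matrix.trace]
  exact sum_mem fun i _ => matrix_pow_mem (matrix_mul_mem invForm_mem dForm_mem) d i i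

theorem phi_mem_smoothAlg (n : ℕ) : phi n ∈ smoothAlg (2 * n) := by
  have h : phi n = (fun X : SPD (2 * n) => (Real.sqrt X.1.1.det)⁻¹ • (1 : Ext (2 * n))) *
      pfaffian n (dForm (2 * n) * invForm (2 * n) * dForm (2 * n)) := by
    funext X
    have h1 : (evalForm X).mapMatrix (dForm (2 * n) * invForm (2 * n) * dForm (2 * n)) =
        dMat (2 * n) * invMat X * dMat (2 * n) := by
      rw [map_mul, map_mul]
      rfl
    have h2 := map_pfaffian (evalForm X) (dForm (2 * n) * invForm (2 * n) * dForm (2 * n))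
    rw [h1] at h2
    rw [Pi.mul_apply, smul_mul_assoc, one_mul]
    exact congrArg (fun y => (Real.sqrt X.1.1.det)⁻¹ • y) h2.symm
  rw [h]
  exact mul_mem (smul_const_mem_smoothSpan isSmoothFun_sqrt_det_inv 1)
    (pfaffian_mem (matrix_mul_mem (matrix_mul_mem dForm_mem invForm_mem) dForm_mem))

end Smooth

/-! ### Canonical forms of non-compact type -/

section Canonical

open ExteriorAlgebra Module

variable {m : ℕ}

/-- The forms invariant under all the maps `X ↦ gᵀ X g`. -/
def invariantAlg (m : ℕ) : Subalgebra ℝ (Form m) where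
  carrier := {ω | ∀ (g : GL (Fin m) ℝ) (X : SPD m),
    congrMap g.1 (ω ⟨congr g.1 X.1, congr_posDef g X⟩) = ω X}
  mul_mem' {x y} hx hy g X := by
    rw [Pi.mul_apply, map_mul, hx, hy]
    rfl
  add_mem' {x y} hx hy g X := by
    rw [Pi.add_apply, map_add, hx, hy]
    rfl
  algebraMap_mem' r g X := (congrMap g.1).commutes r

/-- The smooth invariant forms annihilated by contraction with the Euler vector field. -/
def basicAlg (m : ℕ) : Subalgebra ℝ (Form m) :=
  smoothAlg m ⊓ invariantAlg m ⊓ (eulerKer m).comap (evalForm (onePt m))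

theorem beta_mem_basicAlg {k : ℕ} (hk : 1 ≤ k) : beta m (4 * k + 1) ∈ basicAlg m := by
  refine ⟨⟨beta_mem_smoothAlg _, fun g X => congrMap_beta g _ X⟩, ?_⟩
  change beta m (4 * k + 1) (onePt m) ∈ eulerKer m
  rw [beta_onePt]
  exact oddTrace_mem_eulerKer hk

theorem realize_mem_basicAlg (n : ℕ) (ω : OmegaNC n) : realize n ω ∈ basicAlg (2 * n) := by
  have hsmul : ∀ (q : ℚ) (x : Form (2 * n)), x ∈ basicAlg (2 * n) → q • x ∈ basicAlg (2 * n) := by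
    intro q x hx
    rw [← Rat.cast_smul_eq_qsmul ℝ]
    exact (basicAlg (2 * n)).smul_mem hx _
  induction ω using ExteriorAlgebra.induction with
  | algebraMap r =>
    rw [AlgHom.commutes, Algebra.algebraMap_eq_smul_one]
    exact hsmul _ _ (one_mem _)
  | ι v =>
    rw [realize, lift_ι_apply, Finsupp.linearCombination_apply]
    exact sum_mem fun k _ => hsmul _ _ (beta_mem_basicAlg k.2.1)
  | mul x y hx hy => rw [map_mul]; exact mul_mem hx hy
  | add x y hx hy => rw [map_add]; exact add_mem hx hy

theorem contractEuler_eq_zero {ω : Form m} (c : GL (Fin m) ℝ → ℝ)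
    (h : ∀ (g : GL (Fin m) ℝ) (X : SPD m),
      congrMap g.1 (ω ⟨congr g.1 X.1, congr_posDef g X⟩) = c g • ω X)
    (h1 : ω (onePt m) ∈ eulerKer m) : contractEuler ω = 0 := by
  funext X
  obtain ⟨g, rfl⟩ := exists_congr_onePt X
  apply congrMap_injective g
  rw [congrMap_contractEuler, h, map_smul]
  change c g • contractOne m (ω (onePt m)) = congrMap g.1 0
  rw [mem_eulerKer.1 h1, smul_zero, map_zero]

theorem pullback_of_eq {T T' : symMat m →ₗ[ℝ] symMat m} (h : T = T')
    (hT : ∀ X : SPD m, (T X.1 : Matrix (Fin m) (Fin m) ℝ).PosDef)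
    (hT' : ∀ X : SPD m, (T' X.1 : Matrix (Fin m) (Fin m) ℝ).PosDef) (ω : Form m) :
    pullback T hT ω = pullback T' hT' ω := by
  subst h
  rfl

/-- Scaling by t is congruence by the scalar matrix √t, of positive determinant, so invariance under
scalings is a case of equivariance. -/
theorem exists_congr_eq_smul {t : ℝ} (ht : 0 < t) :
    ∃ g : GL (Fin m) ℝ, eps g = 1 ∧ (t • LinearMap.id : symMat m →ₗ[ℝ] symMat m) = congr g.1 := by
  have hs : 0 < Real.sqrt t := Real.sqrt_pos.2 ht
  refine ⟨Units.map (Matrix.scalar (Fin m)).toMonoidHom (Units.mk0 _ hs.ne'), ?_, ?_⟩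
  · have h : 0 < (Matrix.scalar (Fin m) (Real.sqrt t)).det := by
      simp [hs]
    change (Matrix.scalar (Fin m) (Real.sqrt t)).det *
      |(Matrix.scalar (Fin m) (Real.sqrt t)).det|⁻¹ = 1
    rw [abs_of_pos h, mul_inv_cancel₀ h.ne']
  · refine LinearMap.ext fun X => Subtype.ext ?_
    change t • X.1 = (Matrix.scalar (Fin m) (Real.sqrt t))ᵀ * X.1 *
      Matrix.scalar (Fin m) (Real.sqrt t)
    ext i j
    simp only [Matrix.scalar_apply, Matrix.diagonal_transpose, Matrix.mul_diagonal,
      Matrix.diagonal_mul, Matrix.smul_apply, smul_eq_mul]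
    nth_rw 1 [← Real.mul_self_sqrt ht.le]
    ring

theorem wedgePhi_apply (n : ℕ) (ω : OmegaNC n) : wedgePhi n ω = realize n ω * phi n := rfl

theorem wedgePhi_mem (n : ℕ) (ω : OmegaNC n) : wedgePhi n ω ∈ linkOrientationForms (2 * n) := by
  obtain ⟨⟨hsm, hinv⟩, hker⟩ := realize_mem_basicAlg n ω
  have h : ∀ (g : GL (Fin (2 * n)) ℝ) (X : SPD (2 * n)),
      congrMap g.1 (wedgePhi n ω ⟨congr g.1 X.1, congr_posDef g X⟩) =
        eps g • wedgePhi n ω X := by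
    intro g X
    rw [wedgePhi_apply, Pi.mul_apply, Pi.mul_apply, map_mul, hinv g X, congrMap_phi, mul_smul_comm]
  have hpull : ∀ g : GL (Fin (2 * n)) ℝ,
      pullback (congr g.1) (congr_posDef g) (wedgePhi n ω) = eps g • wedgePhi n ω :=
    fun g => funext fun X => h g X
  refine ⟨⟨isSmooth_of_mem_smoothAlg (mul_mem hsm (phi_mem_smoothAlg n)),
    contractEuler_eq_zero eps h ?_, fun t ht => ?_⟩, hpull⟩
  · rw [wedgePhi_apply, Pi.mul_apply, phi_onePt]
    exact mul_mem hker (pfaffian_dMat_sq_mem_eulerKer n)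
  · obtain ⟨g, hg, hT⟩ := exists_congr_eq_smul (m := 2 * n) ht
    rw [pullback_of_eq hT _ (congr_posDef g), hpull, hg, one_smul]

/-- Multiplying by the missing odd traces gives the full product, which is non-zero. -/
theorem list_prod_oddTrace_mul_pfaffian_ne_zero (n : ℕ) {l : List ℕ} (hl : l.Nodup)
    (hln : ∀ k ∈ l, k < n) :
    (l.map (oddTrace (2 * n))).prod * pfaffian n (dMat (2 * n) ^ 2) ≠ 0 := by
  intro h
  have hp : ((List.range n).filter (fun k => k ∉ l) ++ l).Perm (List.range n) := by
    rw [List.perm_ext_iff_of_nodup _ List.nodup_range]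
    · intro k
      by_cases hk : k ∈ l <;> simp [hk, hln]
    · refine List.Nodup.append (List.nodup_range.filter _) hl ?_
      intro k hk hk'
      simp [hk'] at hk
  refine pfaffian_mul_oddTraces_ne_zero n hp ?_
  rw [pfaffian_dMat_sq_comm, List.map_append, List.prod_append, mul_assoc, h, mul_zero]

/-- The kernel is a left ideal. If it were non-zero it would contain the product of all generators,
whose image is already non-zero at the identity matrix. -/
theorem wedgePhi_injective (n : ℕ) : Function.Injective (wedgePhi n) := by
  rw [← LinearMap.ker_eq_bot]
  by_contra hJ
  let b : Basis (NCIndex n) ℚ (NCIndex n →₀ ℚ) := Finsupp.basisSingleOne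
  have : Fintype (NCIndex n) := Fintype.ofInjective
    (fun k : NCIndex n => (⟨k.1, by have := k.2.2; omega⟩ : Fin n))
    fun k k' h => Subtype.ext (Fin.mk.inj_iff.1 h)
  have h := basis_univ_mem_of_ne_bot b (J := LinearMap.ker (wedgePhi n)) (fun x y hy => by
    rw [LinearMap.mem_ker, wedgePhi_apply] at hy ⊢
    rw [map_mul, mul_assoc, hy, mul_zero]) hJ
  obtain ⟨l, hl, -, he⟩ := exists_list_basis_exteriorAlgebra b Finset.univ
  rw [he, LinearMap.mem_ker, wedgePhi_apply, map_list_prod, List.map_map] at h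
  have h1 := congrArg (evalForm (onePt (2 * n))) h
  rw [map_mul, map_list_prod, List.map_map, map_zero] at h1
  refine list_prod_oddTrace_mul_pfaffian_ne_zero n (hl.map Subtype.val_injective) ?_ ?_
  · intro k hk
    obtain ⟨k, _, rfl⟩ := List.mem_map.1 hk
    have := k.2.2
    omega
  · rw [← phi_onePt, List.map_map]
    refine Eq.trans ?_ h1
    congr 3
    funext k
    have h2 : realize n (ι ℚ (b k)) = beta (2 * n) (4 * k.1 + 1) := by
      rw [realize, lift_ι_apply, Finsupp.coe_basisSingleOne, Finsupp.linearCombination_single,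
        one_smul]
    simp only [Function.comp_apply, h2]
    exact (beta_onePt _ _).symm

end Canonical

end

end PfaffianForms

theorem proposition3p1 (n : ℕ) (hn : 1 ≤ n) :
    (∃ c : ℤ, c ≠ 0 ∧
      PfaffianForms.betaProd n * PfaffianForms.phi n = (c : ℝ) • PfaffianForms.eta n) ∧
    (∀ ω : PfaffianForms.OmegaNC n,
      PfaffianForms.wedgePhi n ω ∈ PfaffianForms.linkOrientationForms (2 * n)) ∧
    Function.Injective (PfaffianForms.wedgePhi n) :=
  ⟨PfaffianForms.exists_int_betaProd_mul_phi hn, PfaffianForms.wedgePhi_mem n,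
    PfaffianForms.wedgePhi_injective n⟩
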